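/- Let $0<u_-<u_+<1$ with $u_-+u_+=1$. Put $s(u)=u\log u+(1-u)\log(1-u)$ on $[0,1]$ (with $0\log 0=0$), $g(u,\varphi,p)=s(u)+s(p)+(1-u)\varphi-\log(1+e^\varphi)$, and $\varphi_\pm=s'(u_\pm)=\log\frac{u_\pm}{1-u_\pm}$. Let $\mathcal C$ be the set of absolutely continuous $\varphi:\mathbb R\to\mathbb R$ with $0\le\varphi'\le1$ a.e. and $\lim_{x\to\pm\infty}\varphi(x)=\varphi_\pm$, with the topology of uniform convergence, and let $\mathcal X=L^\infty(\mathbb R;[0,1])\times\mathcal C$ with the product of the weak* topology and that of $\mathcal C$. Write $(\tau_z w)(x)=w(x-z)$, $\tau_z(u,\varphi)=(\tau_zu,\tau_z\varphi)$, and $\vartheta_{a,b}=a\mathbf 1_{(-\infty,0)}+b\mathbf 1_{[0,\infty)}$. Let $\mathcal D\subset\mathcal X$ be the set of $(u,\varphi)$ with $\|u-\vartheta_{u_-,u_+}\|_{L^2(\mathbb R)}+\|\varphi-\vartheta_{\varphi_-,\varphi_+}\|_{L^1(\mathbb R)}<\infty$, and set $$\mathcal G(u,\varphi)=\int_{\mathbb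 R}\big[g(u,\varphi,\varphi')-g(u_+,\varphi_+,0)\big]\,dx\ \text{ on }\mathcal D,\qquad \mathcal G=+\infty\ \text{ on }\mathcal X\setminus\mathcal D.$$ For $\ell>0$ let $\mathcal G_\ell(u,\varphi)=\int_{-\ell}^{\ell}[g(u,\varphi,\varphi')-g(u_+,\varphi_+,0)]\,dx$ if $(u,\varphi)=(u_-,\varphi_-)$ on $(-\infty,-\ell]$ and $(u,\varphi)=(u_+,\varphi_+)$ on $[\ell,\infty)$, and $\mathcal G_\ell=+\infty$ otherwise. Let $\bar u(x)=\frac12+(u_+-\frac12)\tanh[(u_+-\frac12)x]$ and $\bar\varphi=s'(\bar u)$. (i) For $(u,\varphi)\in\mathcal D$ the integrand of $\mathcal G$ is integrable. There is a constant $C\in(1,\infty)$ such that for every $(u,\varphi)\in\mathcal D$ $$\mathcal G(u,\varphi)\le C\big(\|u-\vartheta_{u_-,u_+}\|_{L^2(\mathbb R)}^2+\|\varphi-\vartheta_{\varphi_-,\varphi_+}\|_{L^1(\mathbb R)}\big)+C,$$ $$\mathcal G(u,\varphi)\ge \frac1C\big(\|u-\tau_z\vartheta_{u_-,u_+}\|_{L^2(\mathbb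 R)}^2+\|\varphi-\tau_z\vartheta_{\varphi_-,\varphi_+}\|_{L^1(\mathbb R)}\big)-C$$ for some $z\in\mathbb R$ depending on $(u,\varphi)$. The functional $\mathcal G$ is lower semicontinuous on $\mathcal X$. The $C^2$ solutions $v$ of $v''-[v(1-v)]'=0$ on $\mathbb R$ with $\lim_{x\to\pm\infty}v(x)=u_\pm$ are exactly the translates $\tau_z\bar u$, $z\in\mathbb R$. The pair $(\bar u,\bar\varphi)$ belongs to $\mathcal X$, and the set of minimizers of $\mathcal G$ on $\mathcal X$ is $\{(v,s'(v)): v \text{ such a solution}\}=\{(\tau_z\bar u,\tau_z\bar\varphi):z\in\mathbb R\}$. (ii) If $\ell_n\to\infty$, $(u_n,\varphi_n)\in\mathcal X$ and $\limsup_n\mathcal G_{\ell_n}(u_n,\varphi_n)<+\infty$, there are $z_n\in\mathbb R$ such that $\{\tau_{z_n}(u_n,\varphi_n)\}_n$ is precompact in $\mathcal X$; likewise, for a family $(u_\ell,\varphi_\ell)$ with a real parameter and $\limsup_{\ell\to\infty}\mathcal G_\ell(u_\ell,\varphi_\ell)<+\infty$, there are $z_\ell\in\mathbb R$ such that $\{\tau_{z_\ell}(u_\ell,\varphi_\ell)\}_{\ell\ge\ell_0}$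 is precompact for some $\ell_0$. As $\ell\to\infty$, $\mathcal G_\ell$ $\Gamma$-converges to $\mathcal G$ on $\mathcal X$. Finally, for every $\ell>0$ the problem $v''-[v(1-v)]'=0$ in $(-\ell,\ell)$, $v(\pm\ell)=u_\pm$, has a unique solution $\bar u_\ell\in C([-\ell,\ell])\cap C^2((-\ell,\ell))$; extend it by $u_-$ to the left of $-\ell$ and by $u_+$ to the right of $\ell$, and put $\bar\varphi_\ell=s'(\bar u_\ell)$. For every $\ell\ge\varphi_+$ the pair $(\bar u_\ell,\bar\varphi_\ell)$ belongs to $\mathcal X$ and is the unique minimizer of $\mathcal G_\ell$, and $(\bar u_\ell,\bar\varphi_\ell)\to(\bar u,\bar\varphi)$ in $\mathcal X$ as $\ell\to\infty$. -/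

import Mathlib

open MeasureTheory Set Filter Topology
open scoped ENNReal

noncomputable section

namespace BurgersGamma

/-! ### The integrand -/

/-- `s(u) = u log u + (1-u) log (1-u)`, with `0 log 0 = 0`. -/
def entropy (u : ℝ) : ℝ := u * Real.log u + (1 - u) * Real.log (1 - u)

/-- `s'(u) = log (u / (1-u))`, for `u` in `(0,1)`. -/
def chem (u : ℝ) : ℝ := Real.log (u / (1 - u))

/-- `g(u,φ,p) = s(u) + s(p) + (1-u) φ - log (1 + e^φ)`. -/
def gFun (u φ p : ℝ) : ℝ :=
  entropy u + entropy p + (1 - u) * φ - Real.log (1 + Real.exp φ)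

/-! ### The space `L^∞(ℝ;[0,1])` with the weak* topology -/

/-- Elements of `L^∞(ℝ)` with values in `[0,1]`. -/
structure LinfUnit where
  /-- the underlying class of functions -/
  val : Lp ℝ ∞ (volume : Measure ℝ)
  mem_unit : ∀ᵐ y, val y ∈ Icc (0 : ℝ) 1

instance : CoeFun LinfUnit (fun _ => ℝ → ℝ) := ⟨fun u => u.val⟩

/-- The weak* topology: the coarsest one that makes `u ↦ ∫ u f` continuous for all `f ∈ L¹(ℝ)`. -/
instance : TopologicalSpace LinfUnit :=
  TopologicalSpace.induced
    (fun (u : LinfUnit) (f : Lp ℝ 1 (volume : Measure ℝ)) => ∫ y, u y * f y)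
    inferInstance

/-- `(τ_z u)(y) = u (y - z)`. -/
def LinfUnit.translate (z : ℝ) (u : LinfUnit) : LinfUnit where
  val := Lp.compMeasurePreserving (fun y : ℝ => y - z)
    (measurePreserving_sub_right volume z) u.val
  mem_unit := by
    have h := Lp.coeFn_compMeasurePreserving u.val (measurePreserving_sub_right volume z)
    have h2 := (measurePreserving_sub_right (volume : Measure ℝ) z).quasiMeasurePreserving.ae
      u.mem_unit
    filter_upwards [h, h2] with y hy hy2
    rw [hy]
    exact hy2

/-! ### The space `C` with the topology of uniform convergence -/

/-- Absolutely continuous `φ : ℝ → ℝ` with `0 ≤ φ' ≤ 1` almost everywhere and limits `a` at `-∞`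
and `b` at `+∞`. -/
structure PhaseSpace (a b : ℝ) where
  /-- the underlying function -/
  val : ℝ → ℝ
  ac : ∀ c d : ℝ, AbsolutelyContinuousOnInterval val c d
  deriv_mem : ∀ᵐ y, deriv val y ∈ Icc (0 : ℝ) 1
  tendsto_atBot : Tendsto val atBot (𝓝 a)
  tendsto_atTop : Tendsto val atTop (𝓝 b)

instance (a b : ℝ) : CoeFun (PhaseSpace a b) (fun _ => ℝ → ℝ) := ⟨fun φ => φ.val⟩

instance (a b : ℝ) : TopologicalSpace (PhaseSpace a b) :=
  TopologicalSpace.induced (fun φ : PhaseSpace a b => UniformFun.ofFun φ.val) inferInstance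

theorem ac_translate {f : ℝ → ℝ} (hf : ∀ c d : ℝ, AbsolutelyContinuousOnInterval f c d)
    (z c d : ℝ) : AbsolutelyContinuousOnInterval (fun y => f (y - z)) c d := by
  have h := hf (c - z) (d - z)
  rw [absolutelyContinuousOnInterval_iff] at h ⊢
  intro ε hε
  obtain ⟨δ, hδ, H⟩ := h ε hε
  refine ⟨δ, hδ, fun E hE hs => ?_⟩
  refine H (E.1, fun i => ((E.2 i).1 - z, (E.2 i).2 - z)) ⟨fun i hi => ?_, ?_⟩ ?_
  · have := hE.1 i hi
    simp only [mem_uIcc] at this ⊢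
    grind
  · intro i hi j hj hij
    have := hE.2 hi hj hij
    simp only [Function.onFun, Set.disjoint_left, mem_uIoc] at this ⊢
    intro y hy hy'
    exact this (a := y + z) (by grind) (by grind)
  · simpa using hs

/-- `(τ_z φ)(y) = φ (y - z)`. -/
def PhaseSpace.translate {a b : ℝ} (z : ℝ) (φ : PhaseSpace a b) : PhaseSpace a b where
  val := fun y => φ (y - z)
  ac := ac_translate φ.ac z
  deriv_mem := by
    have h2 := (measurePreserving_sub_right (volume : Measure ℝ) z).quasiMeasurePreserving.ae
      φ.deriv_mem
    filter_upwards [h2] with y hy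
    rw [deriv_comp_sub_const]
    exact hy
  tendsto_atBot := φ.tendsto_atBot.comp (tendsto_atBot_add_const_right _ (-z) tendsto_id)
  tendsto_atTop := φ.tendsto_atTop.comp (tendsto_atTop_add_const_right _ (-z) tendsto_id)

/-! ### The state space and the functionals -/

/-- `L^∞(ℝ;[0,1]) × C`, with the product topology. -/
abbrev State (um up : ℝ) : Type := LinfUnit × PhaseSpace (chem um) (chem up)

/-- `τ_z (u,φ) = (τ_z u, τ_z φ)`. -/
def translate {um up : ℝ} (z : ℝ) (x : State um up) : State um up :=
  (x.1.translate z, x.2.translate z)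

/-- The step function with value `a` on the left and `b` on the right of the origin. -/
def step (a b : ℝ) (y : ℝ) : ℝ := if y < 0 then a else b

/-- `‖u - τ_z ϑ_{u_-,u_+}‖` in `L²(ℝ)`. -/
def devU {um up : ℝ} (z : ℝ) (x : State um up) : ℝ≥0∞ :=
  eLpNorm (fun y => x.1 y - step um up (y - z)) 2 volume

/-- `‖φ - τ_z ϑ_{φ_-,φ_+}‖` in `L¹(ℝ)`. -/
def devPhi {um up : ℝ} (z : ℝ) (x : State um up) : ℝ≥0∞ :=
  eLpNorm (fun y => x.2 y - step (chem um) (chem up) (y - z)) 1 volume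

/-- The set `D` on which the limit functional is given by an integral. -/
def domainD (um up : ℝ) : Set (State um up) := {x | devU 0 x + devPhi 0 x < ⊤}

/-- `g(u,φ,φ') - g(u_+,φ_+,0)`. -/
def density {um up : ℝ} (x : State um up) (y : ℝ) : ℝ :=
  gFun (x.1 y) (x.2 y) (deriv x.2.val y) - gFun up (chem up) 0

open Classical in
/-- The limit functional `G`. -/
def energy (um up : ℝ) (x : State um up) : EReal :=
  if x ∈ domainD um up then ((∫ y, density x y : ℝ) : EReal) else ⊤

/-- The set `B_ℓ` of states that are frozen outside `(-ℓ,ℓ)`. -/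
def boxSet (um up ℓ : ℝ) : Set (State um up) :=
  {x | (∀ y ≤ -ℓ, x.2 y = chem um) ∧ (∀ᵐ y, y ≤ -ℓ → x.1 y = um) ∧
    (∀ y ≥ ℓ, x.2 y = chem up) ∧ (∀ᵐ y, y ≥ ℓ → x.1 y = up)}

open Classical in
/-- The finite volume functional `G_ℓ`. -/
def energyBox (um up ℓ : ℝ) (x : State um up) : EReal :=
  if x ∈ boxSet um up ℓ then ((∫ y in Ioo (-ℓ) ℓ, density x y : ℝ) : EReal) else ⊤

/-! ### Stationary solutions -/

/-- `v` is a classical solution of `v'' - (v(1-v))' = 0` on the whole line with limits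
`u_-` and `u_+` at `-∞` and `+∞`. -/
def IsStandingWave (um up : ℝ) (v : ℝ → ℝ) : Prop :=
  ContDiff ℝ 2 v ∧
  (∀ y, deriv (deriv v) y - deriv (fun t => v t * (1 - v t)) y = 0) ∧
  Tendsto v atBot (𝓝 um) ∧ Tendsto v atTop (𝓝 up)

/-- `v` is a classical solution of `v'' - (v(1-v))' = 0` in `(-ℓ,ℓ)`, continuous up to the
boundary, with `v(-ℓ) = u_-` and `v(ℓ) = u_+`. -/
def IsBoxSolution (um up ℓ : ℝ) (v : ℝ → ℝ) : Prop :=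
  ContinuousOn v (Icc (-ℓ) ℓ) ∧ ContDiffOn ℝ 2 v (Ioo (-ℓ) ℓ) ∧
  (∀ y ∈ Ioo (-ℓ) ℓ, deriv (deriv v) y - deriv (fun t => v t * (1 - v t)) y = 0) ∧
  v (-ℓ) = um ∧ v ℓ = up

/-- The standing wave `ū(y) = 1/2 + (u_+ - 1/2) tanh ((u_+ - 1/2) y)`. -/
def ubar (up : ℝ) (y : ℝ) : ℝ := 1 / 2 + (up - 1 / 2) * Real.tanh ((up - 1 / 2) * y)

/-- Extension of a function on `[-ℓ,ℓ]` by the constants `u_-` on the left, `u_+` on the right. -/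
def extendBox (um up ℓ : ℝ) (v : ℝ → ℝ) (y : ℝ) : ℝ :=
  if y ≤ -ℓ then um else if ℓ ≤ y then up else v y

/-- The state `x` is the pair `(v, s'(v))`. -/
def IsPairOf {um up : ℝ} (x : State um up) (v : ℝ → ℝ) : Prop :=
  (∀ᵐ y, x.1 y = v y) ∧ ∀ y, x.2 y = chem (v y)

/-! ### Gamma-convergence as `ℓ → ∞` -/

/-- `Γ`-convergence of the family `F ℓ` to `F₀` as `ℓ → ∞`: the liminf inequality along
every sequence `ℓ_n → ∞`, and a recovery family indexed by all `ℓ`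
(hence a recovery sequence along every sequence `ℓ_n → ∞`). -/
def GammaTendsto {X : Type*} [TopologicalSpace X] (F : ℝ → X → EReal) (F₀ : X → EReal) : Prop :=
  (∀ (x : X) (L : ℕ → ℝ) (y : ℕ → X), Tendsto L atTop atTop → Tendsto y atTop (𝓝 x) →
    F₀ x ≤ liminf (fun n => F (L n) (y n)) atTop) ∧
  (∀ x : X, ∃ y : ℝ → X, Tendsto y atTop (𝓝 x) ∧
    limsup (fun ℓ => F ℓ (y ℓ)) atTop ≤ F₀ x)

end BurgersGamma

end

open BurgersGamma

/-!
The proof rests on a calibration. Write `σ` for the logistic function, `A = u_+ u_-` and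
`m = σ(1-σ)`. By an exact identity (`OppositePhases.gFun_sub`) the density splits as
`kl(u | σ(φ)) + [s(φ') + log m(φ) - log A]`, where `kl` is the relative entropy of two Bernoulli
laws. The standing wave solves `v' = v(1-v) - A`, hence its phase solves `φ' = 1 - A / m(φ)`, a
slope called `slope A φ`. The bracket is `kl(φ' | slope A φ)` plus `φ'` times a function of `φ`
(`entropy_add_log_mobility`). The last term is a null Lagrangian: by the change of variables along
a monotone Lipschitz function its integral depends only on the limits of `φ`. So on the whole
state space the energy is `minEnergy` plus the sum of two nonnegative integrals, called the
`excess` (`OppositePhases.energy_eq`). The rest is read off from this identity.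

* Coercivity (`OppositePhases.dev_le_excess`): a relative entropy controls a squared distance,
  `slope A φ` is comparable with the distance of `φ` from its limits, and
  `slope ≤ 2 kl(φ' | slope) + 2 φ'` with `∫ φ' = φ_+ - φ_-`.
* Lower semicontinuity: both relative entropies are convex in the variable that converges only
  weakly*, while the other variable converges uniformly.
* Minimizers: the excess vanishes exactly if `u = σ(φ)` and `φ' = slope A φ`, an ODE for `u` that is
  integrated explicitly.
* The interval `(-ℓ,ℓ)`: the same calibration works with `A` replaced by `1/4 - b²`, where the rate
  `b = boxRate up ℓ` is the one for which `1/2 + b tanh (b y)` takes the boundary values. For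
  `ℓ = φ_+` it degenerates to slope `1`, and the phase is then forced to be linear.
* Compactness: normalizing the phase to vanish at the origin, coercivity and monotonicity bound its
  tails uniformly. Monotone functions that converge pointwise to a continuous limit, with the same
  limits at `±∞`, converge uniformly; and `L^∞(ℝ;[0,1])` is weak* compact.
* Γ-convergence: the lower bound follows from lower semicontinuity, since the finite volume
  functional dominates the limit one. For the upper bound the phase is cut off by two lines of slope
  `1` in boundary layers of fixed width, where the density is as small as the tails of the phase.
-/

namespace BurgersGamma

/-! ### The binary relative entropy -/

/-- The binary relative entropy `p log (p/q) + (1-p) log ((1-p)/(1-q))`, written so that the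
identities relating it to the energy density hold by unfolding. -/
noncomputable def kl (p q : ℝ) : ℝ := entropy p - Real.log (1 - q) - p * chem q

theorem chem_eq {q : ℝ} (h0 : 0 < q) (h1 : q < 1) : chem q = Real.log q - Real.log (1 - q) := by
  rw [chem, Real.log_div h0.ne' (by linarith)]

theorem kl_eq {p q : ℝ} (h0 : 0 < q) (h1 : q < 1) :
    kl p q = entropy p - p * Real.log q - (1 - p) * Real.log (1 - q) := by
  rw [kl, chem_eq h0 h1]; ring

theorem kl_zero_zero : kl 0 0 = 0 := by simp [kl, entropy]

theorem kl_one_one : kl 1 1 = 0 := by simp [kl, entropy, chem]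

theorem mul_log_le {x a : ℝ} (hx : 0 ≤ x) (ha : 0 < a) :
    x * Real.log a ≤ x * Real.log x + a - x := by
  rcases hx.eq_or_lt with rfl | hx
  · simpa using ha.le
  · have h := Real.log_le_sub_one_of_pos (div_pos ha hx)
    rw [Real.log_div ha.ne' hx.ne'] at h
    have := mul_le_mul_of_nonneg_left h hx.le
    have e : x * (a / x - 1) = a - x := by field_simp
    rw [e] at this
    linarith

/-- Gibbs' inequality. -/
theorem gibbs {p q : ℝ} (hp : p ∈ Icc (0 : ℝ) 1) (h0 : 0 < q) (h1 : q < 1) :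
    p * Real.log q + (1 - p) * Real.log (1 - q) ≤ entropy p := by
  have a := mul_log_le hp.1 h0
  have b := mul_log_le (sub_nonneg.2 hp.2) (sub_pos.2 h1)
  unfold entropy
  linarith

theorem kl_nonneg {p q : ℝ} (hp : p ∈ Icc (0 : ℝ) 1) (h0 : 0 < q) (h1 : q < 1) : 0 ≤ kl p q := by
  rw [kl_eq h0 h1]
  linarith [gibbs hp h0 h1]

theorem kl_self {q : ℝ} (h0 : 0 < q) (h1 : q < 1) : kl q q = 0 := by
  rw [kl_eq h0 h1, entropy]; ring

/-- The variational lower bound for the relative entropy by functions affine in `p`. -/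
theorem kl_ge_affine {p q : ℝ} (hp : p ∈ Icc (0 : ℝ) 1) (h0 : 0 < q) (h1 : q < 1) (t : ℝ) :
    t * p - Real.log (1 - q + q * Real.exp t) ≤ kl p q := by
  have he := Real.exp_pos t
  have hq : 0 < 1 - q := sub_pos.2 h1
  set Z := 1 - q + q * Real.exp t with hZ
  have hZ0 : 0 < Z := by positivity
  have ha : 0 < q * Real.exp t / Z := by positivity
  have hb : 1 - q * Real.exp t / Z = (1 - q) / Z := by field_simp; rw [hZ]; ring
  have hb1 : q * Real.exp t / Z < 1 := by
    have : 0 < (1 - q) / Z := by positivity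
    linarith
  have := gibbs hp ha hb1
  rw [hb, Real.log_div (by positivity) hZ0.ne', Real.log_div hq.ne' hZ0.ne',
    Real.log_mul h0.ne' he.ne', Real.log_exp] at this
  rw [kl_eq h0 h1]
  linarith

/-- A quadratic lower bound of Pinsker type. -/
theorem sq_le_kl {p q : ℝ} (hp : p ∈ Icc (0 : ℝ) 1) (h0 : 0 < q) (h1 : q < 1) :
    (p - q) ^ 2 / 4 ≤ kl p q := by
  -- the variational bound at `t = (p - q) / 2`, expanded to second order
  set t := (p - q) / 2 with ht
  have h := kl_ge_affine hp h0 h1 t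
  have habs : |t| ≤ 1 := by rw [abs_le]; constructor <;> linarith [hp.1, hp.2]
  have he := (abs_le.1 (Real.abs_exp_sub_one_sub_id_le habs)).2
  have hl : Real.log (1 - q + q * Real.exp t) ≤ q * (t + t ^ 2) := by
    have hq : 0 < 1 - q := sub_pos.2 h1
    have := Real.log_le_sub_one_of_pos (x := 1 - q + q * Real.exp t)
      (by have := Real.exp_pos t; positivity)
    nlinarith
  have hpq : p - q = 2 * t := by rw [ht]; ring
  have h2 : q * t ^ 2 ≤ t ^ 2 := by nlinarith [sq_nonneg t]
  have h3 : t * p - q * t = 2 * t ^ 2 := by linear_combination t * hpq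
  rw [hpq]
  linarith

theorem eq_of_kl_eq_zero {p q : ℝ} (hp : p ∈ Icc (0 : ℝ) 1) (h0 : 0 < q) (h1 : q < 1)
    (h : kl p q = 0) : p = q := by
  have := sq_le_kl hp h0 h1
  rw [h] at this
  nlinarith [sq_nonneg (p - q)]

theorem kl_le_sq {p q : ℝ} (hp : p ∈ Icc (0 : ℝ) 1) (h0 : 0 < q) (h1 : q < 1) :
    kl p q ≤ (p - q) ^ 2 / (q * (1 - q)) := by
  have key : ∀ x a : ℝ, 0 ≤ x → 0 < a → x * Real.log x - x * Real.log a ≤ x * (x / a - 1) := by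
    intro x a hx ha
    rcases hx.eq_or_lt with rfl | hx
    · simp
    · have h := Real.log_le_sub_one_of_pos (div_pos hx ha)
      rw [Real.log_div hx.ne' ha.ne'] at h
      nlinarith
  have hq : 0 < 1 - q := sub_pos.2 h1
  have a := key p q hp.1 h0
  have b := key (1 - p) (1 - q) (sub_nonneg.2 hp.2) hq
  rw [kl_eq h0 h1, entropy]
  have e : (p - q) ^ 2 / (q * (1 - q)) =
      p * (p / q - 1) + (1 - p) * ((1 - p) / (1 - q) - 1) := by
    field_simp; ring
  rw [e]; linarith

/-- Unless `q` is small, the relative entropy and `p` cannot both be small. -/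
theorem le_kl_add {p q : ℝ} (hp : p ∈ Icc (0 : ℝ) 1) (h0 : 0 < q) (h1 : q < 1) :
    q ≤ 2 * kl p q + 2 * p := by
  have h := kl_ge_affine hp h0 h1 (-Real.log 2)
  rw [Real.exp_neg, Real.exp_log two_pos] at h
  have hl := Real.log_le_sub_one_of_pos (x := 1 - q + q * 2⁻¹) (by linarith)
  have h2 : Real.log 2 ≤ 1 := by linarith [Real.log_two_lt_d9]
  nlinarith [hp.1]

/-- The affine minorant that touches the relative entropy at the interpolation
`w = (1-r) p + r q` is off by at most `r * kl p q` at `p`: this is the convexity of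
`kl p`. -/
theorem kl_sub_kl_interp {p q r : ℝ} (hp : p ∈ Icc (0 : ℝ) 1) (h0 : 0 < q) (h1 : q < 1)
    (hr0 : 0 < r) (hr1 : r < 1) :
    (1 - r) * kl p q ≤
      (chem ((1 - r) * p + r * q) - chem q) * p -
        Real.log (1 - q + q * Real.exp (chem ((1 - r) * p + r * q) - chem q)) := by
  set w := (1 - r) * p + r * q with hw
  have hr : 0 < 1 - r := sub_pos.2 hr1
  have hq : 0 < 1 - q := sub_pos.2 h1
  have hw0 : 0 < w := by have := hp.1; positivity
  have hw' : 1 - w = (1 - r) * (1 - p) + r * (1 - q) := by rw [hw]; ring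
  have hw1 : 0 < 1 - w := by
    rw [hw']; have : 0 ≤ 1 - p := sub_nonneg.2 hp.2
    positivity
  have hwl : w < 1 := by linarith
  have hZ : 1 - q + q * Real.exp (chem w - chem q) = (1 - q) / (1 - w) := by
    rw [Real.exp_sub, chem, chem, Real.exp_log (by positivity), Real.exp_log (by positivity)]
    field_simp; ring
  rw [hZ, Real.log_div hq.ne' hw1.ne']
  have key : ∀ x a b : ℝ, 0 ≤ x → 0 < a → b = (1 - r) * x + r * a →
      x * ((1 - r) * Real.log x + r * Real.log a) ≤ x * Real.log b := by
    intro x a b hx ha hb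
    rcases hx.eq_or_lt with rfl | hx
    · simp
    · have := strictConcaveOn_log_Ioi.concaveOn.2 (x := x) hx (y := a) ha hr.le hr0.le (by ring)
      simp only [smul_eq_mul] at this
      rw [hb]
      exact mul_le_mul_of_nonneg_left this hx.le
  have a := key p q w hp.1 h0 hw
  have b := key (1 - p) (1 - q) (1 - w) (sub_nonneg.2 hp.2) hq hw'
  rw [kl_eq h0 h1, chem_eq hw0 hwl, chem_eq h0 h1, entropy]
  nlinarith

theorem continuous_entropy : Continuous entropy := by
  unfold entropy
  exact Real.continuous_mul_log.add
    (Real.continuous_mul_log.comp (continuous_const.sub continuous_id))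

theorem entropy_nonpos {p : ℝ} (hp : p ∈ Icc (0 : ℝ) 1) : entropy p ≤ 0 := by
  have a := mul_nonpos_of_nonneg_of_nonpos hp.1 (Real.log_nonpos hp.1 hp.2)
  have b := mul_nonpos_of_nonneg_of_nonpos (sub_nonneg.2 hp.2)
    (Real.log_nonpos (sub_nonneg.2 hp.2) (by linarith [hp.1]))
  unfold entropy; linarith

theorem measurable_chem : Measurable chem := by unfold chem; fun_prop

theorem measurable_kl : Measurable fun z : ℝ × ℝ => kl z.1 z.2 := by
  unfold kl
  have := continuous_entropy.measurable
  have := measurable_chem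
  fun_prop

/-! ### The chemical potential and the sigmoid function -/

theorem chem_sigmoid (t : ℝ) : chem (Real.sigmoid t) = t := by
  have h0 := Real.sigmoid_pos t
  rw [chem, ← Real.sigmoid_neg, ← Real.sigmoid_mul_rexp_neg, Real.exp_neg]
  field_simp
  exact Real.log_exp t

theorem sigmoid_chem {q : ℝ} (h0 : 0 < q) (h1 : q < 1) : Real.sigmoid (chem q) = q := by
  obtain ⟨t, rfl⟩ : q ∈ range Real.sigmoid := by rw [Real.range_sigmoid]; exact ⟨h0, h1⟩
  rw [chem_sigmoid]

theorem log_one_add_exp (t : ℝ) : Real.log (1 + Real.exp t) = -Real.log (1 - Real.sigmoid t) := by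
  rw [← Real.sigmoid_neg, Real.sigmoid_def, neg_neg, Real.log_inv, neg_neg]

theorem hasDerivAt_chem {q : ℝ} (h0 : 0 < q) (h1 : q < 1) :
    HasDerivAt chem (1 / (q * (1 - q))) q := by
  have hq : 0 < 1 - q := sub_pos.2 h1
  have h := ((hasDerivAt_id q).div ((hasDerivAt_id q).const_sub 1) hq.ne').log
    (div_ne_zero h0.ne' hq.ne')
  refine h.congr_deriv ?_
  simp only [id, Pi.div_apply]
  field_simp; ring

/-- The variance `σ(t) (1 - σ(t))` of the Bernoulli law with chemical potential `t`. -/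
noncomputable def mobility (t : ℝ) : ℝ := Real.sigmoid t * (1 - Real.sigmoid t)

theorem mobility_pos (t : ℝ) : 0 < mobility t :=
  mul_pos (Real.sigmoid_pos t) (sub_pos.2 (Real.sigmoid_lt_one t))

theorem mobility_le (t : ℝ) : mobility t ≤ 1 / 4 := by
  unfold mobility; nlinarith [sq_nonneg (Real.sigmoid t - 1 / 2)]

theorem continuous_mobility : Continuous mobility := by
  unfold mobility
  exact differentiable_sigmoid.continuous.mul
    (continuous_const.sub differentiable_sigmoid.continuous)

theorem log_mobility (t : ℝ) :
    Real.log (mobility t) = t - 2 * Real.log (1 + Real.exp t) := by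
  have h0 := Real.sigmoid_pos t
  have h1 := Real.sigmoid_lt_one t
  have h2 := chem_eq h0 h1
  rw [chem_sigmoid] at h2
  rw [log_one_add_exp, mobility, Real.log_mul h0.ne' (by linarith)]
  linarith

theorem sigmoid_sub_le {s t : ℝ} (h : s ≤ t) : Real.sigmoid t - Real.sigmoid s ≤ t - s := by
  have := Convex.image_sub_le_mul_sub_of_deriv_le (f := Real.sigmoid) (C := 1) convex_univ
    differentiable_sigmoid.continuous.continuousOn differentiable_sigmoid.differentiableOn
    (fun x _ => by
      rw [(Real.hasDerivAt_sigmoid x).deriv]; have := mobility_le x; unfold mobility at this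
      linarith) s (mem_univ _) t (mem_univ _) h
  linarith

theorem abs_sigmoid_sub_le (s t : ℝ) : |Real.sigmoid s - Real.sigmoid t| ≤ |s - t| := by
  rcases le_total s t with h | h
  · rw [abs_sub_comm, abs_sub_comm s, abs_of_nonneg (sub_nonneg.2 (Real.sigmoid_le h)),
      abs_of_nonneg (sub_nonneg.2 h)]
    exact sigmoid_sub_le h
  · rw [abs_of_nonneg (sub_nonneg.2 (Real.sigmoid_le h)), abs_of_nonneg (sub_nonneg.2 h)]
    exact sigmoid_sub_le h

/-- The slope `φ' = 1 - B / (v (1 - v))`, at `v = σ(φ)`, prescribed by the first integral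
`v' = v (1 - v) - B` of the stationary equation. -/
noncomputable def slope (B t : ℝ) : ℝ := 1 - B / mobility t

theorem continuous_slope (B : ℝ) : Continuous (slope B) :=
  continuous_const.sub (continuous_const.div continuous_mobility fun t => (mobility_pos t).ne')

theorem one_sub_slope (B t : ℝ) : 1 - slope B t = B / mobility t := by simp [slope]

theorem slope_lt_one {B : ℝ} (hB : 0 < B) (t : ℝ) : slope B t < 1 := by
  have := div_pos hB (mobility_pos t)
  unfold slope; linarith

/-- The calibration identity behind the energy estimates: the part of the energy density depending
on the phase `t` and its slope `p` is a relative entropy, plus the null Lagrangian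
`p * chem (slope B t)`, plus a constant. -/
theorem entropy_add_log_mobility {B : ℝ} (hB : 0 < B) (p t : ℝ) :
    entropy p + Real.log (mobility t) =
      kl p (slope B t) + p * chem (slope B t) + Real.log B := by
  rw [kl, one_sub_slope, Real.log_div hB.ne' (mobility_pos t).ne']
  ring

/-- Two opposite phases: `0 < u₋ < u₊` and `u₋ + u₊ = 1`. -/
structure OppositePhases (um up : ℝ) : Prop where
  pos : 0 < um
  lt : um < up
  sum : um + up = 1

namespace OppositePhases

variable {um up : ℝ} (h : OppositePhases um up)
include h

theorem um_eq : um = 1 - up := by linarith [h.sum]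
theorem half_lt : 1 / 2 < up := by linarith [h.sum, h.lt]
theorem up_lt : up < 1 := by linarith [h.sum, h.pos]
theorem up_pos : 0 < up := by linarith [h.lt, h.pos]
theorem um_lt : um < 1 := by linarith [h.lt, h.up_lt]
theorem mul_pos : 0 < up * um := _root_.mul_pos h.up_pos h.pos

theorem sigmoid_up : Real.sigmoid (chem up) = up := sigmoid_chem h.up_pos h.up_lt
theorem sigmoid_um : Real.sigmoid (chem um) = um := sigmoid_chem h.pos h.um_lt

theorem chem_um : chem um = -chem up := by
  apply Real.sigmoid_injective
  rw [h.sigmoid_um, Real.sigmoid_neg, h.sigmoid_up, h.um_eq]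

theorem chem_up_pos : 0 < chem up := by
  rw [← Real.sigmoid_lt_iff, h.sigmoid_up, Real.sigmoid_zero]
  linarith [h.half_lt]

theorem mobility_up : mobility (chem up) = up * um := by
  rw [mobility, h.sigmoid_up, h.um_eq]

/-- The energy density, with the phase-dependent part separated from the relative entropy of
the density with respect to its local equilibrium. -/
theorem gFun_sub (u t p : ℝ) :
    gFun u t p - gFun up (chem up) 0 =
      kl u (Real.sigmoid t) + (entropy p + Real.log (mobility t) - Real.log (up * um)) := by
  have e0 : entropy 0 = 0 := by simp [entropy]
  have e1 : entropy up = Real.log (up * um) - up * Real.log um - um * Real.log up := by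
    rw [Real.log_mul h.up_pos.ne' h.pos.ne', entropy, ← h.um_eq, h.um_eq]; ring
  have e2 : chem up = Real.log up - Real.log um := by rw [chem_eq h.up_pos h.up_lt, h.um_eq]
  unfold gFun
  rw [log_one_add_exp (chem up), h.sigmoid_up, log_mobility, kl, chem_sigmoid, log_one_add_exp t,
    e0, e1, ← h.um_eq, e2, h.um_eq]
  ring

variable {t : ℝ}

theorem sigmoid_mem (ht : t ∈ Icc (-chem up) (chem up)) : Real.sigmoid t ∈ Icc um up := by
  rw [← h.chem_um] at ht
  have a := Real.sigmoid_le ht.1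
  have b := Real.sigmoid_le ht.2
  rw [h.sigmoid_um] at a
  rw [h.sigmoid_up] at b
  exact ⟨a, b⟩

theorem mobility_sub (t : ℝ) :
    mobility t - up * um = (Real.sigmoid t - um) * (up - Real.sigmoid t) := by
  rw [mobility, h.um_eq]; ring

theorem le_mobility (ht : t ∈ Icc (-chem up) (chem up)) : up * um ≤ mobility t := by
  have := h.sigmoid_mem ht
  have := mul_nonneg (sub_nonneg.2 this.1) (sub_nonneg.2 this.2)
  rw [← h.mobility_sub] at this
  linarith

theorem le_sigmoid_sub {s : ℝ} (hs : s ∈ Icc (-chem up) (chem up))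
    (ht : t ∈ Icc (-chem up) (chem up)) (hst : s ≤ t) :
    up * um * (t - s) ≤ Real.sigmoid t - Real.sigmoid s := by
  refine Convex.mul_sub_le_image_sub_of_le_deriv (convex_Icc (-chem up) (chem up))
    differentiable_sigmoid.continuous.continuousOn differentiable_sigmoid.differentiableOn
    (fun x hx => ?_) s hs t ht hst
  rw [interior_Icc] at hx
  rw [(Real.hasDerivAt_sigmoid x).deriv]
  exact h.le_mobility ⟨hx.1.le, hx.2.le⟩

theorem slope_eq (t : ℝ) :
    slope (up * um) t = (Real.sigmoid t - um) * (up - Real.sigmoid t) / mobility t := by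
  rw [← h.mobility_sub, slope]
  have := (mobility_pos t).ne'
  field_simp

theorem slope_nonneg {B : ℝ} (hB : B ≤ up * um) (ht : t ∈ Icc (-chem up) (chem up)) :
    0 ≤ slope B t := by
  have := h.le_mobility ht
  rw [slope, sub_nonneg, div_le_one (mobility_pos t)]
  linarith

theorem slope_pos {B : ℝ} (hB : B < up * um) (ht : t ∈ Icc (-chem up) (chem up)) :
    0 < slope B t := by
  have := h.le_mobility ht
  rw [slope, sub_pos, div_lt_one (mobility_pos t)]
  linarith

theorem mul_le_slope (ht : t ∈ Icc (-chem up) (chem up)) :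
    (up * um) ^ 2 * ((t + chem up) * (chem up - t)) ≤ slope (up * um) t := by
  have hp := h.chem_up_pos
  have h1 := h.le_sigmoid_sub (left_mem_Icc.2 (by linarith)) ht ht.1
  have h2 := h.le_sigmoid_sub ht (right_mem_Icc.2 (by linarith)) ht.2
  rw [← h.chem_um, h.sigmoid_um] at h1
  rw [h.sigmoid_up] at h2
  rw [h.chem_um] at h1
  have hA := h.mul_pos
  have hm := mobility_le t
  rw [h.slope_eq, le_div_iff₀ (mobility_pos t)]
  have h3 : 0 ≤ up * um * (chem up - t) := by have := sub_nonneg.2 ht.2; positivity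
  have h4 : 0 ≤ up * um * (t + chem up) := by
    have : 0 ≤ t + chem up := by linarith [ht.1]
    positivity
  calc _ ≤ (up * um) ^ 2 * ((t + chem up) * (chem up - t)) * 1 := by
        refine mul_le_mul_of_nonneg_left (by linarith) ?_
        have : 0 ≤ t + chem up := by linarith [ht.1]
        have := sub_nonneg.2 ht.2
        positivity
    _ = (up * um * (t + chem up)) * (up * um * (chem up - t)) := by ring
    _ ≤ _ := mul_le_mul (by linarith) h2 h3 (by linarith)

/-- The prescribed slope controls the distance of the phase to the nearest of `±Φ`. -/
theorem dist_le_slope (ht : t ∈ Icc (-chem up) (chem up)) :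
    |t - step (chem um) (chem up) t| ≤ ((up * um) ^ 2 * chem up)⁻¹ * slope (up * um) t := by
  have hA := h.mul_pos
  have hp := h.chem_up_pos
  have := h.mul_le_slope ht
  rw [inv_mul_eq_div, le_div_iff₀ (by positivity)]
  refine le_trans ?_ this
  rw [mul_comm, mul_assoc]
  refine mul_le_mul_of_nonneg_left ?_ (by positivity)
  unfold step
  split_ifs with h0
  · rw [h.chem_um, abs_of_nonneg (by linarith [ht.1])]
    nlinarith [ht.1]
  · rw [abs_of_nonpos (by linarith [ht.2])]
    nlinarith [ht.2]

theorem log_mobility_nonneg (ht : t ∈ Icc (-chem up) (chem up)) :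
    0 ≤ Real.log (mobility t) - Real.log (up * um) :=
  sub_nonneg.2 (Real.log_le_log h.mul_pos (h.le_mobility ht))

theorem log_mobility_le (ht : t ∈ Icc (-chem up) (chem up)) {s : ℝ}
    (hs : s = chem um ∨ s = chem up) :
    Real.log (mobility t) - Real.log (up * um) ≤ (up * um)⁻¹ * |t - s| := by
  have hA := h.mul_pos
  have hm := mobility_pos t
  rw [← Real.log_div hm.ne' hA.ne']
  have h1 := Real.log_le_sub_one_of_pos (div_pos hm hA)
  have h2 := h.mobility_sub t
  have h3 := h.sigmoid_mem ht
  have h4 : mobility t - up * um ≤ |t - s| := by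
    rw [h2]
    rcases hs with rfl | rfl
    · refine le_trans ?_ (abs_sigmoid_sub_le t (chem um))
      rw [h.sigmoid_um, abs_of_nonneg (by linarith [h3.1])]
      nlinarith [h3.1, h3.2, h.pos, h.up_lt]
    · refine le_trans ?_ (abs_sigmoid_sub_le t (chem up))
      rw [h.sigmoid_up, abs_sub_comm, abs_of_nonneg (by linarith [h3.2])]
      nlinarith [h3.1, h3.2, h.pos, h.up_lt]
  calc _ ≤ mobility t / (up * um) - 1 := h1
    _ = (up * um)⁻¹ * (mobility t - up * um) := by
        rw [mul_sub, inv_mul_cancel₀ hA.ne', inv_mul_eq_div]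
    _ ≤ _ := mul_le_mul_of_nonneg_left h4 (by positivity)

end OppositePhases

/-! ### Functions with slopes between `0` and `1` -/

/-- All difference quotients of `f` lie in `[0,1]`. -/
def UnitSlope (f : ℝ → ℝ) : Prop := ∀ x y, x ≤ y → f y - f x ∈ Icc 0 (y - x)

namespace UnitSlope

variable {f : ℝ → ℝ} (hf : UnitSlope f)
include hf

theorem monotone : Monotone f := fun x y h => sub_nonneg.1 (hf x y h).1

theorem lipschitz : LipschitzWith 1 f := by
  refine LipschitzWith.of_dist_le_mul fun x y => ?_
  rw [NNReal.coe_one, one_mul, Real.dist_eq, Real.dist_eq]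
  rcases le_total x y with h | h
  · rw [abs_sub_comm, abs_sub_comm x, abs_of_nonneg (hf x y h).1, abs_of_nonneg (sub_nonneg.2 h)]
    exact (hf x y h).2
  · rw [abs_of_nonneg (hf y x h).1, abs_of_nonneg (sub_nonneg.2 h)]
    exact (hf y x h).2

theorem continuous : Continuous f := hf.lipschitz.continuous

theorem ac (c d : ℝ) : AbsolutelyContinuousOnInterval f c d :=
  (hf.lipschitz.lipschitzOnWith (s := uIcc c d)).absolutelyContinuousOnInterval

theorem deriv_mem (y : ℝ) : deriv f y ∈ Icc (0 : ℝ) 1 :=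
  ⟨hf.monotone.deriv_nonneg, (le_abs_self _).trans (by
    have := norm_deriv_le_of_lipschitz (x₀ := y) hf.lipschitz
    simpa using this)⟩

theorem integral_deriv (a b : ℝ) : ∫ y in a..b, deriv f y = f b - f a :=
  (hf.ac a b).integral_deriv_eq_sub

theorem max {g : ℝ → ℝ} (hg : UnitSlope g) : UnitSlope fun y => max (f y) (g y) := by
  intro x y h
  have a := hf x y h
  have b := hg x y h
  simp only [mem_Icc] at *
  grind

theorem min {g : ℝ → ℝ} (hg : UnitSlope g) : UnitSlope fun y => min (f y) (g y) := by
  intro x y h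
  have a := hf x y h
  have b := hg x y h
  simp only [mem_Icc] at *
  grind

theorem comp {g : ℝ → ℝ} (hg : UnitSlope g) : UnitSlope fun y => f (g y) := by
  intro x y h
  have b := hg x y h
  have a := hf (g x) (g y) (sub_nonneg.1 b.1)
  exact ⟨a.1, a.2.trans b.2⟩

end UnitSlope

theorem unitSlope_const (c : ℝ) : UnitSlope fun _ => c := fun x y h => by simpa using h

theorem unitSlope_add_const (c : ℝ) : UnitSlope fun y => y + c := fun x y h => by
  simpa using h

theorem unitSlope_of_hasDerivAt {f f' : ℝ → ℝ} (hf : ∀ y, HasDerivAt f (f' y) y)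
    (h : ∀ y, f' y ∈ Icc (0 : ℝ) 1) : UnitSlope f := by
  have hd : Differentiable ℝ f := fun y => (hf y).differentiableAt
  intro x y hxy
  refine ⟨?_, ?_⟩
  · have := Convex.mul_sub_le_image_sub_of_le_deriv (f := f) (C := 0) convex_univ
      hd.continuous.continuousOn hd.differentiableOn
      (fun x _ => by rw [(hf x).deriv]; exact (h x).1) x (mem_univ _) y (mem_univ _) hxy
    linarith
  · have := Convex.image_sub_le_mul_sub_of_deriv_le (f := f) (C := 1) convex_univ
      hd.continuous.continuousOn hd.differentiableOn
      (fun x _ => by rw [(hf x).deriv]; exact (h x).2) x (mem_univ _) y (mem_univ _) hxy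
    linarith

/-! ### The space of phases -/

namespace PhaseSpace

variable {a b : ℝ}

theorem unitSlope (φ : PhaseSpace a b) : UnitSlope φ.val := by
  intro x y h
  rw [← (φ.ac x y).integral_deriv_eq_sub, intervalIntegral.integral_of_le h]
  have hi : IntegrableOn (deriv φ.val) (Ioc x y) := by
    have := (φ.ac x y).intervalIntegrable_deriv
    rwa [intervalIntegrable_iff_integrableOn_Ioc_of_le h] at this
  refine ⟨integral_nonneg_of_ae (ae_restrict_of_ae (φ.deriv_mem.mono fun z hz => hz.1)), ?_⟩
  calc ∫ z in Ioc x y, deriv φ.val z ≤ ∫ _ in Ioc x y, (1 : ℝ) :=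
        integral_mono_ae hi (integrable_const _)
          (ae_restrict_of_ae (φ.deriv_mem.mono fun z hz => hz.2))
    _ = y - x := by simp [h]

theorem monotone (φ : PhaseSpace a b) : Monotone φ.val := φ.unitSlope.monotone

theorem continuous (φ : PhaseSpace a b) : Continuous φ.val := φ.unitSlope.continuous

theorem mem_Icc (φ : PhaseSpace a b) (y : ℝ) : φ y ∈ Icc a b :=
  ⟨φ.monotone.le_of_tendsto φ.tendsto_atBot y, φ.monotone.ge_of_tendsto φ.tendsto_atTop y⟩

@[ext]
theorem ext {φ ψ : PhaseSpace a b} (h : ∀ y, φ y = ψ y) : φ = ψ := by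
  cases φ; cases ψ
  congr
  exact funext h

/-- The element of the phase space given by a function with slopes in `[0,1]`. -/
def ofUnitSlope (f : ℝ → ℝ) (hf : UnitSlope f) (ha : Tendsto f atBot (𝓝 a))
    (hb : Tendsto f atTop (𝓝 b)) : PhaseSpace a b where
  val := f
  ac := hf.ac
  deriv_mem := Eventually.of_forall hf.deriv_mem
  tendsto_atBot := ha
  tendsto_atTop := hb

theorem tendsto_iff_uniform {ι : Type*} {l : Filter ι} {φ : ι → PhaseSpace a b}
    {ψ : PhaseSpace a b} :
    Tendsto φ l (𝓝 ψ) ↔ TendstoUniformly (fun i => (φ i).val) ψ.val l := by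
  rw [(Topology.IsInducing.mk rfl :
    Topology.IsInducing fun φ : PhaseSpace a b => UniformFun.ofFun φ.val).tendsto_nhds_iff,
    UniformFun.tendsto_iff_tendstoUniformly]
  rfl

/-- Pólya's theorem: for monotone functions with common limits at `±∞`, pointwise convergence to a
continuous limit is uniform. -/
theorem tendsto_of_pointwise {ι : Type*} {l : Filter ι} {φ : ι → PhaseSpace a b}
    {ψ : PhaseSpace a b} (h : ∀ y, Tendsto (fun i => φ i y) l (𝓝 (ψ y))) :
    Tendsto φ l (𝓝 ψ) := by
  rw [tendsto_iff_uniform, Metric.tendstoUniformly_iff]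
  intro ε' hε'
  obtain ⟨ε, hε, rfl⟩ : ∃ ε, 0 < ε ∧ ε' = 3 * ε := ⟨ε' / 3, by positivity, by ring⟩
  have ev1 : ∀ᶠ y in atTop, b - ε < ψ y := ψ.tendsto_atTop.eventually_const_lt (by linarith)
  have ev2 : ∀ᶠ y in atBot, ψ y < a + ε := ψ.tendsto_atBot.eventually_lt_const (by linarith)
  obtain ⟨R1, hR1⟩ := ev1.exists_forall_of_atTop
  obtain ⟨R2, hR2⟩ := ev2.exists_forall_of_atBot
  -- a finite grid of mesh `ε` that reaches beyond `R2` and `R1`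
  obtain ⟨N, hN⟩ := exists_nat_gt (max (R1 / ε) (-R2 / ε))
  have hN1 : R1 < N * ε := by rw [← div_lt_iff₀ hε]; exact (le_max_left _ _).trans_lt hN
  have hN2 : -R2 < N * ε := by rw [← div_lt_iff₀ hε]; exact (le_max_right _ _).trans_lt hN
  have grid : ∀ᶠ i in l, ∀ k ∈ Finset.Icc (-(N : ℤ)) N, |φ i (k * ε) - ψ (k * ε)| < ε := by
    rw [Filter.eventually_all_finset]
    intro k _
    exact (Metric.tendsto_nhds.1 (h _)) ε hε
  filter_upwards [grid] with i hi y
  rw [dist_comm, Real.dist_eq]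
  have top := abs_lt.1 (hi N (by simp))
  have bot := abs_lt.1 (hi (-N) (by simp))
  push_cast at top bot
  rcases lt_or_ge y (-(N * ε)) with hy | hy
  · have m1 := (φ i).monotone hy.le
    have m2 := ((φ i).mem_Icc y).1
    have m3 := (ψ.mem_Icc y).1
    have m4 := hR2 y (by linarith)
    have m5 := hR2 (-N * ε) (by linarith)
    rw [neg_mul] at *
    rw [abs_lt]; constructor <;> linarith
  rcases lt_or_ge y (N * ε) with hy' | hy'
  · have f1 : ⌊y / ε⌋ * ε ≤ y := by rw [← le_div_iff₀ hε]; exact Int.floor_le _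
    have f2 : y ≤ (⌊y / ε⌋ + 1) * ε := by
      rw [← div_le_iff₀ hε]; exact (Int.lt_floor_add_one _).le
    have k1 : -(N : ℤ) ≤ ⌊y / ε⌋ := by
      rw [Int.le_floor, le_div_iff₀ hε]; push_cast; linarith
    have k2 : ⌊y / ε⌋ < N := by
      rw [Int.floor_lt, div_lt_iff₀ hε]; exact_mod_cast hy'
    have g1 := abs_lt.1 (hi ⌊y / ε⌋ (by rw [Finset.mem_Icc]; omega))
    have g2 := abs_lt.1 (hi (⌊y / ε⌋ + 1) (by rw [Finset.mem_Icc]; omega))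
    push_cast at g2
    have m1 := (φ i).monotone f1
    have m2 := (φ i).monotone f2
    have s := ψ.unitSlope (⌊y / ε⌋ * ε) y f1
    have s' := ψ.unitSlope y ((⌊y / ε⌋ + 1) * ε) f2
    have s1 := s.1
    have s2 := s.2
    have s3 := s'.1
    have s4 := s'.2
    rw [abs_lt]; constructor <;> linarith
  · have m1 := (φ i).monotone hy'
    have m2 := ((φ i).mem_Icc y).2
    have m3 := (ψ.mem_Icc y).2
    have m4 := hR1 y (by linarith)
    have m5 := hR1 (N * ε) (by linarith)
    rw [abs_lt]; constructor <;> linarith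

end PhaseSpace

/-- Along an ultrafilter, a bounded real function converges. -/
theorem exists_tendsto_ultrafilter {ι : Type*} (U : Ultrafilter ι) (f : ι → ℝ) {a b : ℝ}
    (h : ∀ i, f i ∈ Icc a b) : ∃ c ∈ Icc a b, Tendsto f U (𝓝 c) :=
  isCompact_Icc.ultrafilter_le_nhds' (U.map f) (by
    rw [Ultrafilter.mem_map]; exact Filter.univ_mem' h)

/-- A set of phases with uniformly small tails is compact. -/
theorem PhaseSpace.isCompact_tails {a b : ℝ} (M : ℝ) :
    IsCompact {φ : PhaseSpace a b | (∀ y > 0, y * (b - φ y) ≤ M) ∧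
      ∀ y < 0, -y * (φ y - a) ≤ M} := by
  rw [isCompact_iff_ultrafilter_le_nhds']
  intro U hU
  choose f hf hlim using fun y : ℝ =>
    exists_tendsto_ultrafilter U (fun φ : PhaseSpace a b => φ y) (fun φ => φ.mem_Icc y)
  have hs : UnitSlope f := by
    intro x y hxy
    exact isClosed_Icc.mem_of_tendsto ((hlim y).sub (hlim x))
      (Eventually.of_forall fun φ => φ.unitSlope x y hxy)
  have ht1 : ∀ y > 0, y * (b - f y) ≤ M := fun y hy =>
    le_of_tendsto ((tendsto_const_nhds.sub (hlim y)).const_mul y)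
      (Filter.mem_of_superset hU fun φ hφ => hφ.1 y hy)
  have ht2 : ∀ y < 0, -y * (f y - a) ≤ M := fun y hy =>
    le_of_tendsto (((hlim y).sub tendsto_const_nhds).const_mul (-y))
      (Filter.mem_of_superset hU fun φ hφ => hφ.2 y hy)
  have hb : Tendsto f atTop (𝓝 b) := by
    refine tendsto_of_tendsto_of_tendsto_of_le_of_le' (g := fun y => b - M / y) (h := fun _ => b)
      ?_ tendsto_const_nhds ?_ (Eventually.of_forall fun y => (hf y).2)
    · simpa using (tendsto_const_nhds (x := b)).sub (tendsto_const_nhds.div_atTop tendsto_id)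
    · filter_upwards [eventually_gt_atTop 0] with y hy
      have := ht1 y hy
      rw [mul_comm, ← le_div_iff₀ hy] at this
      linarith
  have ha : Tendsto f atBot (𝓝 a) := by
    refine tendsto_of_tendsto_of_tendsto_of_le_of_le' (g := fun _ => a) (h := fun y => a + M / -y)
      tendsto_const_nhds ?_ (Eventually.of_forall fun y => (hf y).1) ?_
    · simpa using (tendsto_const_nhds (x := a)).add
        (tendsto_const_nhds.div_atTop tendsto_neg_atBot_atTop)
    · filter_upwards [eventually_lt_atBot 0] with y hy
      have := ht2 y hy
      rw [mul_comm, ← le_div_iff₀ (neg_pos.2 hy)] at this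
      linarith
  exact ⟨PhaseSpace.ofUnitSlope f hs ha hb, ⟨ht1, ht2⟩,
    PhaseSpace.tendsto_of_pointwise (φ := id) hlim⟩

/-! ### The weak* topology -/

namespace LinfUnit

theorem aestronglyMeasurable (u : LinfUnit) : AEStronglyMeasurable (u : ℝ → ℝ) :=
  Lp.aestronglyMeasurable u.val

theorem aemeasurable (u : LinfUnit) : AEMeasurable (u : ℝ → ℝ) :=
  u.aestronglyMeasurable.aemeasurable

theorem ext {u v : LinfUnit} (h : ∀ᵐ y, u y = v y) : u = v := by
  cases u; cases v
  congr
  exact Lp.ext h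

theorem memLp_top {f : ℝ → ℝ} (hm : AEMeasurable f) (h : ∀ y, f y ∈ Icc (0 : ℝ) 1) :
    MemLp f ∞ :=
  memLp_top_of_bound hm.aestronglyMeasurable 1 (Eventually.of_forall fun y => by
    rw [Real.norm_eq_abs, abs_of_nonneg (h y).1]; exact (h y).2)

/-- The class of a measurable function with values in `[0,1]`. -/
noncomputable def ofFun (f : ℝ → ℝ) (hm : AEMeasurable f) (h : ∀ y, f y ∈ Icc (0 : ℝ) 1) :
    LinfUnit where
  val := (memLp_top hm h).toLp f
  mem_unit := by
    filter_upwards [MemLp.coeFn_toLp (memLp_top hm h)] with y hy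
    rw [hy]; exact h y

theorem coeFn_ofFun (f : ℝ → ℝ) (hm : AEMeasurable f) (h : ∀ y, f y ∈ Icc (0 : ℝ) 1) :
    ∀ᵐ y, ofFun f hm h y = f y :=
  MemLp.coeFn_toLp (memLp_top hm h)

theorem integrable_mul (u : LinfUnit) {f : ℝ → ℝ} (hf : Integrable f) :
    Integrable fun y => u y * f y :=
  hf.bdd_mul u.aestronglyMeasurable (c := 1) (u.mem_unit.mono fun y hy => by
    rw [Real.norm_eq_abs, abs_of_nonneg hy.1]; exact hy.2)

theorem integrableOn (u : LinfUnit) {s : Set ℝ} (hs : volume s ≠ ∞) : IntegrableOn (u : ℝ → ℝ) s :=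
  Measure.integrableOn_of_bounded hs u.aestronglyMeasurable (M := 1)
    (ae_restrict_of_ae (u.mem_unit.mono fun y hy => by
      rw [Real.norm_eq_abs, abs_of_nonneg hy.1]; exact hy.2))

theorem integral_mem (u : LinfUnit) {s : Set ℝ} (hs : volume s ≠ ∞) :
    ∫ y in s, u y ∈ Icc 0 (volume.real s) := by
  refine ⟨integral_nonneg_of_ae (ae_restrict_of_ae (u.mem_unit.mono fun y hy => hy.1)), ?_⟩
  have : IsFiniteMeasure (volume.restrict s) := ⟨by simpa using hs.lt_top⟩
  calc ∫ y in s, u y ≤ ∫ _ in s, (1 : ℝ) :=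
        integral_mono_ae (u.integrableOn hs) (integrable_const _)
          (ae_restrict_of_ae (u.mem_unit.mono fun y hy => hy.2))
    _ = volume.real s := by simp

theorem abs_integral_mul_sub_le (u : LinfUnit) {f g : ℝ → ℝ} (hf : Integrable f)
    (hg : Integrable g) : |(∫ y, u y * f y) - ∫ y, u y * g y| ≤ ∫ y, |f y - g y| := by
  rw [← integral_sub (u.integrable_mul hf) (u.integrable_mul hg)]
  refine (abs_integral_le_integral_abs).trans ?_
  refine integral_mono_ae ((u.integrable_mul hf).sub (u.integrable_mul hg)).abs
    (hf.sub hg).abs (u.mem_unit.mono fun y hy => ?_)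
  simp only [← mul_sub, abs_mul]
  rw [abs_of_nonneg hy.1]
  exact mul_le_of_le_one_left (abs_nonneg _) hy.2

theorem tendsto_iff {ι : Type*} {l : Filter ι} {u : ι → LinfUnit} {v : LinfUnit} :
    Tendsto u l (𝓝 v) ↔ ∀ f : ℝ → ℝ, Integrable f →
      Tendsto (fun i => ∫ y, u i y * f y) l (𝓝 (∫ y, v y * f y)) := by
  rw [(Topology.IsInducing.mk rfl : Topology.IsInducing
    fun (u : LinfUnit) (f : Lp ℝ 1 (volume : Measure ℝ)) => ∫ y, u y * f y).tendsto_nhds_iff,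
    tendsto_pi_nhds]
  constructor
  · intro h f hf
    have e : ∀ w : LinfUnit, ∫ y, w y * (hf.toL1 f) y = ∫ y, w y * f y := fun w =>
      integral_congr_ae (hf.coeFn_toL1.mono fun y hy => by simp only [hy])
    simpa only [Function.comp_def, e] using h (hf.toL1 f)
  · exact fun h f => h f (L1.integrable_coeFn f)

theorem tendsto_setIntegral_of_iUnion {ι κ : Type*} [Countable κ] {l : Filter ι}
    {u : ι → LinfUnit} {v : LinfUnit} {s : κ → Set ℝ} (hm : ∀ k, MeasurableSet (s k))
    (hd : Pairwise (Function.onFun Disjoint s)) (hs : volume (⋃ k, s k) ≠ ∞)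
    (h : ∀ k, Tendsto (fun i => ∫ y in s k, u i y) l (𝓝 (∫ y in s k, v y))) :
    Tendsto (fun i => ∫ y in ⋃ k, s k, u i y) l (𝓝 (∫ y in ⋃ k, s k, v y)) := by
  have hk : ∀ k, volume (s k) ≠ ∞ := fun k =>
    ne_top_of_le_ne_top hs (measure_mono (subset_iUnion s k))
  simp only [fun w : LinfUnit => integral_iUnion hm hd (w.integrableOn hs)]
  have hsum : Summable fun k => volume.real (s k) := by
    have := (hasSum_integral_iUnion (μ := volume) (f := fun _ => (1 : ℝ)) hm hd
      (integrableOn_const hs)).summable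
    simpa using this
  refine tendsto_tsum_of_dominated_convergence hsum h (Eventually.of_forall fun i k => ?_)
  have := (u i).integral_mem (hk k)
  rw [Real.norm_eq_abs, abs_of_nonneg this.1]
  exact this.2

/-- Weak* convergence in `L^∞(ℝ;[0,1])` may be tested on intervals. -/
theorem tendsto_of_intervals {ι : Type*} {l : Filter ι} {u : ι → LinfUnit} {v : LinfUnit}
    (h : ∀ a b : ℝ, a ≤ b →
      Tendsto (fun i => ∫ y in Ioc a b, u i y) l (𝓝 (∫ y in Ioc a b, v y))) :
    Tendsto u l (𝓝 v) := by
  have bdd : ∀ (s : Set ℝ) (c d : ℝ), volume (s ∩ Ioc c d) ≠ ∞ := fun s c d =>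
    ne_top_of_le_ne_top (by simp : volume (Ioc c d) ≠ ∞) (measure_mono inter_subset_right)
  have step1 : ∀ c d : ℝ, c ≤ d → ∀ s : Set ℝ, MeasurableSet s →
      Tendsto (fun i => ∫ y in s ∩ Ioc c d, u i y) l (𝓝 (∫ y in s ∩ Ioc c d, v y)) := by
    intro c d hcd
    refine MeasurableSpace.induction_on_inter
      (C := fun s _ => Tendsto (fun i => ∫ y in s ∩ Ioc c d, u i y) l
        (𝓝 (∫ y in s ∩ Ioc c d, v y)))
      (BorelSpace.measurable_eq.trans (borel_eq_generateFrom_Iic ℝ)) isPiSystem_Iic ?_ ?_ ?_ ?_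
    · simpa using tendsto_const_nhds
    · rintro _ ⟨e, rfl⟩
      have : Iic e ∩ Ioc c d = Ioc c (max c (min d e)) := by ext y; simp; grind
      rw [this]
      exact h _ _ (le_max_left _ _)
    · intro t ht hC
      have e : ∀ w : LinfUnit, ∫ y in tᶜ ∩ Ioc c d, w y =
          (∫ y in Ioc c d, w y) - ∫ y in t ∩ Ioc c d, w y := by
        intro w
        have := integral_inter_add_sdiff (f := (w : ℝ → ℝ)) (s := Ioc c d) (μ := volume) ht
          (w.integrableOn (by simp))
        rw [inter_comm t, ← this, inter_comm, ← sdiff_eq]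
        ring
      simp only [e]
      exact (h c d hcd).sub hC
    · intro f hd hm hC
      simp only [iUnion_inter]
      exact tendsto_setIntegral_of_iUnion (fun k => (hm k).inter measurableSet_Ioc)
        (fun i j hij => (hd hij).mono inter_subset_left inter_subset_left)
        (by rw [← iUnion_inter]; exact bdd _ _ _) hC
  have step2 : ∀ s : Set ℝ, MeasurableSet s → volume s < ∞ →
      Tendsto (fun i => ∫ y in s, u i y) l (𝓝 (∫ y in s, v y)) := by
    intro s hm hs
    have e : s = ⋃ k : ℤ, s ∩ Ioc (k : ℝ) (k + 1) := by
      rw [← inter_iUnion, iUnion_Ioc_intCast, inter_univ]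
    rw [e]
    exact tendsto_setIntegral_of_iUnion (fun k => hm.inter measurableSet_Ioc)
      (fun i j hij => (pairwise_disjoint_Ioc_intCast ℝ hij).mono inter_subset_right
        inter_subset_right) (by rw [← e]; exact hs.ne)
      (fun k => step1 _ _ (by linarith) s hm)
  rw [tendsto_iff]
  intro f hf
  refine Integrable.induction (P := fun f : ℝ → ℝ =>
    Tendsto (fun i => ∫ y, u i y * f y) l (𝓝 (∫ y, v y * f y))) ?_ ?_ ?_ ?_ hf
  · intro c s hm hs
    have e : ∀ w : LinfUnit, ∫ y, w y * s.indicator (fun _ => c) y = (∫ y in s, w y) * c := by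
      intro w
      rw [← integral_mul_const, ← integral_indicator hm]
      congr 1; ext y
      by_cases hy : y ∈ s <;> simp [hy]
    simp only [e]
    exact (step2 s hm hs).mul_const c
  · intro f g _ hf hg h1 h2
    have e : ∀ w : LinfUnit, ∫ y, w y * (f + g) y = (∫ y, w y * f y) + ∫ y, w y * g y := by
      intro w
      rw [← integral_add (w.integrable_mul hf) (w.integrable_mul hg)]
      simp only [Pi.add_apply, mul_add]
    simp only [e]
    exact h1.add h2
  · rw [← isSeqClosed_iff_isClosed]
    intro F f hF hlim
    rw [mem_ofPred_eq, Metric.tendsto_nhds]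
    intro ε hε
    obtain ⟨n, hn⟩ := ((Metric.tendsto_nhds.1 hlim) (ε / 3) (by positivity)).exists
    rw [L1.dist_eq_integral_dist] at hn
    simp only [Real.dist_eq] at hn
    have hw : ∀ w : LinfUnit, |(∫ y, w y * F n y) - ∫ y, w y * f y| < ε / 3 := fun w =>
      (w.abs_integral_mul_sub_le (L1.integrable_coeFn _) (L1.integrable_coeFn _)).trans_lt hn
    filter_upwards [(Metric.tendsto_nhds.1 (hF n)) (ε / 3) (by positivity)] with i hi
    rw [Real.dist_eq] at *
    have h1 := abs_lt.1 (hw (u i))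
    have h2 := abs_lt.1 (hw v)
    have h3 := abs_lt.1 hi
    rw [abs_lt]; constructor <;> linarith
  · intro f g hfg hf h1
    have e : ∀ w : LinfUnit, ∫ y, w y * g y = ∫ y, w y * f y := fun w =>
      integral_congr_ae (hfg.mono fun y hy => by simp only [hy])
    simpa only [e] using h1

/-- Pointwise convergence of representatives implies weak* convergence. -/
theorem tendsto_of_ae_eq {ι : Type*} {l : Filter ι} [l.IsCountablyGenerated] {u : ι → LinfUnit}
    {v : LinfUnit} {g : ι → ℝ → ℝ} {g₀ : ℝ → ℝ} (hu : ∀ᶠ i in l, ∀ᵐ y, u i y = g i y)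
    (hv : ∀ᵐ y, v y = g₀ y) (h : ∀ᵐ y, Tendsto (fun i => g i y) l (𝓝 (g₀ y))) :
    Tendsto u l (𝓝 v) := by
  rw [tendsto_iff]
  intro f hf
  have e : ∫ y, v y * f y = ∫ y, g₀ y * f y := integral_congr_ae (hv.mono fun y hy => by
    simp only [hy])
  have ei : ∀ᶠ i in l, (fun y => u i y * f y) =ᵐ[volume] fun y => g i y * f y :=
    hu.mono fun i hi => hi.mono fun y hy => by simp only [hy]
  rw [e]
  refine Tendsto.congr' (ei.mono fun i hi => (integral_congr_ae hi).symm) ?_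
  refine tendsto_integral_filter_of_dominated_convergence (fun y => |f y|)
    (ei.mono fun i hi => ((u i).integrable_mul hf).aestronglyMeasurable.congr hi)
    (hu.mono fun i hi => ?_) hf.abs (h.mono fun y hy => hy.mul_const _)
  filter_upwards [hi, (u i).mem_unit] with y h1 h2
  rw [h1] at h2
  rw [Real.norm_eq_abs, abs_mul, abs_of_nonneg h2.1]
  exact mul_le_of_le_one_left (abs_nonneg _) h2.2

/-- The class of the derivative of a function with slopes in `[0,1]`. -/
noncomputable def ofDeriv (f : ℝ → ℝ) (hf : UnitSlope f) : LinfUnit :=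
  ofFun (deriv f) (measurable_deriv f).aemeasurable hf.deriv_mem

theorem coeFn_ofDeriv {f : ℝ → ℝ} (hf : UnitSlope f) : ∀ᵐ y, ofDeriv f hf y = deriv f y :=
  coeFn_ofFun _ _ _

theorem integral_ofDeriv {f : ℝ → ℝ} (hf : UnitSlope f) {a b : ℝ} (hab : a ≤ b) :
    ∫ y in Ioc a b, ofDeriv f hf y = f b - f a := by
  rw [← hf.integral_deriv, intervalIntegral.integral_of_le hab]
  exact integral_congr_ae (ae_restrict_of_ae (coeFn_ofDeriv hf))

/-- `L^∞(ℝ;[0,1])` is weak* compact: along an ultrafilter the primitives converge to a function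
with slopes in `[0,1]`, whose derivative is the limit. -/
instance : CompactSpace LinfUnit := by
  refine ⟨isCompact_iff_ultrafilter_le_nhds'.2 fun U _ => ?_⟩
  have hb : ∀ (y : ℝ) (u : LinfUnit), (∫ t in (0 : ℝ)..y, u t) ∈ Icc (-|y|) |y| := by
    intro y u
    have := intervalIntegral.norm_integral_le_of_norm_le_const_ae (f := (u : ℝ → ℝ)) (C := 1)
      (a := 0) (b := y) (u.mem_unit.mono fun t ht _ => by
        rw [Real.norm_eq_abs, abs_of_nonneg ht.1]; exact ht.2)
    rw [one_mul, sub_zero, Real.norm_eq_abs] at this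
    exact abs_le.1 this
  choose f _ hlim using fun y => exists_tendsto_ultrafilter U _ (hb y)
  have hsub : ∀ (u : LinfUnit) (a b : ℝ), a ≤ b →
      (∫ t in (0 : ℝ)..b, u t) - (∫ t in (0 : ℝ)..a, u t) = ∫ t in Ioc a b, u t := by
    intro u a b hab
    have hi : ∀ c d : ℝ, IntervalIntegrable (u : ℝ → ℝ) volume c d := fun c d =>
      intervalIntegrable_iff.2 (u.integrableOn (by simp [uIoc]))
    rw [intervalIntegral.integral_interval_sub_left (hi _ _) (hi _ _),
      intervalIntegral.integral_of_le hab]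
  have hs : UnitSlope f := by
    intro a b hab
    refine isClosed_Icc.mem_of_tendsto ((hlim b).sub (hlim a)) (Eventually.of_forall fun u => ?_)
    rw [hsub u a b hab]
    simpa [hab] using u.integral_mem (s := Ioc a b) (by simp)
  refine ⟨ofDeriv f hs, mem_univ _, tendsto_of_intervals (u := id) fun a b hab => ?_⟩
  rw [integral_ofDeriv hs hab]
  refine ((hlim b).sub (hlim a)).congr fun u => hsub u a b hab

end LinfUnit

/-- The class of `φ'`. -/
noncomputable def PhaseSpace.derivClass {a b : ℝ} (φ : PhaseSpace a b) : LinfUnit :=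
  LinfUnit.ofDeriv φ.val φ.unitSlope

/-- Uniform convergence of the phases implies weak* convergence of their derivatives. -/
theorem PhaseSpace.continuous_derivClass {a b : ℝ} :
    Continuous (PhaseSpace.derivClass : PhaseSpace a b → LinfUnit) := by
  rw [continuous_iff_continuousAt]
  intro φ
  refine LinfUnit.tendsto_of_intervals fun c d hcd => ?_
  simp only [derivClass, LinfUnit.integral_ofDeriv _ hcd]
  have := PhaseSpace.tendsto_iff_uniform.1 (tendsto_id (x := 𝓝 φ))
  exact (this.tendsto_at d).sub (this.tendsto_at c)

instance : R1Space LinfUnit :=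
  (Topology.IsInducing.mk rfl : Topology.IsInducing
    fun (u : LinfUnit) (f : Lp ℝ 1 (volume : Measure ℝ)) => ∫ y, u y * f y).r1Space

instance (a b : ℝ) : R1Space (PhaseSpace a b) :=
  (Topology.IsInducing.mk rfl :
    Topology.IsInducing fun φ : PhaseSpace a b => UniformFun.ofFun φ.val).r1Space

/-! ### Change of variables along a phase -/

/-- Up to null sets, the image under a phase of its set of differentiability is `(a,b)`: the
complement is null and the phase is Lipschitz. -/
theorem PhaseSpace.image_ae_eq {a b : ℝ} (φ : PhaseSpace a b) :
    (φ.val '' {y | DifferentiableAt ℝ φ.val y} : Set ℝ) =ᵐ[volume] Ioo a b := by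
  set s := {y | DifferentiableAt ℝ φ.val y} with hs
  have hnull : volume (φ.val '' sᶜ) = 0 := by
    have h1 : volume sᶜ = 0 := φ.unitSlope.lipschitz.ae_differentiableAt_of_real
    have h2 := φ.unitSlope.lipschitz.hausdorffMeasure_image_le zero_le_one sᶜ
    rw [hausdorffMeasure_real, h1, mul_zero] at h2
    exact le_antisymm h2 bot_le
  have h1 : φ.val '' s ⊆ Icc a b := by
    rintro _ ⟨y, _, rfl⟩; exact φ.mem_Icc y
  have h2 : Ioo a b ⊆ φ.val '' s ∪ φ.val '' sᶜ := by
    rw [← image_union, union_compl_self, image_univ]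
    intro t ht
    exact mem_range_of_exists_le_of_exists_ge φ.continuous
      (φ.tendsto_atBot.eventually_le_const ht.1).exists
      (φ.tendsto_atTop.eventually_const_le ht.2).exists
  refine EventuallyLE.antisymm ?_ ?_
  · exact h1.eventuallyLE.trans Ioo_ae_eq_Icc.symm.le
  · refine h2.eventuallyLE.trans (EventuallyEq.le ?_)
    exact union_ae_eq_left_of_ae_eq_empty (ae_eq_empty.2 hnull)

theorem PhaseSpace.differentiable_ae_eq {a b : ℝ} (φ : PhaseSpace a b) :
    ({y | DifferentiableAt ℝ φ.val y} : Set ℝ) =ᵐ[volume] univ :=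
  ae_eq_univ.2 φ.unitSlope.lipschitz.ae_differentiableAt_of_real

theorem PhaseSpace.integrable_deriv_mul {a b : ℝ} (φ : PhaseSpace a b) {w : ℝ → ℝ}
    (hw : IntegrableOn w (Ioo a b)) : Integrable fun y => deriv φ.val y * w (φ y) := by
  have h := integrableOn_image_iff_integrableOn_deriv_smul_of_monotoneOn (f := φ.val)
    (measurableSet_of_differentiableAt ℝ φ.val) (f' := deriv φ.val)
    (fun y hy => (DifferentiableAt.hasDerivAt hy).hasDerivWithinAt) (φ.monotone.monotoneOn _) w
  rw [integrableOn_congr_set_ae φ.image_ae_eq,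
    integrableOn_congr_set_ae φ.differentiable_ae_eq, integrableOn_univ] at h
  exact h.1 hw

theorem PhaseSpace.integral_deriv_mul {a b : ℝ} (φ : PhaseSpace a b) (w : ℝ → ℝ) :
    ∫ y, deriv φ.val y * w (φ y) = ∫ t in Ioo a b, w t := by
  have h := integral_image_eq_integral_deriv_smul_of_monotoneOn (f := φ.val)
    (measurableSet_of_differentiableAt ℝ φ.val) (f' := deriv φ.val)
    (fun y hy => (DifferentiableAt.hasDerivAt hy).hasDerivWithinAt) (φ.monotone.monotoneOn _) w
  rw [setIntegral_congr_set φ.image_ae_eq, setIntegral_congr_set φ.differentiable_ae_eq,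
    setIntegral_univ] at h
  exact h.symm

/-- The logarithmic singularities of `chem (slope A t)` at `t = ±Φ` are integrable. -/
theorem OppositePhases.integrableOn_chem_slope {um up : ℝ} (h : OppositePhases um up) :
    IntegrableOn (fun t => chem (slope (up * um) t)) (Ioo (-chem up) (chem up)) := by
  have hp := h.chem_up_pos
  have hA := h.mul_pos
  set Φ := chem up with hΦ
  have i1 : IntegrableOn (fun t => Real.log (t + Φ)) (Ioo (-Φ) Φ) := by
    have := (intervalIntegral.intervalIntegrable_log' (a := 0) (b := 2 * Φ)).comp_add_right Φ
    rwa [zero_sub, show 2 * Φ - Φ = Φ by ring,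
      intervalIntegrable_iff_integrableOn_Ioo_of_le (by linarith)] at this
  have i2 : IntegrableOn (fun t => Real.log (Φ - t)) (Ioo (-Φ) Φ) := by
    have := (intervalIntegral.intervalIntegrable_log' (a := 2 * Φ) (b := 0)).comp_sub_left Φ
    rwa [sub_zero, show Φ - 2 * Φ = -Φ by ring,
      intervalIntegrable_iff_integrableOn_Ioo_of_le (by linarith)] at this
  have i3 : IntegrableOn (fun t => -Real.log (up * um) + Real.log (mobility t) +
      -Real.log ((up * um) ^ 2)) (Ioo (-Φ) Φ) := by
    refine (ContinuousOn.integrableOn_Icc ?_).mono_set Ioo_subset_Icc_self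
    exact ((continuous_const.add (continuous_mobility.log fun t => (mobility_pos t).ne')).add
      continuous_const).continuousOn
  refine Integrable.mono' ((i3.sub i1).sub i2)
    (measurable_chem.comp (continuous_slope _).measurable).aestronglyMeasurable ?_
  filter_upwards [ae_restrict_mem measurableSet_Ioo] with t ht
  have ht' : t ∈ Icc (-Φ) Φ := ⟨ht.1.le, ht.2.le⟩
  have ha : 0 < t + Φ := by linarith [ht.1]
  have hb : 0 < Φ - t := by linarith [ht.2]
  have hle := h.mul_le_slope ht'
  rw [← hΦ] at hle
  have h0 : 0 < slope (up * um) t := lt_of_lt_of_le (by positivity) hle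
  have h1 := slope_lt_one hA t
  have hlog := Real.log_le_log (by positivity) hle
  rw [Real.log_mul (by positivity) (by positivity), Real.log_mul ha.ne' hb.ne'] at hlog
  have hn := Real.log_nonpos h0.le h1.le
  have hm := h.log_mobility_nonneg ht'
  simp only [Pi.sub_apply]
  rw [chem_eq h0 h1, one_sub_slope, Real.log_div hA.ne' (mobility_pos t).ne', Real.norm_eq_abs,
    abs_le]
  constructor <;> linarith

/-! ### The energy as a relative entropy -/

variable {um up : ℝ}

/-- The energy of the state above the minimum, written as a sum of two relative entropies: of `u`
with respect to the local equilibrium `σ(φ)`, and of `φ'` with respect to the slope of the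
standing wave. -/
noncomputable def excess (x : State um up) : ℝ≥0∞ :=
  (∫⁻ y, ENNReal.ofReal (kl (x.1 y) (Real.sigmoid (x.2 y)))) +
    ∫⁻ y, ENNReal.ofReal (kl (deriv x.2.val y) (slope (up * um) (x.2 y)))

/-- The minimum of the energy: the integral of the null Lagrangian. -/
noncomputable def minEnergy (um up : ℝ) : ℝ :=
  ∫ t in Ioo (chem um) (chem up), chem (slope (up * um) t)

theorem aemeasurable_kl_density (x : State um up) :
    AEMeasurable fun y => kl (x.1 y) (Real.sigmoid (x.2 y)) :=
  measurable_kl.comp_aemeasurable (x.1.aemeasurable.prodMk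
    (differentiable_sigmoid.continuous.comp x.2.continuous).measurable.aemeasurable)

theorem measurable_kl_slope (B : ℝ) (x : State um up) :
    Measurable fun y => kl (deriv x.2.val y) (slope B (x.2 y)) :=
  measurable_kl.comp ((measurable_deriv _).prodMk
    ((continuous_slope B).comp x.2.continuous).measurable)

theorem measurable_step (a b : ℝ) : Measurable (step a b) :=
  Measurable.ite measurableSet_Iio measurable_const measurable_const

theorem devU_sq (z : ℝ) (x : State um up) :
    devU z x ^ 2 = ∫⁻ y, ENNReal.ofReal ((x.1 y - step um up (y - z)) ^ 2) := by
  have h := eLpNorm_nnreal_pow_eq_lintegral (μ := (volume : Measure ℝ)) (p := 2)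
    (f := fun y => x.1 y - step um up (y - z)) two_ne_zero
  simp only [NNReal.coe_ofNat, ENNReal.rpow_ofNat, ENNReal.coe_ofNat] at h
  rw [devU, h]
  refine lintegral_congr fun y => ?_
  rw [Real.enorm_eq_ofReal_abs, ← ENNReal.ofReal_pow (abs_nonneg _), sq_abs]

theorem devPhi_eq (z : ℝ) (x : State um up) :
    devPhi z x = ∫⁻ y, ENNReal.ofReal |x.2 y - step (chem um) (chem up) (y - z)| := by
  simp only [devPhi, eLpNorm_one_eq_lintegral_enorm, Real.enorm_eq_ofReal_abs]

theorem aemeasurable_devU (z : ℝ) (x : State um up) :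
    AEMeasurable fun y => x.1 y - step um up (y - z) :=
  x.1.aemeasurable.sub ((measurable_step _ _).comp (measurable_id.sub_const z)).aemeasurable

theorem measurable_devPhi (z : ℝ) (x : State um up) :
    Measurable fun y => x.2 y - step (chem um) (chem up) (y - z) :=
  x.2.continuous.measurable.sub ((measurable_step _ _).comp (measurable_id.sub_const z))

theorem step_eq_or (a b y : ℝ) : step a b y = a ∨ step a b y = b := by
  unfold step; split_ifs <;> simp

theorem memLp_step_sub (a b z : ℝ) (p : ℝ≥0∞) :
    MemLp (fun y => step a b (y - z) - step a b y) p := by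
  refine MemLp.mono (memLp_indicator_const p (measurableSet_Icc (a := -|z|) (b := |z|)) (b - a)
    (Or.inr (by simp)))
    (((measurable_step _ _).comp (measurable_id.sub_const z)).sub
      (measurable_step _ _)).aestronglyMeasurable (Eventually.of_forall fun y => ?_)
  unfold step
  by_cases hy : y ∈ Icc (-|z|) |z|
  · rw [indicator_of_mem hy]
    split_ifs <;> simp [abs_sub_comm]
  · rw [indicator_of_notMem hy]
    rw [mem_Icc] at hy
    have := neg_abs_le z
    have := le_abs_self z
    split_ifs <;> simp <;> grind

/-- Membership in the domain may be tested with a translated step. -/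
theorem mem_domainD_of_translated {x : State um up} {z : ℝ} (hu : devU z x < ⊤)
    (hp : devPhi z x < ⊤) : x ∈ domainD um up := by
  have h1 : MemLp (fun y => x.1 y - step um up (y - z)) 2 :=
    ⟨(aemeasurable_devU z x).aestronglyMeasurable, hu⟩
  have h2 : MemLp (fun y => x.2 y - step (chem um) (chem up) (y - z)) 1 :=
    ⟨(measurable_devPhi z x).aestronglyMeasurable, hp⟩
  refine ENNReal.add_lt_top.2 ⟨?_, ?_⟩
  · convert (h1.add (memLp_step_sub um up z 2)).2 using 1
    rw [devU]; congr 1; ext y; simp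
  · convert (h2.add (memLp_step_sub (chem um) (chem up) z 1)).2 using 1
    rw [devPhi]; congr 1; ext y; simp

theorem kl_density_nonneg (x : State um up) :
    ∀ᵐ y, 0 ≤ kl (x.1 y) (Real.sigmoid (x.2 y)) := by
  filter_upwards [x.1.mem_unit] with y hy
  exact kl_nonneg hy (Real.sigmoid_pos _) (Real.sigmoid_lt_one _)

theorem integrable_dev {x : State um up} (hx : x ∈ domainD um up) :
    Integrable (fun y => (x.1 y - step um up y) ^ 2) ∧
      Integrable (fun y => |x.2 y - step (chem um) (chem up) y|) := by
  obtain ⟨h1, h2⟩ := ENNReal.add_lt_top.1 hx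
  have m1 := aemeasurable_devU 0 x
  have m2 := measurable_devPhi 0 x
  have e1 : devU 0 x ^ 2 < ⊤ := ENNReal.pow_lt_top h1
  rw [devU_sq] at e1
  rw [devPhi_eq] at h2
  simp only [sub_zero] at m1 m2 e1 h2
  refine ⟨⟨(m1.pow_const 2).aestronglyMeasurable, ?_⟩, ⟨m2.abs.aestronglyMeasurable, ?_⟩⟩
  · rwa [hasFiniteIntegral_iff_ofReal (Eventually.of_forall fun y => sq_nonneg _)]
  · rwa [hasFiniteIntegral_iff_ofReal (Eventually.of_forall fun y => abs_nonneg _)]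

namespace OppositePhases

variable (h : OppositePhases um up)
include h

theorem mem_Icc (x : State um up) (y : ℝ) : x.2 y ∈ Icc (-chem up) (chem up) := by
  rw [← h.chem_um]; exact x.2.mem_Icc y

/-- A phase is stationary wherever the slope of the standing wave vanishes, since there it
attains its maximum or its minimum. -/
theorem deriv_eq_zero (x : State um up) {y : ℝ} (hy : slope (up * um) (x.2 y) = 0) :
    deriv x.2.val y = 0 := by
  rw [h.slope_eq, div_eq_zero_iff, or_iff_left (mobility_pos _).ne', mul_eq_zero] at hy
  rcases hy with hy | hy
  · have e : x.2 y = chem um := by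
      rw [← chem_sigmoid (x.2 y), sub_eq_zero.1 hy]
    have : IsMinOn x.2.val univ y := fun t _ => e.le.trans (x.2.mem_Icc t).1
    exact (this.isLocalMin univ_mem).deriv_eq_zero
  · have e : x.2 y = chem up := by
      rw [← chem_sigmoid (x.2 y), ← sub_eq_zero.1 hy]
    have : IsMaxOn x.2.val univ y := fun t _ => (x.2.mem_Icc t).2.trans e.ge
    exact (this.isLocalMax univ_mem).deriv_eq_zero

theorem slope_cases (x : State um up) (y : ℝ) :
    (0 < slope (up * um) (x.2 y) ∧ slope (up * um) (x.2 y) < 1) ∨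
      slope (up * um) (x.2 y) = 0 ∧ deriv x.2.val y = 0 := by
  rcases (h.slope_nonneg le_rfl (h.mem_Icc x y)).eq_or_lt with h0 | h0
  · exact Or.inr ⟨h0.symm, h.deriv_eq_zero x h0.symm⟩
  · exact Or.inl ⟨h0, slope_lt_one h.mul_pos _⟩

theorem kl_slope_nonneg (x : State um up) (y : ℝ) :
    0 ≤ kl (deriv x.2.val y) (slope (up * um) (x.2 y)) := by
  rcases h.slope_cases x y with ⟨h0, h1⟩ | ⟨h0, h1⟩
  · exact kl_nonneg (x.2.unitSlope.deriv_mem y) h0 h1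
  · rw [h0, h1, kl_zero_zero]

theorem slope_le_kl (x : State um up) (y : ℝ) : slope (up * um) (x.2 y) ≤
    2 * kl (deriv x.2.val y) (slope (up * um) (x.2 y)) + 2 * deriv x.2.val y := by
  rcases h.slope_cases x y with ⟨h0, h1⟩ | ⟨h0, h1⟩
  · exact le_kl_add (x.2.unitSlope.deriv_mem y) h0 h1
  · rw [h0, h1, kl_zero_zero]; simp

theorem step_sigmoid (y : ℝ) :
    step um up y = Real.sigmoid (step (chem um) (chem up) y) := by
  unfold step; split_ifs
  · exact h.sigmoid_um.symm
  · exact h.sigmoid_up.symm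

theorem sq_sigmoid_sub_le (t y : ℝ) :
    (Real.sigmoid t - step um up y) ^ 2 ≤ |t - step (chem um) (chem up) y| := by
  rw [h.step_sigmoid]
  refine le_trans ?_ (abs_sigmoid_sub_le _ _)
  rw [← sq_abs, sq]
  refine mul_le_of_le_one_left (abs_nonneg _) ?_
  rw [abs_le]
  constructor <;> linarith [Real.sigmoid_pos t, Real.sigmoid_lt_one t,
    Real.sigmoid_pos (step (chem um) (chem up) y), Real.sigmoid_lt_one (step (chem um) (chem up) y)]

theorem kl_density_le (x : State um up) (z : ℝ) : ∀ᵐ y,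
    kl (x.1 y) (Real.sigmoid (x.2 y)) ≤ (up * um)⁻¹ *
      (2 * (x.1 y - step um up (y - z)) ^ 2 +
        2 * |x.2 y - step (chem um) (chem up) (y - z)|) := by
  filter_upwards [x.1.mem_unit] with y hy
  have hA := h.mul_pos
  refine (kl_le_sq hy (Real.sigmoid_pos _) (Real.sigmoid_lt_one _)).trans ?_
  have h1 := h.le_mobility (h.mem_Icc x y)
  have h2 := h.sq_sigmoid_sub_le (x.2 y) (y - z)
  rw [inv_mul_eq_div]
  refine div_le_div₀ (by positivity) ?_ hA h1
  nlinarith [sq_nonneg ((x.1 y - step um up (y - z)) +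
    (Real.sigmoid (x.2 y) - step um up (y - z)))]

theorem exists_zero (x : State um up) : ∃ z, x.2 z = 0 := by
  have hp := h.chem_up_pos
  exact mem_range_of_exists_le_of_exists_ge x.2.continuous
    (x.2.tendsto_atBot.eventually_le_const (by rw [h.chem_um]; linarith)).exists
    (x.2.tendsto_atTop.eventually_const_le hp).exists

theorem dist_step_le (x : State um up) {z : ℝ} (hz : x.2 z = 0) (y : ℝ) :
    |x.2 y - step (chem um) (chem up) (y - z)| ≤
      ((up * um) ^ 2 * chem up)⁻¹ * slope (up * um) (x.2 y) := by
  refine le_trans ?_ (h.dist_le_slope (h.mem_Icc x y))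
  have hp := h.chem_up_pos
  have hc := h.chem_um
  unfold step
  by_cases hy : y < z
  · have h1 := x.2.monotone hy.le
    change x.2 y ≤ x.2 z at h1
    rw [hz] at h1
    rw [if_pos (sub_neg.2 hy)]
    rcases h1.eq_or_lt with h0 | h0
    · rw [h0, if_neg (lt_irrefl _), hc]; simp
    · rw [if_pos h0]
  · have h1 := x.2.monotone (not_lt.1 hy)
    change x.2 z ≤ x.2 y at h1
    rw [hz] at h1
    rw [if_neg (by linarith), if_neg (by linarith)]

theorem lintegral_deriv (x : State um up) :
    ∫⁻ y, ENNReal.ofReal (deriv x.2.val y) = ENNReal.ofReal (2 * chem up) := by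
  have hp := h.chem_up_pos
  have h1 := x.2.integrable_deriv_mul (w := fun _ => 1) (integrableOn_const (by simp))
  have h2 := x.2.integral_deriv_mul (fun _ => 1)
  simp only [mul_one] at h1 h2
  rw [← ofReal_integral_eq_lintegral_ofReal h1
    (Eventually.of_forall fun y => (x.2.unitSlope.deriv_mem y).1), h2]
  congr 1
  rw [h.chem_um]
  simp [hp.le]
  ring

/-- Coercivity: the deviation from the step centred at a zero of the phase is controlled by the
excess energy. -/
theorem dev_le_excess : ∃ C : ℝ, 0 < C ∧ ∀ (x : State um up) (z : ℝ), x.2 z = 0 →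
    devU z x ^ 2 + devPhi z x ≤ ENNReal.ofReal C * (excess x + 1) := by
  have hA := h.mul_pos
  have hp := h.chem_up_pos
  set K := ((up * um) ^ 2 * chem up)⁻¹ with hK
  have hK0 : 0 < K := by positivity
  refine ⟨8 + 6 * K + 12 * K * chem up, by positivity, fun x z hz => ?_⟩
  set F1 := ∫⁻ y, ENNReal.ofReal (kl (x.1 y) (Real.sigmoid (x.2 y))) with hF1
  set F2 := ∫⁻ y, ENNReal.ofReal (kl (deriv x.2.val y) (slope (up * um) (x.2 y))) with hF2
  have hphi : devPhi z x ≤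
      ENNReal.ofReal (2 * K) * F2 + ENNReal.ofReal (2 * K) * ENNReal.ofReal (2 * chem up) := by
    have hm := measurable_kl_slope (up * um) x
    rw [devPhi_eq, hF2, ← h.lintegral_deriv x,
      ← lintegral_const_mul _ hm.ennreal_ofReal,
      ← lintegral_const_mul _ (measurable_deriv _).ennreal_ofReal,
      ← lintegral_add_left (hm.ennreal_ofReal.const_mul _)]
    refine lintegral_mono fun y => ?_
    have h1 := h.kl_slope_nonneg x y
    have h2 := (x.2.unitSlope.deriv_mem y).1
    rw [← ENNReal.ofReal_mul (by positivity), ← ENNReal.ofReal_mul (by positivity),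
      ← ENNReal.ofReal_add (by positivity) (by positivity)]
    refine ENNReal.ofReal_le_ofReal ?_
    have h3 := mul_le_mul_of_nonneg_left (h.slope_le_kl x y) hK0.le
    have h4 := h.dist_step_le x hz y
    linarith
  have hu : devU z x ^ 2 ≤ ENNReal.ofReal 8 * F1 + ENNReal.ofReal 2 * devPhi z x := by
    have hm := aemeasurable_kl_density x
    have hm2 := (measurable_devPhi z x).abs.ennreal_ofReal
    simp only [devU_sq, devPhi_eq, hF1]
    rw [← lintegral_const_mul'' _ hm.ennreal_ofReal, ← lintegral_const_mul _ hm2,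
      ← lintegral_add_left' (hm.ennreal_ofReal.const_mul _)]
    refine lintegral_mono_ae ?_
    filter_upwards [x.1.mem_unit, kl_density_nonneg x] with y hy hk
    rw [← ENNReal.ofReal_mul (by positivity), ← ENNReal.ofReal_mul (by positivity),
      ← ENNReal.ofReal_add (by positivity) (by positivity)]
    refine ENNReal.ofReal_le_ofReal ?_
    have h1 := sq_le_kl hy (Real.sigmoid_pos (x.2 y)) (Real.sigmoid_lt_one _)
    have h2 := h.sq_sigmoid_sub_le (x.2 y) (y - z)
    nlinarith [sq_nonneg ((x.1 y - Real.sigmoid (x.2 y)) -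
      (Real.sigmoid (x.2 y) - step um up (y - z)))]
  calc devU z x ^ 2 + devPhi z x
      ≤ ENNReal.ofReal 8 * F1 + ENNReal.ofReal 2 * devPhi z x + devPhi z x := by gcongr
    _ = ENNReal.ofReal 8 * F1 + ENNReal.ofReal 3 * devPhi z x := by
        have : ENNReal.ofReal 3 = ENNReal.ofReal 2 + 1 := by
          rw [← ENNReal.ofReal_one, ← ENNReal.ofReal_add] <;> norm_num
        rw [this]; ring
    _ ≤ ENNReal.ofReal 8 * F1 + ENNReal.ofReal 3 * (ENNReal.ofReal (2 * K) * F2 +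
        ENNReal.ofReal (2 * K) * ENNReal.ofReal (2 * chem up)) := by gcongr
    _ = ENNReal.ofReal 8 * F1 + ENNReal.ofReal (6 * K) * F2 +
        ENNReal.ofReal (12 * K * chem up) * 1 := by
        have e1 : 6 * K = 3 * (2 * K) := by ring
        have e2 : 12 * K * chem up = 3 * (2 * K * (2 * chem up)) := by ring
        rw [e1, e2, ENNReal.ofReal_mul (p := 3) (by norm_num),
          ENNReal.ofReal_mul (p := 3) (by norm_num),
          ENNReal.ofReal_mul (p := 2 * K) (by positivity)]
        ring
    _ ≤ ENNReal.ofReal (8 + 6 * K + 12 * K * chem up) * F1 +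
        ENNReal.ofReal (8 + 6 * K + 12 * K * chem up) * F2 +
        ENNReal.ofReal (8 + 6 * K + 12 * K * chem up) * 1 := by
        have : 0 < K * chem up := by positivity
        gcongr <;> nlinarith
    _ = ENNReal.ofReal (8 + 6 * K + 12 * K * chem up) * (excess x + 1) := by
        rw [excess, ← hF1, ← hF2]; ring

theorem mem_domainD_of_excess {x : State um up} (hx : excess x ≠ ⊤) : x ∈ domainD um up := by
  obtain ⟨C, _, hC⟩ := h.dev_le_excess
  obtain ⟨z, hz⟩ := h.exists_zero x
  have h1 : devU z x ^ 2 + devPhi z x < ⊤ := (hC x z hz).trans_lt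
    (ENNReal.mul_lt_top ENNReal.ofReal_lt_top (ENNReal.add_lt_top.2 ⟨hx.lt_top, by simp⟩))
  obtain ⟨h2, h3⟩ := ENNReal.add_lt_top.1 h1
  exact mem_domainD_of_translated (z := z) (by
    by_contra h4
    rw [not_lt, top_le_iff] at h4
    simp [h4] at h2) h3

theorem density_eq (x : State um up) (y : ℝ) : density x y =
    kl (x.1 y) (Real.sigmoid (x.2 y)) + kl (deriv x.2.val y) (slope (up * um) (x.2 y)) +
      deriv x.2.val y * chem (slope (up * um) (x.2 y)) := by
  rw [density, h.gFun_sub, entropy_add_log_mobility h.mul_pos]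
  ring

theorem density_le (x : State um up) : ∀ᵐ y, density x y ≤ (up * um)⁻¹ *
      (2 * (x.1 y - step um up y) ^ 2 + 3 * |x.2 y - step (chem um) (chem up) y|) := by
  filter_upwards [h.kl_density_le x 0] with y hy
  rw [sub_zero] at hy
  have h1 := entropy_nonpos (x.2.unitSlope.deriv_mem y)
  have h2 := h.log_mobility_le (h.mem_Icc x y) (step_eq_or (chem um) (chem up) y)
  rw [density, h.gFun_sub]
  linarith

theorem integrable_null_lagrangian (x : State um up) :
    Integrable fun y => deriv x.2.val y * chem (slope (up * um) (x.2 y)) := by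
  refine x.2.integrable_deriv_mul (w := fun t => chem (slope (up * um) t)) ?_
  rw [h.chem_um]
  exact h.integrableOn_chem_slope

theorem integrable_kl {x : State um up} (hx : x ∈ domainD um up) :
    Integrable (fun y => kl (x.1 y) (Real.sigmoid (x.2 y))) ∧
      Integrable (fun y => kl (deriv x.2.val y) (slope (up * um) (x.2 y))) := by
  obtain ⟨h1, h2⟩ := integrable_dev hx
  have hN := h.integrable_null_lagrangian x
  constructor
  · refine Integrable.mono' (((h1.const_mul 2).add (h2.const_mul 2)).const_mul (up * um)⁻¹)
      (aemeasurable_kl_density x).aestronglyMeasurable ?_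
    filter_upwards [kl_density_nonneg x, h.kl_density_le x 0] with y h3 h4
    rw [Real.norm_eq_abs, abs_of_nonneg h3]
    simpa using h4
  · refine Integrable.mono' ((h2.const_mul (up * um)⁻¹).sub hN)
      (measurable_kl_slope _ x).aestronglyMeasurable (Eventually.of_forall fun y => ?_)
    rw [Real.norm_eq_abs, abs_of_nonneg (h.kl_slope_nonneg x y)]
    have h3 := entropy_add_log_mobility h.mul_pos (deriv x.2.val y) (x.2 y)
    have h4 := entropy_nonpos (x.2.unitSlope.deriv_mem y)
    have h5 := h.log_mobility_le (h.mem_Icc x y) (step_eq_or (chem um) (chem up) y)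
    simp only [Pi.sub_apply]
    linarith

theorem integrable_density {x : State um up} (hx : x ∈ domainD um up) :
    Integrable (density x) := by
  obtain ⟨h1, h2⟩ := h.integrable_kl hx
  exact ((h1.add h2).add (h.integrable_null_lagrangian x)).congr
    (Eventually.of_forall fun y => (h.density_eq x y).symm)

/-- The energy is the excess plus the constant `minEnergy`, on the whole space. -/
theorem energy_eq (x : State um up) :
    energy um up x = (excess x : EReal) + (minEnergy um up : EReal) := by
  by_cases hx : x ∈ domainD um up
  · obtain ⟨h1, h2⟩ := h.integrable_kl hx
    have hN := h.integrable_null_lagrangian x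
    have h3 := kl_density_nonneg x
    have h4 := h.kl_slope_nonneg x
    have i1 := integral_nonneg_of_ae h3
    have i2 := integral_nonneg_of_ae (μ := volume) (Eventually.of_forall h4)
    have e : ∫ y, density x y = (∫ y, kl (x.1 y) (Real.sigmoid (x.2 y))) +
        (∫ y, kl (deriv x.2.val y) (slope (up * um) (x.2 y))) + minEnergy um up := by
      simp only [h.density_eq x]
      have h12 : Integrable fun y => kl (x.1 y) (Real.sigmoid (x.2 y)) +
          kl (deriv x.2.val y) (slope (up * um) (x.2 y)) := h1.add h2
      rw [integral_add h12 hN, integral_add h1 h2,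
        x.2.integral_deriv_mul fun t => chem (slope (up * um) t), minEnergy]
    rw [energy, if_pos hx, e, excess, ← ofReal_integral_eq_lintegral_ofReal h1 h3,
      ← ofReal_integral_eq_lintegral_ofReal h2 (Eventually.of_forall h4),
      ← ENNReal.ofReal_add i1 i2, EReal.coe_add, EReal.coe_ennreal_ofReal,
      max_eq_left (add_nonneg i1 i2)]
  · have : excess x = ⊤ := by
      by_contra hne
      exact hx (h.mem_domainD_of_excess hne)
    rw [energy, if_neg hx, this, EReal.coe_ennreal_top, EReal.top_add_coe]

theorem excess_ne_top {x : State um up} (hx : x ∈ domainD um up) : excess x ≠ ⊤ := by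
  intro hne
  have := h.energy_eq x
  rw [hne, energy, if_pos hx, EReal.coe_ennreal_top, EReal.top_add_coe] at this
  exact EReal.coe_ne_top _ this

theorem integral_density_le {x : State um up} (hx : x ∈ domainD um up) :
    ∫ y, density x y ≤ 3 * (up * um)⁻¹ * (devU 0 x ^ 2 + devPhi 0 x).toReal := by
  obtain ⟨h1, h2⟩ := integrable_dev hx
  have hA := h.mul_pos
  have n1 : 0 ≤ ∫ y, (x.1 y - step um up y) ^ 2 := integral_nonneg fun y => sq_nonneg _
  have n2 : 0 ≤ ∫ y, |x.2 y - step (chem um) (chem up) y| := integral_nonneg fun y => abs_nonneg _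
  have e : (devU 0 x ^ 2 + devPhi 0 x).toReal = (∫ y, (x.1 y - step um up y) ^ 2) +
      ∫ y, |x.2 y - step (chem um) (chem up) y| := by
    rw [devU_sq, devPhi_eq]
    simp only [sub_zero]
    rw [← ofReal_integral_eq_lintegral_ofReal h1 (Eventually.of_forall fun y => sq_nonneg _),
      ← ofReal_integral_eq_lintegral_ofReal h2 (Eventually.of_forall fun y => abs_nonneg _),
      ← ENNReal.ofReal_add n1 n2, ENNReal.toReal_ofReal (add_nonneg n1 n2)]
  have := integral_mono_ae (h.integrable_density hx)
    (((h1.const_mul 2).add (h2.const_mul 3)).const_mul (up * um)⁻¹) (h.density_le x)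
  simp only [Pi.add_apply] at this
  rw [integral_const_mul, integral_add (h1.const_mul 2) (h2.const_mul 3), integral_const_mul,
    integral_const_mul] at this
  rw [e]
  refine this.trans ?_
  rw [mul_comm (3 : ℝ) (up * um)⁻¹, mul_assoc (up * um)⁻¹]
  refine mul_le_mul_of_nonneg_left ?_ (by positivity)
  linarith

/-- The two-sided bound of the energy by the distance to a step. -/
theorem energy_bounds : ∃ C : ℝ, 1 < C ∧ ∀ x ∈ domainD um up,
      energy um up x ≤
        (C : EReal) * (((devU 0 x) ^ 2 + devPhi 0 x : ℝ≥0∞) : EReal) + (C : EReal) ∧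
      ∃ z : ℝ,
        ((1 / C : ℝ) : EReal) * (((devU z x) ^ 2 + devPhi z x : ℝ≥0∞) : EReal) - (C : EReal)
          ≤ energy um up x := by
  obtain ⟨K, hK, hdev⟩ := h.dev_le_excess
  have hA := h.mul_pos
  set m := minEnergy um up with hm
  set C := 2 + K + 3 * (up * um)⁻¹ + |m| with hC
  have hA' : 0 < (up * um)⁻¹ := by positivity
  have hCK : K ≤ C := by have := abs_nonneg m; linarith
  have hC0 : 0 < C := by linarith
  refine ⟨C, by have := abs_nonneg m; linarith, fun x hx => ⟨?_, ?_⟩⟩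
  · have hfin : devU 0 x ^ 2 + devPhi 0 x ≠ ⊤ := by
      obtain ⟨h1, h2⟩ := ENNReal.add_lt_top.1 hx
      exact (ENNReal.add_lt_top.2 ⟨ENNReal.pow_lt_top h1, h2⟩).ne
    have := h.integral_density_le hx
    rw [energy, if_pos hx, ← EReal.coe_ennreal_toReal hfin, ← EReal.coe_mul, ← EReal.coe_add,
      EReal.coe_le_coe_iff]
    have h0 : 0 ≤ (devU 0 x ^ 2 + devPhi 0 x).toReal := ENNReal.toReal_nonneg
    have : 3 * (up * um)⁻¹ * (devU 0 x ^ 2 + devPhi 0 x).toReal ≤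
        C * (devU 0 x ^ 2 + devPhi 0 x).toReal :=
      mul_le_mul_of_nonneg_right (by have := abs_nonneg m; linarith) h0
    linarith
  · obtain ⟨z, hz⟩ := h.exists_zero x
    have hF := h.excess_ne_top hx
    have h1 := hdev x z hz
    have hfin : ENNReal.ofReal K * (excess x + 1) ≠ ⊤ :=
      ENNReal.mul_ne_top ENNReal.ofReal_ne_top (ENNReal.add_ne_top.2 ⟨hF, by simp⟩)
    have h2 := ENNReal.toReal_mono hfin h1
    rw [ENNReal.toReal_mul, ENNReal.toReal_add hF (by simp), ENNReal.toReal_ofReal hK.le,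
      ENNReal.toReal_one] at h2
    have hF0 : 0 ≤ (excess x).toReal := ENNReal.toReal_nonneg
    refine ⟨z, ?_⟩
    rw [h.energy_eq x, ← EReal.coe_ennreal_toReal hF,
      ← EReal.coe_ennreal_toReal (ne_top_of_le_ne_top hfin h1), ← EReal.coe_mul, ← EReal.coe_sub,
      ← EReal.coe_add, EReal.coe_le_coe_iff]
    have h3 : 1 / C * (devU z x ^ 2 + devPhi z x).toReal ≤ (excess x).toReal + 1 := by
      rw [one_div, inv_mul_le_iff₀ hC0]
      refine h2.trans (mul_le_mul_of_nonneg_right hCK (by linarith))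
    have := neg_abs_le m
    linarith

end OppositePhases

/-! ### Lower semicontinuity -/

theorem exp_neg_le_affine_exp {q t M : ℝ} (hq : q ∈ Icc (0 : ℝ) 1) (ht : |t| ≤ M) :
    Real.exp (-M) ≤ 1 - q + q * Real.exp t := by
  have hM : 0 ≤ M := (abs_nonneg t).trans ht
  have h1 : Real.exp (-M) ≤ 1 := Real.exp_le_one_iff.2 (by linarith)
  have h2 : Real.exp (-M) ≤ Real.exp t := Real.exp_le_exp.2 (abs_le.1 ht).1
  nlinarith [hq.1, hq.2]

theorem affine_exp_le_exp {q t M : ℝ} (hq : q ∈ Icc (0 : ℝ) 1) (ht : |t| ≤ M) :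
    1 - q + q * Real.exp t ≤ Real.exp M := by
  have hM : 0 ≤ M := (abs_nonneg t).trans ht
  have h1 : 1 ≤ Real.exp M := Real.one_le_exp hM
  have h2 : Real.exp t ≤ Real.exp M := Real.exp_le_exp.2 (abs_le.1 ht).2
  nlinarith [hq.1, hq.2]

theorem abs_log_affine_exp_le {q t M : ℝ} (hq : q ∈ Icc (0 : ℝ) 1) (ht : |t| ≤ M) :
    |Real.log (1 - q + q * Real.exp t)| ≤ M := by
  have h1 := exp_neg_le_affine_exp hq ht
  have h0 := (Real.exp_pos (-M)).trans_le h1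
  rw [abs_le, Real.le_log_iff_exp_le h0, Real.log_le_iff_le_exp h0]
  exact ⟨h1, affine_exp_le_exp hq ht⟩

theorem log_affine_exp_sub_le {q q' t M : ℝ} (hq : q ∈ Icc (0 : ℝ) 1) (hq' : q' ∈ Icc (0 : ℝ) 1)
    (ht : |t| ≤ M) : Real.log (1 - q' + q' * Real.exp t) - Real.log (1 - q + q * Real.exp t) ≤
      Real.exp (2 * M) * |q' - q| := by
  have hM : 0 ≤ M := (abs_nonneg t).trans ht
  have h1 := exp_neg_le_affine_exp hq ht
  have h0 := (Real.exp_pos (-M)).trans_le h1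
  have h0' := (Real.exp_pos (-M)).trans_le (exp_neg_le_affine_exp hq' ht)
  have h3 : |Real.exp t - 1| ≤ Real.exp M := by
    have := Real.exp_pos t
    have := Real.one_le_exp hM
    have : Real.exp t ≤ Real.exp M := Real.exp_le_exp.2 (abs_le.1 ht).2
    rw [abs_le]; constructor <;> linarith
  rw [← Real.log_div h0'.ne' h0.ne']
  calc _ ≤ (1 - q' + q' * Real.exp t) / (1 - q + q * Real.exp t) - 1 :=
        Real.log_le_sub_one_of_pos (div_pos h0' h0)
    _ = (q' - q) * (Real.exp t - 1) / (1 - q + q * Real.exp t) := by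
        rw [div_sub_one h0.ne']; congr 1; ring
    _ ≤ |q' - q| * Real.exp M / Real.exp (-M) := by
        refine div_le_div₀ (by positivity) ?_ (Real.exp_pos _) h1
        exact (le_abs_self _).trans (by rw [abs_mul]; gcongr)
    _ = Real.exp (2 * M) * |q' - q| := by
        rw [Real.exp_neg, div_inv_eq_mul, mul_assoc, ← Real.exp_add, ← two_mul, mul_comm]

theorem abs_log_affine_exp_sub_le {q q' t M : ℝ} (hq : q ∈ Icc (0 : ℝ) 1)
    (hq' : q' ∈ Icc (0 : ℝ) 1) (ht : |t| ≤ M) :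
    |Real.log (1 - q' + q' * Real.exp t) - Real.log (1 - q + q * Real.exp t)| ≤
      Real.exp (2 * M) * |q' - q| := by
  have h1 := log_affine_exp_sub_le hq hq' ht
  have h2 := log_affine_exp_sub_le hq' hq ht
  rw [abs_sub_comm] at h2
  rw [abs_le]; constructor <;> linarith

theorem abs_chem_le {v η : ℝ} (h0 : 0 < η) (h1 : η ≤ v) (h2 : v ≤ 1 - η) :
    |chem v| ≤ -Real.log η := by
  rw [chem_eq (by linarith) (by linarith), abs_le]
  have a := Real.log_le_log h0 h1
  have b := Real.log_le_log (x := η) (y := 1 - v) h0 (by linarith)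
  have c := Real.log_nonpos (x := v) (by linarith) (by linarith)
  have d := Real.log_nonpos (x := 1 - v) (by linarith) (by linarith)
  constructor <;> linarith

theorem ofReal_integral_le_lintegral {α : Type*} [MeasurableSpace α] {μ : Measure α} {f : α → ℝ}
    (hf : Integrable f μ) : ENNReal.ofReal (∫ a, f a ∂μ) ≤ ∫⁻ a, ENNReal.ofReal (f a) ∂μ := by
  rw [integral_eq_lintegral_pos_part_sub_lintegral_neg_part hf]
  exact (ENNReal.ofReal_le_ofReal (sub_le_self _ ENNReal.toReal_nonneg)).trans
    ENNReal.ofReal_toReal_le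

/-- A bounded test function supported in a set `E` of finite measure gives, by the variational
bound for the relative entropy, a functional of `(u,q)` that is continuous for weak* convergence of
`u` and uniform convergence of `q`, and that minorizes the relative entropy. -/
theorem eventually_lt_lintegral_kl {X : Type*} [TopologicalSpace X] {u : X → LinfUnit}
    (hu : Continuous u) {q : X → ℝ → ℝ} (hqm : ∀ x, Measurable (q x))
    (hqc : ∀ x, TendstoUniformly q (q x) (𝓝 x))
    (hq : ∀ x, ∀ᵐ y, (0 < q x y ∧ q x y < 1) ∨ (q x y = 0 ∧ u x y = 0)) (x : X)
    {E : Set ℝ} (hE : MeasurableSet E) (hEv : volume E ≠ ∞) {t : ℝ → ℝ} (htm : AEMeasurable t)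
    {M : ℝ} (htM : ∀ᵐ y, y ∈ E → |t y| ≤ M) {c : ℝ≥0∞}
    (hc : c < ENNReal.ofReal (∫ y in E,
      (t y * u x y - Real.log (1 - q x y + q x y * Real.exp (t y))))) :
    ∀ᶠ x' in 𝓝 x, c < ∫⁻ y, ENNReal.ofReal (kl (u x' y) (q x' y)) := by
  have hq01 : ∀ x, ∀ᵐ y, q x y ∈ Icc (0 : ℝ) 1 := fun x => (hq x).mono fun y hy => by
    rcases hy with hy | hy
    · exact ⟨hy.1.le, hy.2.le⟩
    · rw [hy.1]; simp
  have htM' : ∀ᵐ y ∂(volume.restrict E), |t y| ≤ M := (ae_restrict_iff' hE).2 htM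
  have itE : IntegrableOn t E :=
    Measure.integrableOn_of_bounded hEv htm.aestronglyMeasurable htM'
  have itI : Integrable (E.indicator t) := (integrable_indicator_iff hE).2 itE
  have eqI : ∀ x', (fun y => u x' y * E.indicator t y) = E.indicator fun y => t y * u x' y := by
    intro x'; ext y
    by_cases hy : y ∈ E <;> simp [hy, mul_comm]
  have i1 : ∀ x', IntegrableOn (fun y => t y * u x' y) E := fun x' => by
    rw [← integrable_indicator_iff hE, ← eqI]
    exact (u x').integrable_mul itI
  have i2 : ∀ x', IntegrableOn (fun y => Real.log (1 - q x' y + q x' y * Real.exp (t y))) E := by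
    intro x'
    refine Measure.integrableOn_of_bounded (M := M) hEv ?_ ?_
    · have := hqm x'
      exact AEMeasurable.aestronglyMeasurable (by fun_prop)
    · filter_upwards [htM', ae_restrict_of_ae (hq01 x')] with y h1 h2
      exact abs_log_affine_exp_le h2 h1
  have lim : Tendsto (fun x' => ∫ y in E,
      (t y * u x' y - Real.log (1 - q x' y + q x' y * Real.exp (t y)))) (𝓝 x)
      (𝓝 (∫ y in E, (t y * u x y - Real.log (1 - q x y + q x y * Real.exp (t y))))) := by
    simp only [fun x' => integral_sub (i1 x') (i2 x')]
    refine Tendsto.sub ?_ ?_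
    · have := LinfUnit.tendsto_iff.1 (hu.tendsto x) _ itI
      simpa only [eqI, integral_indicator hE] using this
    · rw [Metric.tendsto_nhds]
      intro ε hε
      set K := Real.exp (2 * M) * (volume.real E + 1) with hK
      have hK0 : 0 < K := by positivity
      filter_upwards [Metric.tendstoUniformly_iff.1 (hqc x) (ε / K) (by positivity)] with x' hx'
      rw [Real.dist_eq, ← integral_sub (i2 x') (i2 x), ← Real.norm_eq_abs]
      have : ‖∫ y in E, (Real.log (1 - q x' y + q x' y * Real.exp (t y)) -
          Real.log (1 - q x y + q x y * Real.exp (t y)))‖ ≤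
          (Real.exp (2 * M) * (ε / K)) * volume.real E := by
        refine norm_setIntegral_le_of_norm_le_const_ae hEv.lt_top ?_
        filter_upwards [htM', ae_restrict_of_ae (hq01 x'), ae_restrict_of_ae (hq01 x)]
          with y h1 h2 h3
        refine (abs_log_affine_exp_sub_le h3 h2 h1).trans ?_
        have := hx' y
        rw [dist_comm, Real.dist_eq] at this
        gcongr
      refine this.trans_lt ?_
      have e : Real.exp (2 * M) * (ε / K) * volume.real E =
          ε * (volume.real E / (volume.real E + 1)) := by
        rw [hK]; field_simp
      rw [e]
      refine mul_lt_of_lt_one_right hε ?_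
      rw [div_lt_one (by positivity)]
      linarith
  filter_upwards [((ENNReal.continuous_ofReal.tendsto _).comp lim).eventually_const_lt hc]
    with x' hx'
  refine hx'.trans_le ((ofReal_integral_le_lintegral ((i1 x').sub (i2 x'))).trans ?_)
  refine (lintegral_mono_ae ?_).trans (setLIntegral_le_lintegral E _)
  filter_upwards [ae_restrict_of_ae (hq x'), ae_restrict_of_ae (u x').mem_unit] with y h1 h2
  refine ENNReal.ofReal_le_ofReal ?_
  rcases h1 with h1 | h1
  · exact kl_ge_affine h2 h1.1 h1.2 _
  · simp [h1.1, h1.2, kl_zero_zero]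

/-- The relative entropy is jointly lower semicontinuous. The near-optimal affine minorants
`kl_sub_kl_interp`, cut off where they could be unbounded, serve as test functions. -/
theorem lowerSemicontinuous_lintegral_kl {X : Type*} [TopologicalSpace X] {u : X → LinfUnit}
    (hu : Continuous u) {q : X → ℝ → ℝ} (hqm : ∀ x, Measurable (q x))
    (hqc : ∀ x, TendstoUniformly q (q x) (𝓝 x))
    (hq : ∀ x, ∀ᵐ y, (0 < q x y ∧ q x y < 1) ∨ (q x y = 0 ∧ u x y = 0)) :
    LowerSemicontinuous fun x => ∫⁻ y, ENNReal.ofReal (kl (u x y) (q x y)) := by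
  intro x c hc
  set η : ℕ → ℝ := fun n => 1 / ((n : ℝ) + 2) with hη
  have hη0 : ∀ n, 0 < η n := fun n => by simp only [hη]; positivity
  have hη1 : ∀ n, η n < 1 := fun n => by
    simp only [hη]; rw [div_lt_one (by positivity)]; linarith [n.cast_nonneg (α := ℝ)]
  have hηlim : Tendsto η atTop (𝓝 0) :=
    tendsto_const_nhds.div_atTop (tendsto_atTop_add_const_right _ _ tendsto_natCast_atTop_atTop)
  set E : ℕ → Set ℝ := fun n => Icc (-(n : ℝ)) n ∩ q x ⁻¹' Icc (η n) (1 - η n) with hE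
  have hEm : ∀ n, MeasurableSet (E n) := fun n => measurableSet_Icc.inter (hqm x measurableSet_Icc)
  have hEv : ∀ n, volume (E n) ≠ ∞ := fun n =>
    ne_top_of_le_ne_top (by simp) (measure_mono (inter_subset_left : E n ⊆ Icc (-(n : ℝ)) n))
  set f : ℕ → ℝ → ℝ≥0∞ := fun n => (E n).indicator fun y =>
    ENNReal.ofReal ((1 - η n) * kl (u x y) (q x y)) with hf
  have hkm : AEMeasurable fun y => kl (u x y) (q x y) :=
    measurable_kl.comp_aemeasurable ((u x).aemeasurable.prodMk (hqm x).aemeasurable)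
  have hfm : ∀ n, AEMeasurable (f n) := fun n =>
    (hkm.const_mul _).ennreal_ofReal.indicator (hEm n)
  have hlim : ∀ᵐ y, Tendsto (fun n => f n y) atTop
      (𝓝 (ENNReal.ofReal (kl (u x y) (q x y)))) := by
    filter_upwards [hq x] with y hy
    rcases hy with ⟨h0, h1⟩ | ⟨h0, h1⟩
    · have ev : ∀ᶠ n in atTop, y ∈ E n := by
        filter_upwards [hηlim.eventually_le_const h0,
          hηlim.eventually_le_const (sub_pos.2 h1),
          tendsto_natCast_atTop_atTop.eventually_ge_atTop |y|] with n h2 h3 h4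
        exact ⟨abs_le.1 h4, h2, by linarith⟩
      have : Tendsto (fun n => ENNReal.ofReal ((1 - η n) * kl (u x y) (q x y))) atTop
          (𝓝 (ENNReal.ofReal ((1 - 0) * kl (u x y) (q x y)))) :=
        (ENNReal.continuous_ofReal.tendsto _).comp ((hηlim.const_sub 1).mul_const _)
      rw [sub_zero, one_mul] at this
      refine this.congr' ?_
      filter_upwards [ev] with n hn
      exact (indicator_of_mem hn fun y => ENNReal.ofReal ((1 - η n) * kl (u x y) (q x y))).symm
    · simp only [h0, h1, kl_zero_zero, ENNReal.ofReal_zero]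
      refine tendsto_const_nhds.congr fun n => ?_
      have : y ∉ E n := fun hy => by
        have := hy.2.1
        rw [h0] at this
        linarith [hη0 n]
      exact (indicator_of_notMem this _).symm
  have hfatou : ∫⁻ y, ENNReal.ofReal (kl (u x y) (q x y)) ≤
      liminf (fun n => ∫⁻ y, f n y) atTop := by
    refine le_trans (le_of_eq ?_) (lintegral_liminf_le' hfm)
    exact lintegral_congr_ae (hlim.mono fun y hy => hy.liminf_eq.symm)
  obtain ⟨n, hn⟩ := (eventually_lt_of_lt_liminf (hc.trans_le hfatou)).exists
  set t : ℝ → ℝ := fun y => chem ((1 - η n) * u x y + η n * q x y) - chem (q x y) with ht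
  have htm : AEMeasurable t :=
    (measurable_chem.comp_aemeasurable (((u x).aemeasurable.const_mul _).add
      ((hqm x).aemeasurable.const_mul _))).sub (measurable_chem.comp (hqm x)).aemeasurable
  have htM : ∀ᵐ y, y ∈ E n → |t y| ≤ -Real.log (η n * η n) + -Real.log (η n) := by
    filter_upwards [(u x).mem_unit] with y hy hyE
    have a := hη0 n
    have b := hη1 n
    have h1 := hyE.2.1
    have h2 := hyE.2.2
    have hq0 := abs_chem_le a h1 h2
    have hw := abs_chem_le (v := (1 - η n) * u x y + η n * q x y) (mul_pos a a)
      (by nlinarith [hy.1]) (by nlinarith [hy.2])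
    exact (abs_sub _ _).trans (add_le_add hw hq0)
  refine eventually_lt_lintegral_kl hu hqm hqc hq x (hEm n) (hEv n) htm htM (hn.trans_le ?_)
  have hle : ∀ᵐ y ∂(volume.restrict (E n)), (1 - η n) * kl (u x y) (q x y) ≤
      t y * u x y - Real.log (1 - q x y + q x y * Real.exp (t y)) ∧
      0 ≤ (1 - η n) * kl (u x y) (q x y) := by
    filter_upwards [ae_restrict_of_ae (u x).mem_unit, ae_restrict_mem (hEm n)] with y hy hyE
    have a := hη0 n
    have b := hη1 n
    have h1 : 0 < q x y := a.trans_le hyE.2.1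
    have h2 : q x y < 1 := by linarith [hyE.2.2]
    exact ⟨kl_sub_kl_interp hy h1 h2 a b, mul_nonneg (by linarith) (kl_nonneg hy h1 h2)⟩
  have hint : IntegrableOn
      (fun y => t y * u x y - Real.log (1 - q x y + q x y * Real.exp (t y))) (E n) := by
    refine Measure.integrableOn_of_bounded
      (M := 2 * (-Real.log (η n * η n) + -Real.log (η n))) (hEv n) ?_ ?_
    · have := (u x).aemeasurable
      have := hqm x
      exact AEMeasurable.aestronglyMeasurable (by fun_prop)
    · filter_upwards [ae_restrict_of_ae (u x).mem_unit, ae_restrict_mem (hEm n),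
        ae_restrict_of_ae htM] with y hy hyE hM
      have a := hη0 n
      have hM' := hM hyE
      have h3 := abs_log_affine_exp_le (q := q x y)
        ⟨a.le.trans hyE.2.1, by linarith [hyE.2.2]⟩ hM'
      have h4 : |t y * u x y| ≤ |t y| := by
        rw [abs_mul, abs_of_nonneg hy.1]
        exact mul_le_of_le_one_right (abs_nonneg _) hy.2
      rw [Real.norm_eq_abs]
      exact (abs_sub _ _).trans (by linarith)
  rw [ofReal_integral_eq_lintegral_ofReal hint (hle.mono fun y hy => hy.2.trans hy.1),
    hf, lintegral_indicator (hEm n)]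
  exact lintegral_mono_ae (hle.mono fun y hy => ENNReal.ofReal_le_ofReal hy.1)

/-- Composition with a function that is continuous on the compact range of the phases preserves
uniform convergence. -/
theorem tendstoUniformly_comp_phase {f : ℝ → ℝ} (hf : Continuous f) (x : State um up) :
    TendstoUniformly (fun (x' : State um up) y => f (x'.2 y)) (fun y => f (x.2 y)) (𝓝 x) := by
  have h1 := PhaseSpace.tendsto_iff_uniform.1 (continuous_snd.tendsto x)
  have h2 : UniformContinuousOn f (Icc (chem um) (chem up)) :=
    isCompact_Icc.uniformContinuousOn_of_continuous hf.continuousOn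
  rw [Metric.tendstoUniformly_iff] at h1 ⊢
  rw [Metric.uniformContinuousOn_iff] at h2
  intro ε hε
  obtain ⟨δ, hδ, H⟩ := h2 ε hε
  filter_upwards [h1 δ hδ] with x' hx' y
  exact H _ (x.2.mem_Icc y) _ (x'.2.mem_Icc y) (hx' y)

namespace OppositePhases

variable (h : OppositePhases um up)
include h

theorem lowerSemicontinuous_excess :
    LowerSemicontinuous (excess : State um up → ℝ≥0∞) := by
  refine LowerSemicontinuous.add ?_ ?_
  · refine lowerSemicontinuous_lintegral_kl (u := fun x : State um up => x.1)
      (q := fun x y => Real.sigmoid (x.2 y)) continuous_fst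
      (fun x => (differentiable_sigmoid.continuous.comp x.2.continuous).measurable)
      (tendstoUniformly_comp_phase differentiable_sigmoid.continuous)
      (fun x => Eventually.of_forall fun y =>
        Or.inl ⟨Real.sigmoid_pos _, Real.sigmoid_lt_one _⟩)
  · have key := lowerSemicontinuous_lintegral_kl (u := fun x : State um up => x.2.derivClass)
      (q := fun x y => slope (up * um) (x.2 y))
      (PhaseSpace.continuous_derivClass.comp continuous_snd)
      (fun x => ((continuous_slope _).comp x.2.continuous).measurable)
      (tendstoUniformly_comp_phase (continuous_slope _))
      (fun x => (LinfUnit.coeFn_ofDeriv x.2.unitSlope).mono fun y hy => by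
        have := h.slope_cases x y
        rwa [← hy] at this)
    refine fun x c hc => ?_
    have e : ∀ x : State um up,
        ∫⁻ y, ENNReal.ofReal (kl (deriv x.2.val y) (slope (up * um) (x.2 y))) =
        ∫⁻ y, ENNReal.ofReal (kl (x.2.derivClass y) (slope (up * um) (x.2 y))) := fun x =>
      lintegral_congr_ae ((LinfUnit.coeFn_ofDeriv x.2.unitSlope).mono fun y hy => by
        simp only [PhaseSpace.derivClass, hy])
    simp only [e] at hc ⊢
    exact key x c hc

theorem lowerSemicontinuous_energy : LowerSemicontinuous (energy um up) := by
  have : energy um up = (fun r : ℝ≥0∞ => (r : EReal) + (minEnergy um up : EReal)) ∘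
      (excess : State um up → ℝ≥0∞) := funext h.energy_eq
  rw [this]
  refine Continuous.comp_lowerSemicontinuous ?_ h.lowerSemicontinuous_excess ?_
  · rw [continuous_iff_continuousAt]
    intro r
    exact (EReal.continuousAt_add (Or.inr (EReal.coe_ne_bot _)) (Or.inr (EReal.coe_ne_top _))).comp
      (f := fun r : ℝ≥0∞ => ((r : EReal), (minEnergy um up : EReal)))
      ((continuous_coe_ennreal_ereal.prodMk continuous_const).continuousAt)
  · intro a b hab
    exact add_le_add_left (EReal.coe_ennreal_le_coe_ennreal_iff.2 hab) _

end OppositePhases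

/-! ### The stationary equation -/

/-- A solution of the first-order equation `v' = v (1 - v) - B` is a classical solution of the
second-order equation. -/
theorem contDiffOn_of_hasDerivAt {I : Set ℝ} (hI : IsOpen I) {v : ℝ → ℝ} {B : ℝ}
    (hv : ∀ y ∈ I, HasDerivAt v (v y * (1 - v y) - B) y) :
    ContDiffOn ℝ 2 v I ∧
      ∀ y ∈ I, deriv (deriv v) y - deriv (fun t => v t * (1 - v t)) y = 0 := by
  have hd : DifferentiableOn ℝ v I := fun y hy => (hv y hy).differentiableAt.differentiableWithinAt
  have hderiv : EqOn (deriv v) (fun y => v y * (1 - v y) - B) I := fun y hy => (hv y hy).deriv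
  have h1 : ContDiffOn ℝ 1 v I := by
    rw [show (1 : WithTop ℕ∞) = 0 + 1 by norm_num, contDiffOn_succ_iff_deriv_of_isOpen hI]
    refine ⟨hd, by simp, contDiffOn_zero.2 ?_⟩
    have hc := hd.continuousOn
    exact ((hc.mul (continuousOn_const.sub hc)).sub continuousOn_const).congr hderiv
  constructor
  · rw [show (2 : WithTop ℕ∞) = 1 + 1 by norm_num, contDiffOn_succ_iff_deriv_of_isOpen hI]
    refine ⟨hd, by simp, ?_⟩
    exact ((h1.mul (contDiffOn_const.sub h1)).sub contDiffOn_const).congr hderiv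
  · intro y hy
    have e : deriv v =ᶠ[𝓝 y] fun y => v y * (1 - v y) - B :=
      Filter.eventuallyEq_of_mem (hI.mem_nhds hy) hderiv
    rw [e.deriv_eq, deriv_sub_const, sub_self]

theorem isStandingWave_of_hasDerivAt {um up B : ℝ} {v : ℝ → ℝ}
    (hv : ∀ y, HasDerivAt v (v y * (1 - v y) - B) y) (h1 : Tendsto v atBot (𝓝 um))
    (h2 : Tendsto v atTop (𝓝 up)) : IsStandingWave um up v := by
  have := contDiffOn_of_hasDerivAt isOpen_univ (B := B) fun y _ => hv y
  exact ⟨contDiffOn_univ.1 this.1, fun y => this.2 y (mem_univ y), h1, h2⟩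

theorem isBoxSolution_of_hasDerivAt {um up ℓ B : ℝ} {v : ℝ → ℝ}
    (hc : ContinuousOn v (Icc (-ℓ) ℓ))
    (hv : ∀ y ∈ Ioo (-ℓ) ℓ, HasDerivAt v (v y * (1 - v y) - B) y)
    (h1 : v (-ℓ) = um) (h2 : v ℓ = up) : IsBoxSolution um up ℓ v := by
  have := contDiffOn_of_hasDerivAt isOpen_Ioo hv
  exact ⟨hc, this.1, this.2, h1, h2⟩

/-- The first integral of the stationary equation. -/
theorem exists_first_integral {I : Set ℝ} (hI : IsOpen I) (hI' : IsPreconnected I) {v : ℝ → ℝ}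
    (hv : ContDiffOn ℝ 2 v I)
    (he : ∀ y ∈ I, deriv (deriv v) y - deriv (fun t => v t * (1 - v t)) y = 0) :
    ∃ B, ∀ y ∈ I, HasDerivAt v (v y * (1 - v y) - B) y := by
  rw [show (2 : WithTop ℕ∞) = 1 + 1 by norm_num, contDiffOn_succ_iff_deriv_of_isOpen hI] at hv
  obtain ⟨hd, -, hv1⟩ := hv
  have hd1 := hv1.differentiableOn one_ne_zero
  have hdd : ∀ y ∈ I, DifferentiableAt ℝ v y := fun y hy => hd.differentiableAt (hI.mem_nhds hy)
  have hdd1 : ∀ y ∈ I, DifferentiableAt ℝ (deriv v) y := fun y hy =>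
    hd1.differentiableAt (hI.mem_nhds hy)
  have hw : ∀ y ∈ I, DifferentiableAt ℝ (fun t => v t * (1 - v t)) y := fun y hy =>
    (hdd y hy).mul ((hdd y hy).const_sub 1)
  obtain ⟨c, hc⟩ := hI.exists_is_const_of_deriv_eq_zero hI'
    (f := fun y => v y * (1 - v y) - deriv v y)
    (fun y hy => ((hw y hy).sub (hdd1 y hy)).differentiableWithinAt)
    (fun y hy => by
      have := he y hy
      simp only [Pi.zero_apply]
      rw [deriv_fun_sub (hw y hy) (hdd1 y hy)]
      linarith)
  refine ⟨c, fun y hy => ?_⟩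
  rw [← hc y hy, sub_sub_cancel]
  exact (hdd y hy).hasDerivAt

/-- The difference of two solutions, divided by the integrating factor of the linear equation that
it satisfies. -/
theorem hasDerivAt_sub_mul_exp {v w H : ℝ → ℝ} {B B' y : ℝ}
    (hv : HasDerivAt v (v y * (1 - v y) - B) y) (hw : HasDerivAt w (w y * (1 - w y) - B') y)
    (hH : HasDerivAt H (1 - v y - w y) y) :
    HasDerivAt (fun y => (v y - w y) * Real.exp (-H y)) ((B' - B) * Real.exp (-H y)) y := by
  refine ((hv.sub hw).mul hH.neg.exp).congr_deriv ?_
  simp only [Pi.sub_apply, Pi.neg_apply]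
  ring

theorem eq_of_hasDerivAt {v w : ℝ → ℝ} {B : ℝ}
    (hv : ∀ y, HasDerivAt v (v y * (1 - v y) - B) y)
    (hw : ∀ y, HasDerivAt w (w y * (1 - w y) - B) y) {y₀ : ℝ} (h0 : v y₀ = w y₀) : v = w := by
  have hvc : Continuous v := continuous_iff_continuousAt.2 fun y => (hv y).continuousAt
  have hwc : Continuous w := continuous_iff_continuousAt.2 fun y => (hw y).continuousAt
  have hc : Continuous fun y => 1 - v y - w y := (continuous_const.sub hvc).sub hwc
  set H : ℝ → ℝ := fun y => ∫ t in (0 : ℝ)..y, (1 - v t - w t) with hH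
  have hHd : ∀ y, HasDerivAt H (1 - v y - w y) y := fun y =>
    hc.integral_hasStrictDerivAt 0 y |>.hasDerivAt
  have hK := fun y => hasDerivAt_sub_mul_exp (hv y) (hw y) (hHd y)
  ext y
  have := is_const_of_deriv_eq_zero (fun y => (hK y).differentiableAt)
    (fun y => by rw [(hK y).deriv, sub_self, zero_mul]) y y₀
  simp only [h0, sub_self, zero_mul, mul_eq_zero, Real.exp_ne_zero, or_false] at this
  linarith

/-- Uniqueness for the boundary value problem; the two solutions are not assumed to have the same
first integral. -/
theorem eqOn_of_hasDerivAt {v w : ℝ → ℝ} {B B' a b : ℝ} (hab : a < b)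
    (hvc : ContinuousOn v (Icc a b)) (hwc : ContinuousOn w (Icc a b))
    (hv : ∀ y ∈ Ioo a b, HasDerivAt v (v y * (1 - v y) - B) y)
    (hw : ∀ y ∈ Ioo a b, HasDerivAt w (w y * (1 - w y) - B') y)
    (ha : v a = w a) (hb : v b = w b) : EqOn v w (Icc a b) := by
  have hc : Continuous (IccExtend hab.le (domRestrict (Icc a b) fun y => 1 - v y - w y)) :=
    ((continuousOn_const.sub hvc).sub hwc).domRestrict.Icc_extend'
  set q := IccExtend hab.le (domRestrict (Icc a b) fun y => 1 - v y - w y) with hq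
  set H : ℝ → ℝ := fun y => ∫ t in (0 : ℝ)..y, q t with hH
  have hHd : ∀ y, HasDerivAt H (q y) y := fun y => (hc.integral_hasStrictDerivAt 0 y).hasDerivAt
  have hqe : ∀ y ∈ Ioo a b, q y = 1 - v y - w y := fun y hy =>
    IccExtend_of_mem hab.le _ (Ioo_subset_Icc_self hy)
  have hK : ∀ y ∈ Ioo a b, HasDerivAt (fun y => (v y - w y) * Real.exp (-H y))
      ((B' - B) * Real.exp (-H y)) y := fun y hy =>
    hasDerivAt_sub_mul_exp (hv y hy) (hw y hy) (hqe y hy ▸ hHd y)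
  have hHc : Continuous H := continuous_iff_continuousAt.2 fun y => (hHd y).continuousAt
  have hKc : ContinuousOn (fun y => (v y - w y) * Real.exp (-H y)) (Icc a b) :=
    (hvc.sub hwc).mul hHc.neg.rexp.continuousOn
  have hBB : B' - B = 0 := by
    obtain ⟨ξ, _, hξ⟩ := exists_hasDerivAt_eq_slope _ _ hab hKc hK
    simpa [ha, hb, Real.exp_ne_zero] using hξ
  intro y hy
  rcases hy.1.eq_or_lt with rfl | hay
  · exact ha
  obtain ⟨ξ, _, hξ⟩ := exists_hasDerivAt_eq_slope _ _ hay
    (hKc.mono (Icc_subset_Icc_right hy.2)) fun t ht => hK t ⟨ht.1, ht.2.trans_le hy.2⟩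
  rw [hBB, zero_mul, eq_comm, div_eq_zero_iff, or_iff_left (sub_pos.2 hay).ne'] at hξ
  simp only [ha, sub_self, zero_mul, sub_zero, mul_eq_zero, Real.exp_ne_zero, or_false] at hξ
  linarith

/-- If a function and its derivative converge at `+∞`, the derivative tends to zero. -/
theorem eq_zero_of_tendsto_deriv {f f' : ℝ → ℝ} {L d : ℝ} (hf : ∀ y, HasDerivAt f (f' y) y)
    (h1 : Tendsto f atTop (𝓝 L)) (h2 : Tendsto f' atTop (𝓝 d)) : d = 0 := by
  have hc : Continuous f := continuous_iff_continuousAt.2 fun y => (hf y).continuousAt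
  choose ξ hξ hs using fun y : ℝ => exists_hasDerivAt_eq_slope f f' (lt_add_one y)
    hc.continuousOn fun t _ => hf t
  have hξ' : Tendsto ξ atTop atTop := tendsto_atTop_mono (fun y => (hξ y).1.le) tendsto_id
  have h3 : Tendsto (fun y => f (y + 1) - f y) atTop (𝓝 d) := by
    refine (h2.comp hξ').congr fun y => ?_
    simp [hs y]
  have h4 := (h1.comp (tendsto_atTop_add_const_right _ 1 tendsto_id)).sub h1
  rw [sub_self] at h4
  exact tendsto_nhds_unique h3 h4

theorem tanh_eq_sigmoid (x : ℝ) : Real.tanh x = 2 * Real.sigmoid (2 * x) - 1 := by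
  rw [Real.tanh_eq, Real.sigmoid_def]
  have e : Real.exp (-(2 * x)) = Real.exp (-x) * Real.exp (-x) := by
    rw [← Real.exp_add]; ring_nf
  have e1 : Real.exp x * Real.exp (-x) = 1 := by rw [← Real.exp_add]; simp
  have h1 := Real.exp_pos x
  have h2 := Real.exp_pos (-x)
  rw [e, div_eq_iff (by positivity)]
  have : 0 < 1 + Real.exp (-x) * Real.exp (-x) := by positivity
  field_simp
  linear_combination (2 * Real.exp (-x)) * e1

/-- The odd (about `1/2`) increasing profiles of the stationary equation; `b` is both the
amplitude and the rate. -/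
noncomputable def profile (b y : ℝ) : ℝ := 1 / 2 + b * Real.tanh (b * y)

theorem profile_eq (b y : ℝ) : profile b y = 1 / 2 + b * (2 * Real.sigmoid (2 * (b * y)) - 1) := by
  rw [profile, tanh_eq_sigmoid]

theorem ubar_eq (up : ℝ) : ubar up = profile (up - 1 / 2) := rfl

theorem profile_neg (b y : ℝ) : profile b (-y) = 1 - profile b y := by
  rw [profile, profile, mul_neg, Real.tanh_neg]; ring

theorem hasDerivAt_profile (b y : ℝ) :
    HasDerivAt (profile b) (profile b y * (1 - profile b y) - (1 / 4 - b ^ 2)) y := by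
  have h0 : HasDerivAt (fun y => 2 * (b * y)) (2 * b) y := by
    simpa using ((hasDerivAt_id y).const_mul b).const_mul 2
  have h1 := ((((Real.hasDerivAt_sigmoid (2 * (b * y))).comp y h0).const_mul 2).sub_const
    1).const_mul b |>.const_add (1 / 2)
  have e : profile b = fun y => 1 / 2 + b * (2 * Real.sigmoid (2 * (b * y)) - 1) :=
    funext (profile_eq b)
  rw [e]
  refine h1.congr_deriv ?_
  ring

theorem continuous_profile (b : ℝ) : Continuous (profile b) :=
  continuous_iff_continuousAt.2 fun y => (hasDerivAt_profile b y).continuousAt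

theorem continuous_profile_left (y : ℝ) : Continuous fun b => profile b y := by
  have e : (fun b => profile b y) = fun b => 1 / 2 + b * (2 * Real.sigmoid (2 * (b * y)) - 1) :=
    funext fun b => profile_eq b y
  rw [e]
  have := differentiable_sigmoid.continuous
  fun_prop

theorem profile_mem {b : ℝ} (hb : 0 < b) (hb' : b ≤ 1 / 2) (y : ℝ) : profile b y ∈ Ioo 0 1 := by
  have h0 := Real.sigmoid_pos (2 * (b * y))
  have h1 := Real.sigmoid_lt_one (2 * (b * y))
  rw [profile_eq]
  constructor <;> nlinarith

theorem tendsto_profile_atTop {b : ℝ} (hb : 0 < b) :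
    Tendsto (profile b) atTop (𝓝 (1 / 2 + b)) := by
  have h1 : Tendsto (fun y => 2 * (b * y)) atTop atTop :=
    (tendsto_id.const_mul_atTop hb).const_mul_atTop two_pos
  have := ((((Real.tendsto_sigmoid_atTop.comp h1).const_mul 2).sub_const 1).const_mul b).const_add
    (1 / 2)
  have e : profile b = fun y => 1 / 2 + b * (2 * Real.sigmoid (2 * (b * y)) - 1) :=
    funext (profile_eq b)
  rw [show 1 / 2 + b * (2 * 1 - 1) = 1 / 2 + b by ring] at this
  rw [e]
  exact this

theorem tendsto_profile_atBot {b : ℝ} (hb : 0 < b) :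
    Tendsto (profile b) atBot (𝓝 (1 / 2 - b)) := by
  have := ((tendsto_profile_atTop hb).comp tendsto_neg_atBot_atTop).const_sub 1
  refine (this.congr fun y => ?_).trans (by ring_nf; rfl)
  simp [profile_neg]

namespace OppositePhases

variable (h : OppositePhases um up)
include h

theorem first_integral_eq : 1 / 4 - (up - 1 / 2) ^ 2 = up * um := by
  rw [h.um_eq]; ring

theorem hasDerivAt_ubar (y : ℝ) :
    HasDerivAt (ubar up) (ubar up y * (1 - ubar up y) - up * um) y := by
  rw [ubar_eq, ← h.first_integral_eq]
  exact hasDerivAt_profile _ y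

theorem tendsto_ubar_atTop : Tendsto (ubar up) atTop (𝓝 up) := by
  have := tendsto_profile_atTop (b := up - 1 / 2) (by linarith [h.half_lt])
  rwa [add_sub_cancel] at this

theorem tendsto_ubar_atBot : Tendsto (ubar up) atBot (𝓝 um) := by
  have := tendsto_profile_atBot (b := up - 1 / 2) (by linarith [h.half_lt])
  rwa [show 1 / 2 - (up - 1 / 2) = um by rw [h.um_eq]; ring] at this

theorem isStandingWave_iff (v : ℝ → ℝ) :
    IsStandingWave um up v ↔ ∃ z : ℝ, v = fun y => ubar up (y - z) := by
  constructor
  · rintro ⟨hv, he, h1, h2⟩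
    obtain ⟨B, hB⟩ := exists_first_integral isOpen_univ isPreconnected_univ hv.contDiffOn
      fun y _ => he y
    have hd : ∀ y, HasDerivAt v (v y * (1 - v y) - B) y := fun y => hB y (mem_univ y)
    have hB0 : up * (1 - up) - B = 0 := eq_zero_of_tendsto_deriv hd h2
      ((h2.mul (h2.const_sub 1)).sub_const B)
    have hB1 : B = up * um := by rw [h.um_eq]; linarith
    obtain ⟨z, hz⟩ : ∃ z, v z = 1 / 2 :=
      mem_range_of_exists_le_of_exists_ge hv.continuous
        (h1.eventually_le_const (by linarith [h.sum, h.lt])).exists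
        (h2.eventually_const_le h.half_lt).exists
    refine ⟨z, eq_of_hasDerivAt (B := up * um) (hB1 ▸ hd) (fun y => ?_) (y₀ := z) ?_⟩
    · exact (h.hasDerivAt_ubar (y - z)).comp_sub_const y z
    · simp [hz, ubar]
  · rintro ⟨z, rfl⟩
    refine isStandingWave_of_hasDerivAt
      (fun y => (h.hasDerivAt_ubar (y - z)).comp_sub_const y z) ?_ ?_
    · exact h.tendsto_ubar_atBot.comp (tendsto_atBot_add_const_right _ (-z) tendsto_id)
    · exact h.tendsto_ubar_atTop.comp (tendsto_atTop_add_const_right _ (-z) tendsto_id)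

theorem exists_rate {ℓ : ℝ} (hℓ : 0 < ℓ) : ∃ b, up - 1 / 2 < b ∧ profile b ℓ = up := by
  have ha := h.half_lt
  have hc := continuous_profile_left ℓ
  have hlo : profile (up - 1 / 2) ℓ < up := by
    have := Real.sigmoid_lt_one (2 * ((up - 1 / 2) * ℓ))
    rw [profile_eq]
    nlinarith
  have hlim : Tendsto (fun b => profile b ℓ) atTop atTop := by
    have e : (fun b => profile b ℓ) =
        fun b => 1 / 2 + b * (2 * Real.sigmoid (2 * (b * ℓ)) - 1) :=
      funext fun b => profile_eq b ℓ
    rw [e]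
    have h1 : Tendsto (fun b : ℝ => 2 * (b * ℓ)) atTop atTop :=
      (tendsto_id.atTop_mul_const hℓ).const_mul_atTop two_pos
    have h2 := ((Real.tendsto_sigmoid_atTop.comp h1).const_mul 2).sub_const 1
    exact tendsto_atTop_add_const_left _ _ (tendsto_id.atTop_mul_pos (by norm_num) h2)
  obtain ⟨c, hc1, hc2⟩ := ((hlim.eventually_ge_atTop up).and
    (eventually_ge_atTop (up - 1 / 2))).exists
  obtain ⟨b, hb, hbe⟩ := intermediate_value_Icc hc2 hc.continuousOn ⟨hlo.le, hc1⟩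
  refine ⟨b, lt_of_le_of_ne hb.1 ?_, hbe⟩
  rintro rfl
  exact hlo.ne hbe

end OppositePhases

open Classical in
/-- The rate of the solution of the boundary value problem on `(-ℓ,ℓ)`: the root
`b > u₊ - 1/2` of `1/2 + b tanh (b ℓ) = u₊` (and `0` if `ℓ ≤ 0`). -/
noncomputable def boxRate (up ℓ : ℝ) : ℝ :=
  if h : ∃ b, up - 1 / 2 < b ∧ profile b ℓ = up then h.choose else 0

namespace OppositePhases

variable (h : OppositePhases um up)
include h

theorem lt_boxRate {ℓ : ℝ} (hℓ : 0 < ℓ) : up - 1 / 2 < boxRate up ℓ := by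
  rw [boxRate, dif_pos (h.exists_rate hℓ)]
  exact (h.exists_rate hℓ).choose_spec.1

theorem profile_boxRate {ℓ : ℝ} (hℓ : 0 < ℓ) : profile (boxRate up ℓ) ℓ = up := by
  rw [boxRate, dif_pos (h.exists_rate hℓ)]
  exact (h.exists_rate hℓ).choose_spec.2

theorem boxRate_pos {ℓ : ℝ} (hℓ : 0 < ℓ) : 0 < boxRate up ℓ := by
  linarith [h.lt_boxRate hℓ, h.half_lt]

theorem profile_boxRate_neg {ℓ : ℝ} (hℓ : 0 < ℓ) : profile (boxRate up ℓ) (-ℓ) = um := by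
  rw [profile_neg, h.profile_boxRate hℓ, h.um_eq]

theorem isBoxSolution_profile {ℓ : ℝ} (hℓ : 0 < ℓ) :
    IsBoxSolution um up ℓ (profile (boxRate up ℓ)) :=
  isBoxSolution_of_hasDerivAt (continuous_profile _).continuousOn
    (fun y _ => hasDerivAt_profile _ y) (h.profile_boxRate_neg hℓ) (h.profile_boxRate hℓ)

theorem eqOn_of_isBoxSolution {ℓ : ℝ} (hℓ : 0 < ℓ) {w : ℝ → ℝ} (hw : IsBoxSolution um up ℓ w) :
    EqOn w (profile (boxRate up ℓ)) (Icc (-ℓ) ℓ) := by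
  obtain ⟨hc, hd, he, h1, h2⟩ := hw
  obtain ⟨B, hB⟩ := exists_first_integral isOpen_Ioo isPreconnected_Ioo hd he
  exact eqOn_of_hasDerivAt (by linarith) hc (continuous_profile _).continuousOn hB
    (fun y _ => hasDerivAt_profile _ y) (by rw [h1, h.profile_boxRate_neg hℓ])
    (by rw [h2, h.profile_boxRate hℓ])

theorem boxRate_le_half {ℓ : ℝ} (hℓ : chem up ≤ ℓ) : boxRate up ℓ ≤ 1 / 2 := by
  have hp := h.chem_up_pos
  have hℓ0 : 0 < ℓ := hp.trans_le hℓ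
  by_contra! hlt
  have e := h.profile_boxRate hℓ0
  rw [profile_eq] at e
  have h1 : up ≤ Real.sigmoid ℓ := by rw [← h.sigmoid_up]; exact Real.sigmoid_le hℓ
  have h2 : Real.sigmoid ℓ ≤ Real.sigmoid (2 * (boxRate up ℓ * ℓ)) :=
    Real.sigmoid_le (by nlinarith)
  nlinarith [h.half_lt]

theorem eq_of_boxRate_eq_half {ℓ : ℝ} (hℓ : 0 < ℓ) (hb : boxRate up ℓ = 1 / 2) :
    ℓ = chem up := by
  have e := h.profile_boxRate hℓ
  rw [profile_eq, hb, show 2 * (1 / 2 * ℓ) = ℓ by ring] at e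
  rw [← chem_sigmoid ℓ]
  congr 1
  linarith

theorem tendsto_boxRate : Tendsto (boxRate up) atTop (𝓝 (up - 1 / 2)) := by
  have ha := h.half_lt
  have h1 : Tendsto (fun ℓ : ℝ => 2 * ((up - 1 / 2) * ℓ)) atTop atTop :=
    (tendsto_id.const_mul_atTop (by linarith)).const_mul_atTop two_pos
  have h2 := ((Real.tendsto_sigmoid_atTop.comp h1).const_mul 2).sub_const 1
  have h3 := (tendsto_const_nhds (x := up - 1 / 2)).div h2 (by norm_num)
  rw [show (up - 1 / 2) / (2 * 1 - 1) = up - 1 / 2 by norm_num] at h3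
  refine tendsto_of_tendsto_of_tendsto_of_le_of_le' tendsto_const_nhds h3 ?_ ?_
  · filter_upwards [eventually_gt_atTop 0] with ℓ hℓ using (h.lt_boxRate hℓ).le
  · filter_upwards [eventually_gt_atTop 0] with ℓ hℓ
    have hb := h.lt_boxRate hℓ
    have e := h.profile_boxRate hℓ
    rw [profile_eq] at e
    have hs : Real.sigmoid (2 * ((up - 1 / 2) * ℓ)) ≤ Real.sigmoid (2 * (boxRate up ℓ * ℓ)) :=
      Real.sigmoid_le (by nlinarith)
    have hs0 : 1 / 2 < Real.sigmoid (2 * ((up - 1 / 2) * ℓ)) := by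
      have : 0 < 2 * ((up - 1 / 2) * ℓ) := by
        have := _root_.mul_pos (sub_pos.2 ha) hℓ
        linarith
      have := Real.sigmoid_lt this
      rw [Real.sigmoid_zero] at this
      linarith
    simp only [Pi.div_apply, Function.comp_apply]
    rw [le_div_iff₀ (by linarith)]
    nlinarith

end OppositePhases

/-! ### Phases of stationary solutions -/

theorem mobility_chem {q : ℝ} (h0 : 0 < q) (h1 : q < 1) : mobility (chem q) = q * (1 - q) := by
  rw [mobility, sigmoid_chem h0 h1]

theorem hasDerivAt_chem_profile {b : ℝ} (hb : 0 < b) (hb' : b ≤ 1 / 2) (y : ℝ) :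
    HasDerivAt (fun y => chem (profile b y)) (slope (1 / 4 - b ^ 2) (chem (profile b y))) y := by
  obtain ⟨h0, h1⟩ := profile_mem hb hb' y
  refine ((hasDerivAt_chem h0 h1).comp y (hasDerivAt_profile b y)).congr_deriv ?_
  have : 0 < 1 - profile b y := sub_pos.2 h1
  rw [slope, mobility_chem h0 h1]
  field_simp

theorem unitSlope_chem_profile {b : ℝ} (hb : 0 < b) (hb' : b ≤ 1 / 2) :
    UnitSlope fun y => chem (profile b y) := by
  refine unitSlope_of_hasDerivAt (hasDerivAt_chem_profile hb hb') fun y => ?_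
  obtain ⟨h0, h1⟩ := profile_mem hb hb' y
  have hm : 0 < profile b y * (1 - profile b y) := mul_pos h0 (sub_pos.2 h1)
  have hB : 0 ≤ 1 / 4 - b ^ 2 := by nlinarith
  rw [slope, mobility_chem h0 h1]
  refine ⟨?_, ?_⟩
  · rw [sub_nonneg, div_le_one hm, profile]
    have := Real.tanh_sq_lt_one (b * y)
    nlinarith [mul_nonneg (sq_nonneg b) (sub_nonneg.2 this.le)]
  · have := div_nonneg hB hm.le
    linarith

/-- If the slope of a phase is prescribed almost everywhere on an interval, the density `σ(φ)` is
a classical solution of the corresponding first-order equation there. -/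
theorem hasDerivAt_sigmoid_phase {a b : ℝ} (φ : PhaseSpace a b) {B c d : ℝ}
    (hφ : ∀ᵐ y, y ∈ Ioo c d → deriv φ.val y = slope B (φ y)) {y : ℝ} (hy : y ∈ Ioo c d) :
    HasDerivAt (fun t => Real.sigmoid (φ t))
      (Real.sigmoid (φ y) * (1 - Real.sigmoid (φ y)) - B) y := by
  have hc : Continuous fun t => slope B (φ t) := (continuous_slope B).comp φ.continuous
  have h1 : HasDerivAt (fun t => φ y + ∫ s in y..t, slope B (φ s)) (slope B (φ y)) y :=
    ((hc.integral_hasStrictDerivAt y y).hasDerivAt).const_add _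
  have h2 : φ.val =ᶠ[𝓝 y] fun t => φ y + ∫ s in y..t, slope B (φ s) := by
    filter_upwards [isOpen_Ioo.mem_nhds hy] with t ht
    have : ∫ s in y..t, slope B (φ s) = ∫ s in y..t, deriv φ.val s := by
      refine intervalIntegral.integral_congr_ae ?_
      filter_upwards [hφ] with s hs hst
      refine (hs ?_).symm
      have := (ordConnected_Ioo (a := c) (b := d)).uIcc_subset hy ht
      exact this (uIoc_subset_uIcc hst)
    rw [this, φ.unitSlope.integral_deriv]
    ring
  have h3 := h1.congr_of_eventuallyEq h2
  refine ((Real.hasDerivAt_sigmoid (φ y)).comp y h3).congr_deriv ?_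
  have := (mobility_pos (φ y)).ne'
  rw [slope]
  change mobility (φ y) * (1 - B / mobility (φ y)) = mobility (φ y) - B
  field_simp

/-! ### Minimizers on the line -/

theorem coeFn_translate (z : ℝ) (u : LinfUnit) : ∀ᵐ y, u.translate z y = u (y - z) :=
  Lp.coeFn_compMeasurePreserving u.val (measurePreserving_sub_right volume z)

theorem IsPairOf.translate {x : State um up} {v : ℝ → ℝ} (hx : IsPairOf x v) (z : ℝ) :
    IsPairOf (translate z x) fun y => v (y - z) := by
  refine ⟨?_, fun y => hx.2 (y - z)⟩
  have h := (measurePreserving_sub_right (volume : Measure ℝ) z).quasiMeasurePreserving.ae hx.1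
  filter_upwards [coeFn_translate z x.1, h] with y h1 h2
  exact h1.trans h2

theorem IsPairOf.eq {x x' : State um up} {v : ℝ → ℝ} (hx : IsPairOf x v) (hx' : IsPairOf x' v) :
    x = x' := by
  refine Prod.ext (LinfUnit.ext ?_) (PhaseSpace.ext fun y => (hx.2 y).trans (hx'.2 y).symm)
  filter_upwards [hx.1, hx'.1] with y h1 h2
  exact h1.trans h2.symm

namespace OppositePhases

variable (h : OppositePhases um up)
include h

theorem excess_eq_zero_iff (x : State um up) : excess x = 0 ↔
    (∀ᵐ y, x.1 y = Real.sigmoid (x.2 y)) ∧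
      ∀ᵐ y, deriv x.2.val y = slope (up * um) (x.2 y) := by
  have hm := aemeasurable_kl_density x
  have hm2 := measurable_kl_slope (up * um) x
  rw [excess, add_eq_zero, lintegral_eq_zero_iff' hm.ennreal_ofReal,
    lintegral_eq_zero_iff hm2.ennreal_ofReal]
  refine and_congr ⟨fun h1 => ?_, fun h1 => ?_⟩ ⟨fun h1 => ?_, fun h1 => ?_⟩
  · filter_upwards [h1, kl_density_nonneg x, x.1.mem_unit] with y h2 h3 h4
    exact eq_of_kl_eq_zero h4 (Real.sigmoid_pos _) (Real.sigmoid_lt_one _)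
      (le_antisymm (ENNReal.ofReal_eq_zero.1 h2) h3)
  · filter_upwards [h1] with y h2
    rw [h2, kl_self (Real.sigmoid_pos _) (Real.sigmoid_lt_one _)]
    simp
  · filter_upwards [h1] with y h2
    rcases h.slope_cases x y with ⟨h3, h4⟩ | ⟨h3, h4⟩
    · exact eq_of_kl_eq_zero (x.2.unitSlope.deriv_mem y) h3 h4
        (le_antisymm (ENNReal.ofReal_eq_zero.1 h2) (h.kl_slope_nonneg x y))
    · rw [h3, h4]
  · filter_upwards [h1] with y h2
    rcases h.slope_cases x y with ⟨h3, h4⟩ | ⟨h3, h4⟩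
    · rw [h2, kl_self h3 h4]; simp
    · rw [h3, h4, kl_zero_zero]; simp

theorem excess_eq_zero_iff_exists (x : State um up) :
    excess x = 0 ↔ ∃ v, IsStandingWave um up v ∧ IsPairOf x v := by
  rw [h.excess_eq_zero_iff]
  constructor
  · rintro ⟨h1, h2⟩
    refine ⟨fun y => Real.sigmoid (x.2 y), isStandingWave_of_hasDerivAt (B := up * um)
      (fun y => ?_) ?_ ?_, h1, fun y => (chem_sigmoid _).symm⟩
    · exact hasDerivAt_sigmoid_phase x.2 (c := y - 1) (d := y + 1) (h2.mono fun y hy _ => hy)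
        ⟨by linarith, by linarith⟩
    · have := (differentiable_sigmoid.continuous.tendsto _).comp x.2.tendsto_atBot
      rwa [h.sigmoid_um] at this
    · have := (differentiable_sigmoid.continuous.tendsto _).comp x.2.tendsto_atTop
      rwa [h.sigmoid_up] at this
  · rintro ⟨v, hv, h1, h2⟩
    obtain ⟨z, rfl⟩ := (h.isStandingWave_iff v).1 hv
    have hb : 0 < up - 1 / 2 := by linarith [h.half_lt]
    have hb' : up - 1 / 2 ≤ 1 / 2 := by linarith [h.up_lt]
    have hmem : ∀ y, ubar up y ∈ Ioo 0 1 := profile_mem hb hb'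
    refine ⟨?_, Eventually.of_forall fun y => ?_⟩
    · filter_upwards [h1] with y hy
      rw [h2, hy, sigmoid_chem (hmem _).1 (hmem _).2]
    · have e : x.2.val = fun y => chem (profile (up - 1 / 2) (y - z)) := funext h2
      have := (hasDerivAt_chem_profile hb hb' (y - z)).comp_sub_const y z
      rw [h.first_integral_eq] at this
      rw [e, this.deriv]

/-- The standing wave is a state. -/
theorem exists_standingWave_state : ∃ x : State um up, IsPairOf x (ubar up) := by
  have hb : 0 < up - 1 / 2 := by linarith [h.half_lt]
  have hb' : up - 1 / 2 ≤ 1 / 2 := by linarith [h.up_lt]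
  have hmem : ∀ y, ubar up y ∈ Ioo 0 1 := profile_mem hb hb'
  have hmeas : AEMeasurable (ubar up) := (continuous_profile (up - 1 / 2)).aemeasurable
  have hIcc : ∀ y, ubar up y ∈ Icc (0 : ℝ) 1 := fun y => Ioo_subset_Icc_self (hmem y)
  exact ⟨(LinfUnit.ofFun (ubar up) hmeas hIcc,
    PhaseSpace.ofUnitSlope _ (unitSlope_chem_profile hb hb')
      ((hasDerivAt_chem h.pos h.um_lt).continuousAt.tendsto.comp h.tendsto_ubar_atBot)
      ((hasDerivAt_chem h.up_pos h.up_lt).continuousAt.tendsto.comp h.tendsto_ubar_atTop)),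
    LinfUnit.coeFn_ofFun _ hmeas hIcc, fun y => rfl⟩

theorem isMinimizer_iff (x : State um up) :
    (∀ x', energy um up x ≤ energy um up x') ↔ excess x = 0 := by
  constructor
  · intro hx
    obtain ⟨xb, hxb⟩ := h.exists_standingWave_state
    have h0 : excess xb = 0 := (h.excess_eq_zero_iff_exists xb).2
      ⟨_, (h.isStandingWave_iff _).2 ⟨0, by simp⟩, hxb⟩
    have h1 := hx xb
    rw [h.energy_eq, h.energy_eq, h0, EReal.coe_ennreal_zero] at h1
    have h2 := (EReal.addLECancellable_coe (minEnergy um up)).add_le_add_iff_right.1 h1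
    exact le_antisymm (by exact_mod_cast h2) bot_le
  · intro hx x'
    rw [h.energy_eq, h.energy_eq, hx]
    exact add_le_add_left (EReal.coe_ennreal_le_coe_ennreal_iff.2 bot_le) _

theorem minimizers_eq : {x : State um up | ∀ x', energy um up x ≤ energy um up x'} =
    {x | ∃ v, IsStandingWave um up v ∧ IsPairOf x v} := by
  ext x
  exact (h.isMinimizer_iff x).trans (h.excess_eq_zero_iff_exists x)

theorem minimizers_eq_range {xb : State um up} (hxb : IsPairOf xb (ubar up)) :
    {x : State um up | ∀ x', energy um up x ≤ energy um up x'} =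
      Set.range fun z : ℝ => translate z xb := by
  rw [h.minimizers_eq]
  ext x
  constructor
  · rintro ⟨v, hv, hx⟩
    obtain ⟨z, rfl⟩ := (h.isStandingWave_iff v).1 hv
    exact ⟨z, (hxb.translate z).eq hx⟩
  · rintro ⟨z, rfl⟩
    exact ⟨_, (h.isStandingWave_iff _).2 ⟨z, rfl⟩, hxb.translate z⟩

end OppositePhases

/-! ### The functionals on a box -/

theorem deriv_eq_zero_of_mem_boxSet {x : State um up} {ℓ : ℝ} (hx : x ∈ boxSet um up ℓ) {y : ℝ}
    (hy : y < -ℓ ∨ ℓ < y) : deriv x.2.val y = 0 := by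
  rcases hy with hy | hy
  · have : x.2.val =ᶠ[𝓝 y] fun _ => chem um := by
      filter_upwards [isOpen_Iio.mem_nhds hy] with t ht using hx.1 t ht.le
    rw [this.deriv_eq, deriv_const]
  · have : x.2.val =ᶠ[𝓝 y] fun _ => chem up := by
      filter_upwards [isOpen_Ioi.mem_nhds hy] with t ht using hx.2.2.1 t ht.le
    rw [this.deriv_eq, deriv_const]

theorem ae_lt_or_gt_or_mem_Ioo (ℓ : ℝ) : ∀ᵐ y : ℝ, y < -ℓ ∨ ℓ < y ∨ y ∈ Ioo (-ℓ) ℓ := by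
  have h1 : ∀ᵐ y : ℝ, y ≠ -ℓ := Measure.ae_ne volume (-ℓ)
  have h2 : ∀ᵐ y : ℝ, y ≠ ℓ := Measure.ae_ne volume ℓ
  filter_upwards [h1, h2] with y a b
  rcases lt_or_gt_of_ne a with a | a
  · exact Or.inl a
  · rcases lt_or_gt_of_ne b with b | b
    · exact Or.inr (Or.inr ⟨a, b⟩)
    · exact Or.inr (Or.inl b)

theorem mem_boxSet_of_isPairOf {ℓ : ℝ} (hℓ : 0 < ℓ) {v : ℝ → ℝ} {x : State um up}
    (hx : IsPairOf x (extendBox um up ℓ v)) : x ∈ boxSet um up ℓ := by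
  refine ⟨fun y hy => ?_, ?_, fun y hy => ?_, ?_⟩
  · rw [hx.2, extendBox, if_pos hy]
  · filter_upwards [hx.1] with y h1 hy
    rw [h1, extendBox, if_pos hy]
  · rw [hx.2, extendBox, if_neg (by linarith), if_pos hy]
  · filter_upwards [hx.1] with y h1 hy
    rw [h1, extendBox, if_neg (by linarith), if_pos hy]

namespace OppositePhases

variable (h : OppositePhases um up)
include h

theorem density_eq_zero_of_mem_boxSet {x : State um up} {ℓ : ℝ} (hx : x ∈ boxSet um up ℓ) :
    ∀ᵐ y, y ∉ Ioo (-ℓ) ℓ → density x y = 0 := by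
  filter_upwards [hx.2.1, hx.2.2.2, ae_lt_or_gt_or_mem_Ioo ℓ] with y h1 h2 h3 hy
  have e0 : entropy 0 = 0 := by simp [entropy]
  rcases h3 with h3 | h3 | h3
  · rw [density, h.gFun_sub, deriv_eq_zero_of_mem_boxSet hx (Or.inl h3), hx.1 y h3.le, h1 h3.le,
      h.sigmoid_um, kl_self h.pos h.um_lt, e0, mobility_chem h.pos h.um_lt, h.um_eq]
    ring_nf
  · rw [density, h.gFun_sub, deriv_eq_zero_of_mem_boxSet hx (Or.inr h3), hx.2.2.1 y h3.le,
      h2 h3.le, h.sigmoid_up, kl_self h.up_pos h.up_lt, e0, h.mobility_up]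
    ring
  · exact absurd h3 hy

theorem mem_domainD_of_mem_boxSet {x : State um up} {ℓ : ℝ} (hℓ : 0 < ℓ)
    (hx : x ∈ boxSet um up ℓ) : x ∈ domainD um up := by
  have hfin : volume (Ioo (-ℓ) ℓ) < ∞ := by simp
  have h1 : MemLp (fun y => x.1 y - step um up (y - 0)) 2 := by
    refine MemLp.mono (memLp_indicator_const 2 (measurableSet_Ioo (a := -ℓ) (b := ℓ)) (1 : ℝ)
      (Or.inr hfin.ne)) (aemeasurable_devU 0 x).aestronglyMeasurable ?_
    filter_upwards [hx.2.1, hx.2.2.2, ae_lt_or_gt_or_mem_Ioo ℓ, x.1.mem_unit] with y a b c d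
    rcases c with c | c | c
    · rw [a c.le, step, if_pos (by linarith)]; simp
    · rw [b c.le, step, if_neg (by linarith)]; simp
    · rw [indicator_of_mem c, norm_one, Real.norm_eq_abs, abs_le]
      have := h.pos; have := h.up_pos; have := h.up_lt; have := h.um_lt
      rcases step_eq_or um up (y - 0) with e | e <;> rw [e] <;>
        constructor <;> linarith [d.1, d.2]
  have h2 : MemLp (fun y => x.2 y - step (chem um) (chem up) (y - 0)) 1 := by
    refine MemLp.mono (memLp_indicator_const 1 (measurableSet_Ioo (a := -ℓ) (b := ℓ))
      (2 * chem up) (Or.inr hfin.ne)) (measurable_devPhi 0 x).aestronglyMeasurable ?_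
    filter_upwards [ae_lt_or_gt_or_mem_Ioo ℓ] with y c
    have hp := h.chem_up_pos
    rcases c with c | c | c
    · rw [hx.1 y c.le, step, if_pos (by linarith)]; simp
    · rw [hx.2.2.1 y c.le, step, if_neg (by linarith)]; simp
    · have d := h.mem_Icc x y
      have hc := h.chem_um
      rw [indicator_of_mem c, Real.norm_eq_abs, Real.norm_eq_abs,
        abs_of_nonneg (a := 2 * chem up) (by linarith), abs_le]
      rcases step_eq_or (chem um) (chem up) (y - 0) with e | e <;> rw [e] <;>
        constructor <;> linarith [d.1, d.2]
  exact ENNReal.add_lt_top.2 ⟨h1.2, h2.2⟩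

theorem setIntegral_density {x : State um up} {ℓ : ℝ} (hx : x ∈ boxSet um up ℓ) :
    ∫ y in Ioo (-ℓ) ℓ, density x y = ∫ y, density x y :=
  setIntegral_eq_integral_of_ae_compl_eq_zero (h.density_eq_zero_of_mem_boxSet hx)

theorem energyBox_eq {x : State um up} {ℓ : ℝ} (hℓ : 0 < ℓ) (hx : x ∈ boxSet um up ℓ) :
    energyBox um up ℓ x = energy um up x := by
  rw [energyBox, if_pos hx, energy, if_pos (h.mem_domainD_of_mem_boxSet hℓ hx),
    h.setIntegral_density hx]

theorem energy_le_energyBox {ℓ : ℝ} (hℓ : 0 < ℓ) (x : State um up) :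
    energy um up x ≤ energyBox um up ℓ x := by
  by_cases hx : x ∈ boxSet um up ℓ
  · exact (h.energyBox_eq hℓ hx).ge
  · rw [energyBox, if_neg hx]; exact le_top

/-- In a box of minimal size the phase is forced to be linear. -/
theorem phase_eq_self_of_mem_boxSet {x : State um up} (hx : x ∈ boxSet um up (chem up)) {y : ℝ}
    (hy : y ∈ Icc (-chem up) (chem up)) : x.2 y = y := by
  have h1 := (x.2.unitSlope _ _ hy.1).2
  have h2 := (x.2.unitSlope _ _ hy.2).2
  have h3 : x.2.val (-chem up) = -chem up := (hx.1 _ le_rfl).trans h.chem_um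
  have h4 : x.2.val (chem up) = chem up := hx.2.2.1 _ le_rfl
  rw [h3] at h1
  rw [h4] at h2
  linarith

theorem deriv_eq_one_of_mem_boxSet {x : State um up} (hx : x ∈ boxSet um up (chem up)) {y : ℝ}
    (hy : y ∈ Ioo (-chem up) (chem up)) : deriv x.2.val y = 1 := by
  have : x.2.val =ᶠ[𝓝 y] id := by
    filter_upwards [isOpen_Ioo.mem_nhds hy] with t ht
      using h.phase_eq_self_of_mem_boxSet hx (Ioo_subset_Icc_self ht)
  rw [this.deriv_eq, deriv_id]

theorem integrableOn_kl_density (x : State um up) (ℓ : ℝ) :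
    IntegrableOn (fun y => kl (x.1 y) (Real.sigmoid (x.2 y))) (Ioo (-ℓ) ℓ) := by
  have hA := h.mul_pos
  refine Measure.integrableOn_of_bounded (M := 1 / (up * um)) (by simp)
    (aemeasurable_kl_density x).aestronglyMeasurable ?_
  refine ae_restrict_of_ae ?_
  filter_upwards [kl_density_nonneg x, x.1.mem_unit] with y h1 h2
  rw [Real.norm_eq_abs, abs_of_nonneg h1]
  have h3 := Real.sigmoid_pos (x.2 y)
  have h4 := Real.sigmoid_lt_one (x.2 y)
  refine (kl_le_sq h2 h3 h4).trans (div_le_div₀ zero_le_one ?_ hA (h.le_mobility (h.mem_Icc x y)))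
  rw [sq_le_one_iff_abs_le_one, abs_le]
  constructor <;> linarith [h2.1, h2.2]

/-- The energy on a box in terms of the relative entropies with respect to the solution of the
boundary value problem. -/
theorem exists_setIntegral_density_eq {ℓ : ℝ} (hℓ : chem up ≤ ℓ) :
    ∃ c : ℝ, ∀ x ∈ boxSet um up ℓ,
      IntegrableOn (fun y => kl (deriv x.2.val y) (slope (1 / 4 - boxRate up ℓ ^ 2) (x.2 y)))
        (Ioo (-ℓ) ℓ) ∧
      (∀ y ∈ Ioo (-ℓ) ℓ,
        0 ≤ kl (deriv x.2.val y) (slope (1 / 4 - boxRate up ℓ ^ 2) (x.2 y)) ∧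
        (kl (deriv x.2.val y) (slope (1 / 4 - boxRate up ℓ ^ 2) (x.2 y)) = 0 ↔
          deriv x.2.val y = slope (1 / 4 - boxRate up ℓ ^ 2) (x.2 y))) ∧
      ∫ y in Ioo (-ℓ) ℓ, density x y = c +
        (∫ y in Ioo (-ℓ) ℓ, kl (x.1 y) (Real.sigmoid (x.2 y))) +
        ∫ y in Ioo (-ℓ) ℓ,
          kl (deriv x.2.val y) (slope (1 / 4 - boxRate up ℓ ^ 2) (x.2 y)) := by
  have hp := h.chem_up_pos
  have hℓ0 : 0 < ℓ := hp.trans_le hℓ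
  have hA := h.mul_pos
  rcases (h.boxRate_le_half hℓ).eq_or_lt with hb | hb
  · -- the phase is linear, with slope `1`
    have hℓe := h.eq_of_boxRate_eq_half hℓ0 hb
    have hB : 1 / 4 - boxRate up ℓ ^ 2 = 0 := by rw [hb]; norm_num
    have hs : ∀ t, slope 0 t = 1 := fun t => by simp [slope]
    simp only [hB, hs]
    refine ⟨∫ y in Ioo (-ℓ) ℓ, (Real.log (mobility y) - Real.log (up * um)), fun x hx => ?_⟩
    rw [hℓe] at hx ⊢
    have hd : ∀ y ∈ Ioo (-chem up) (chem up), kl (deriv x.2.val y) 1 = 0 := fun y hy => by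
      rw [h.deriv_eq_one_of_mem_boxSet hx hy, kl_one_one]
    have hi : IntegrableOn (fun y => Real.log (mobility y) - Real.log (up * um))
        (Ioo (-chem up) (chem up)) :=
      (((continuous_mobility.log fun t => (mobility_pos t).ne').sub
        continuous_const).continuousOn.integrableOn_Icc).mono_set Ioo_subset_Icc_self
    refine ⟨integrableOn_zero.congr_fun (fun y hy => (hd y hy).symm) measurableSet_Ioo,
      fun y hy => ⟨(hd y hy).ge, by simp [kl_one_one, h.deriv_eq_one_of_mem_boxSet hx hy]⟩, ?_⟩
    rw [setIntegral_congr_fun measurableSet_Ioo hd, integral_zero, add_zero,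
      ← integral_add hi (h.integrableOn_kl_density x _)]
    refine setIntegral_congr_fun measurableSet_Ioo fun y hy => ?_
    have e1 : entropy 1 = 0 := by simp [entropy]
    simp only [density]
    rw [h.gFun_sub, h.deriv_eq_one_of_mem_boxSet hx hy, e1,
      h.phase_eq_self_of_mem_boxSet hx (Ioo_subset_Icc_self hy)]
    ring
  · have hb0 := h.boxRate_pos hℓ0
    have hab := h.lt_boxRate hℓ0
    set B := 1 / 4 - boxRate up ℓ ^ 2 with hB
    have hB0 : 0 < B := by nlinarith
    have hBA : B < up * um := by rw [← h.first_integral_eq, hB]; nlinarith [h.half_lt]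
    refine ⟨(∫ t in Ioo (chem um) (chem up), chem (slope B t)) +
      2 * ℓ * (Real.log B - Real.log (up * um)), fun x hx => ?_⟩
    have hs0 : ∀ y, 0 < slope B (x.2 y) := fun y => h.slope_pos hBA (h.mem_Icc x y)
    have hs1 : ∀ y, slope B (x.2 y) < 1 := fun y => slope_lt_one hB0 _
    have hn : ∀ y, 0 ≤ kl (deriv x.2.val y) (slope B (x.2 y)) := fun y =>
      kl_nonneg (x.2.unitSlope.deriv_mem y) (hs0 y) (hs1 y)
    have hsc : Continuous fun y => slope B (x.2 y) := (continuous_slope B).comp x.2.continuous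
    have hi : IntegrableOn (fun y => kl (deriv x.2.val y) (slope B (x.2 y))) (Ioo (-ℓ) ℓ) := by
      have hc : Continuous fun y => 1 / (slope B (x.2 y) * (1 - slope B (x.2 y))) :=
        continuous_const.div (hsc.mul (continuous_const.sub hsc))
          fun y => (_root_.mul_pos (hs0 y) (sub_pos.2 (hs1 y))).ne'
      refine Integrable.mono' (hc.continuousOn.integrableOn_Icc.mono_set Ioo_subset_Icc_self)
        (measurable_kl_slope B x).aestronglyMeasurable (Eventually.of_forall fun y => ?_)
      rw [Real.norm_eq_abs, abs_of_nonneg (hn y)]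
      have hd := x.2.unitSlope.deriv_mem y
      have h1 := hs0 y
      have h2 := hs1 y
      refine (kl_le_sq hd h1 h2).trans ?_
      refine div_le_div_of_nonneg_right ?_ (_root_.mul_pos h1 (sub_pos.2 h2)).le
      rw [sq_le_one_iff_abs_le_one, abs_le]
      constructor <;> linarith [hd.1, hd.2]
    refine ⟨hi, fun y _ => ⟨hn y, fun h0 =>
      eq_of_kl_eq_zero (x.2.unitSlope.deriv_mem y) (hs0 y) (hs1 y) h0, fun h0 => by
        rw [h0, kl_self (hs0 y) (hs1 y)]⟩, ?_⟩
    have hN : ∫ y in Ioo (-ℓ) ℓ, deriv x.2.val y * chem (slope B (x.2 y)) =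
        ∫ t in Ioo (chem um) (chem up), chem (slope B t) := by
      rw [← x.2.integral_deriv_mul fun t => chem (slope B t)]
      refine setIntegral_eq_integral_of_ae_compl_eq_zero ?_
      filter_upwards [ae_lt_or_gt_or_mem_Ioo ℓ] with y h3 hy
      rcases h3 with h3 | h3 | h3
      · rw [deriv_eq_zero_of_mem_boxSet hx (Or.inl h3), zero_mul]
      · rw [deriv_eq_zero_of_mem_boxSet hx (Or.inr h3), zero_mul]
      · exact absurd h3 hy
    have hNi : IntegrableOn (fun y => deriv x.2.val y * chem (slope B (x.2 y)))
        (Ioo (-ℓ) ℓ) := by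
      have hcs : Continuous fun y => chem (slope B (x.2 y)) :=
        continuous_iff_continuousAt.2 fun y =>
          (hasDerivAt_chem (hs0 y) (hs1 y)).continuousAt.comp (f := fun y => slope B (x.2 y))
            hsc.continuousAt
      refine Integrable.mono' (hcs.abs.continuousOn.integrableOn_Icc.mono_set Ioo_subset_Icc_self)
        ((measurable_deriv _).mul hcs.measurable).aestronglyMeasurable
        (Eventually.of_forall fun y => ?_)
      have hd := x.2.unitSlope.deriv_mem y
      rw [Real.norm_eq_abs, abs_mul, abs_of_nonneg hd.1]
      exact mul_le_of_le_one_left (abs_nonneg _) hd.2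
    have hk := h.integrableOn_kl_density x ℓ
    have e : ∀ y, density x y = kl (x.1 y) (Real.sigmoid (x.2 y)) +
        (kl (deriv x.2.val y) (slope B (x.2 y)) + (deriv x.2.val y * chem (slope B (x.2 y)) +
          (Real.log B - Real.log (up * um)))) := fun y => by
      rw [density, h.gFun_sub, entropy_add_log_mobility hB0]; ring
    have hc : IntegrableOn (fun _ : ℝ => Real.log B - Real.log (up * um)) (Ioo (-ℓ) ℓ) :=
      integrableOn_const (by simp)
    have h1 : IntegrableOn (fun y => deriv x.2.val y * chem (slope B (x.2 y)) +
        (Real.log B - Real.log (up * um))) (Ioo (-ℓ) ℓ) := hNi.add hc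
    have h2 : IntegrableOn (fun y => kl (deriv x.2.val y) (slope B (x.2 y)) +
        (deriv x.2.val y * chem (slope B (x.2 y)) +
        (Real.log B - Real.log (up * um)))) (Ioo (-ℓ) ℓ) := hi.add h1
    simp only [e]
    rw [integral_add hk h2, integral_add hi h1, integral_add hNi hc, hN, setIntegral_const]
    have hv : volume.real (Ioo (-ℓ) ℓ) = 2 * ℓ := by
      rw [Real.volume_real_Ioo_of_le (by linarith)]; ring
    rw [hv, smul_eq_mul]
    ring

theorem extendBox_eq {ℓ : ℝ} (hℓ : 0 < ℓ) (y : ℝ) :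
    extendBox um up ℓ (profile (boxRate up ℓ)) y =
      profile (boxRate up ℓ) (max (-ℓ) (min ℓ y)) := by
  unfold extendBox
  split_ifs with h1 h2
  · rw [max_eq_left (by simp [h1]), h.profile_boxRate_neg hℓ]
  · rw [min_eq_left h2, max_eq_right (by linarith), h.profile_boxRate hℓ]
  · rw [min_eq_right (by linarith), max_eq_right (by linarith)]

/-- The solution of the boundary value problem, extended by constants, is a state that is frozen
outside the box. -/
theorem exists_boxSolution_state {ℓ : ℝ} (hℓ : chem up ≤ ℓ) :
    ∃ x : State um up, IsPairOf x (extendBox um up ℓ (profile (boxRate up ℓ))) := by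
  have hℓ0 : 0 < ℓ := h.chem_up_pos.trans_le hℓ
  have hb := h.boxRate_pos hℓ0
  have hb' := h.boxRate_le_half hℓ
  set f := extendBox um up ℓ (profile (boxRate up ℓ)) with hf
  have e : f = fun y => profile (boxRate up ℓ) (max (-ℓ) (min ℓ y)) := funext (h.extendBox_eq hℓ0)
  have hmeas : AEMeasurable f := by
    rw [e]
    exact ((continuous_profile _).comp
      (continuous_const.max (continuous_const.min continuous_id))).aemeasurable
  have hIcc : ∀ y, f y ∈ Icc (0 : ℝ) 1 := fun y => by
    rw [e]; exact Ioo_subset_Icc_self (profile_mem hb hb' _)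
  have hs : UnitSlope fun y => chem (f y) := by
    rw [e]
    exact (unitSlope_chem_profile hb hb').comp ((unitSlope_const (-ℓ)).max
      ((unitSlope_const ℓ).min (by simpa using unitSlope_add_const 0)))
  refine ⟨(LinfUnit.ofFun f hmeas hIcc, PhaseSpace.ofUnitSlope _ hs ?_ ?_),
    LinfUnit.coeFn_ofFun _ hmeas hIcc, fun y => rfl⟩
  · refine tendsto_const_nhds.congr' ?_
    filter_upwards [eventually_le_atBot (-ℓ)] with y hy
    rw [hf, extendBox, if_pos hy]
  · refine tendsto_const_nhds.congr' ?_
    filter_upwards [eventually_ge_atTop ℓ] with y hy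
    rw [hf, extendBox, if_neg (by linarith), if_pos hy]

/-- The extended solution of the boundary value problem is the only state frozen outside the box
for which both relative entropies vanish. -/
theorem isPairOf_extendBox_iff {ℓ : ℝ} (hℓ : chem up ≤ ℓ) {x : State um up}
    (hx : x ∈ boxSet um up ℓ) : IsPairOf x (extendBox um up ℓ (profile (boxRate up ℓ))) ↔
      (∀ᵐ y, y ∈ Ioo (-ℓ) ℓ → x.1 y = Real.sigmoid (x.2 y)) ∧
      ∀ᵐ y, y ∈ Ioo (-ℓ) ℓ → deriv x.2.val y = slope (1 / 4 - boxRate up ℓ ^ 2) (x.2 y) := by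
  have hℓ0 : 0 < ℓ := h.chem_up_pos.trans_le hℓ
  have hb := h.boxRate_pos hℓ0
  have hb' := h.boxRate_le_half hℓ
  have hin : ∀ y ∈ Ioo (-ℓ) ℓ, extendBox um up ℓ (profile (boxRate up ℓ)) y =
      profile (boxRate up ℓ) y := fun y hy => by
    rw [extendBox, if_neg (by linarith [hy.1]), if_neg (by linarith [hy.2])]
  constructor
  · rintro ⟨h1, h2⟩
    constructor
    · filter_upwards [h1] with y h3 hy
      obtain ⟨h4, h5⟩ := profile_mem hb hb' y
      rw [h3, h2, hin y hy, sigmoid_chem h4 h5]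
    · refine Eventually.of_forall fun y hy => ?_
      have : x.2.val =ᶠ[𝓝 y] fun t => chem (profile (boxRate up ℓ) t) := by
        filter_upwards [isOpen_Ioo.mem_nhds hy] with t ht
        exact (h2 t).trans (by rw [hin t ht])
      rw [this.deriv_eq, (hasDerivAt_chem_profile hb hb' y).deriv, h2, hin y hy]
  · rintro ⟨h1, h2⟩
    have hl : Real.sigmoid (x.2 (-ℓ)) = um := by rw [hx.1 _ le_rfl, h.sigmoid_um]
    have hr : Real.sigmoid (x.2 ℓ) = up := by rw [hx.2.2.1 _ le_rfl, h.sigmoid_up]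
    have hsol : IsBoxSolution um up ℓ fun y => Real.sigmoid (x.2 y) :=
      isBoxSolution_of_hasDerivAt
        (differentiable_sigmoid.continuous.comp x.2.continuous).continuousOn
        (fun y hy => hasDerivAt_sigmoid_phase x.2 h2 hy) hl hr
    have heq := h.eqOn_of_isBoxSolution hℓ0 hsol
    constructor
    · filter_upwards [h1, hx.2.1, hx.2.2.2, ae_lt_or_gt_or_mem_Ioo ℓ] with y h3 h4 h5 h6
      rcases h6 with h6 | h6 | h6
      · rw [h4 h6.le, extendBox, if_pos h6.le]
      · rw [h5 h6.le, extendBox, if_neg (by linarith), if_pos h6.le]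
      · rw [h3 h6, hin y h6]
        exact heq (Ioo_subset_Icc_self h6)
    · intro y
      unfold extendBox
      split_ifs with h3 h4
      · exact hx.1 y h3
      · exact hx.2.2.1 y h4
      · rw [← heq ⟨by linarith, by linarith⟩, chem_sigmoid]

theorem minimizers_energyBox {ℓ : ℝ} (hℓ : chem up ≤ ℓ) {xl : State um up}
    (hxl : IsPairOf xl (extendBox um up ℓ (profile (boxRate up ℓ)))) :
    {x : State um up | ∀ x', energyBox um up ℓ x ≤ energyBox um up ℓ x'} = {xl} := by
  have hℓ0 : 0 < ℓ := h.chem_up_pos.trans_le hℓ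
  have hbox := mem_boxSet_of_isPairOf hℓ0 hxl
  obtain ⟨c, hc⟩ := h.exists_setIntegral_density_eq hℓ
  have hn1 : ∀ x : State um up,
      0 ≤ᵐ[volume.restrict (Ioo (-ℓ) ℓ)] fun y => kl (x.1 y) (Real.sigmoid (x.2 y)) := fun x =>
    ae_restrict_of_ae (kl_density_nonneg x)
  have hn2 : ∀ x ∈ boxSet um up ℓ, 0 ≤ᵐ[volume.restrict (Ioo (-ℓ) ℓ)]
      fun y => kl (deriv x.2.val y) (slope (1 / 4 - boxRate up ℓ ^ 2) (x.2 y)) := fun x hx => by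
    filter_upwards [ae_restrict_mem measurableSet_Ioo] with y hy
    exact ((hc x hx).2.1 y hy).1
  -- the state `xl` realizes the lower bound `c`
  have hel : ∫ y in Ioo (-ℓ) ℓ, density xl y = c := by
    obtain ⟨h1, h2⟩ := (h.isPairOf_extendBox_iff hℓ hbox).1 hxl
    have z1 : ∫ y in Ioo (-ℓ) ℓ, kl (xl.1 y) (Real.sigmoid (xl.2 y)) = 0 := by
      refine integral_eq_zero_of_ae ?_
      filter_upwards [(ae_restrict_iff' measurableSet_Ioo).2 h1] with y hy
      rw [hy, kl_self (Real.sigmoid_pos _) (Real.sigmoid_lt_one _)]; rfl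
    have z2 : ∫ y in Ioo (-ℓ) ℓ,
        kl (deriv xl.2.val y) (slope (1 / 4 - boxRate up ℓ ^ 2) (xl.2 y)) = 0 := by
      refine integral_eq_zero_of_ae ?_
      filter_upwards [(ae_restrict_iff' measurableSet_Ioo).2 h2,
        ae_restrict_mem measurableSet_Ioo] with y hy hy'
      exact ((hc xl hbox).2.1 y hy').2.2 hy
    rw [(hc xl hbox).2.2, z1, z2, add_zero, add_zero]
  refine Subset.antisymm (fun x hx => ?_) ?_
  · have hle := hx xl
    rw [energyBox, energyBox, if_pos hbox, hel] at hle
    split_ifs at hle with hxb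
    · obtain ⟨hi, hk, he⟩ := hc x hxb
      rw [EReal.coe_le_coe_iff, he] at hle
      have p1 := integral_nonneg_of_ae (hn1 x)
      have p2 := integral_nonneg_of_ae (hn2 x hxb)
      have z1 := (integral_eq_zero_iff_of_nonneg_ae (hn1 x) (h.integrableOn_kl_density x ℓ)).1
        (by linarith)
      have z2 := (integral_eq_zero_iff_of_nonneg_ae (hn2 x hxb) hi).1 (by linarith)
      refine IsPairOf.eq ((h.isPairOf_extendBox_iff hℓ hxb).2 ⟨?_, ?_⟩) hxl
      · filter_upwards [(ae_restrict_iff' measurableSet_Ioo).1 z1, x.1.mem_unit] with y h1 h2 hy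
        exact eq_of_kl_eq_zero h2 (Real.sigmoid_pos _) (Real.sigmoid_lt_one _) (h1 hy)
      · filter_upwards [(ae_restrict_iff' measurableSet_Ioo).1 z2] with y h1 hy
        exact (hk y hy).2.1 (h1 hy)
    · exact absurd (top_le_iff.1 hle) (EReal.coe_ne_top _)
  · rintro x rfl x'
    rw [energyBox, if_pos hbox, hel, energyBox]
    split_ifs with hxb
    · rw [EReal.coe_le_coe_iff, (hc x' hxb).2.2]
      have p1 := integral_nonneg_of_ae (hn1 x')
      have p2 := integral_nonneg_of_ae (hn2 x' hxb)
      linarith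
    · exact le_top

theorem tendsto_boxSolution {xl : ℝ → State um up} {xb : State um up}
    (hxl : ∀ ℓ, chem up ≤ ℓ → IsPairOf (xl ℓ) (extendBox um up ℓ (profile (boxRate up ℓ))))
    (hxb : IsPairOf xb (ubar up)) : Tendsto xl atTop (𝓝 xb) := by
  have hpt : ∀ y, Tendsto (fun ℓ => extendBox um up ℓ (profile (boxRate up ℓ)) y) atTop
      (𝓝 (ubar up y)) := by
    intro y
    have h1 := ((continuous_profile_left y).tendsto _).comp h.tendsto_boxRate
    refine h1.congr' ?_
    filter_upwards [eventually_gt_atTop |y|] with ℓ hℓ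
    have := abs_lt.1 hℓ
    rw [extendBox, if_neg (by linarith), if_neg (by linarith)]
    rfl
  have hmem : ∀ y, ubar up y ∈ Ioo 0 1 :=
    profile_mem (by linarith [h.half_lt]) (by linarith [h.up_lt])
  refine (Prod.tendsto_iff _ _).2 ⟨?_, ?_⟩
  · refine LinfUnit.tendsto_of_ae_eq ?_ hxb.1 (Eventually.of_forall hpt)
    filter_upwards [eventually_ge_atTop (chem up)] with ℓ hℓ using (hxl ℓ hℓ).1
  · refine PhaseSpace.tendsto_of_pointwise fun y => ?_
    rw [hxb.2 y]
    refine (((hasDerivAt_chem (hmem y).1 (hmem y).2).continuousAt.tendsto.comp (hpt y))).congr' ?_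
    filter_upwards [eventually_ge_atTop (chem up)] with ℓ hℓ
    exact ((hxl ℓ hℓ).2 y).symm

end OppositePhases

/-! ### Compactness modulo translations -/

theorem ofReal_le_devPhi_of_pos (x : State um up) (z : ℝ) {y : ℝ} (hy : 0 < y) :
    ENNReal.ofReal (y * (chem up - x.2 (y + z))) ≤ devPhi z x := by
  have e : ENNReal.ofReal (y * (chem up - x.2 (y + z))) =
      ∫⁻ _ in Ioo z (y + z), ENNReal.ofReal (chem up - x.2 (y + z)) := by
    rw [setLIntegral_const, Real.volume_Ioo, add_sub_cancel_right, ENNReal.ofReal_mul hy.le,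
      mul_comm]
  rw [e, devPhi_eq]
  refine (setLIntegral_mono' measurableSet_Ioo fun t ht => ENNReal.ofReal_le_ofReal ?_).trans
    (setLIntegral_le_lintegral _ _)
  have h1 : x.2 t ≤ x.2 (y + z) := x.2.monotone ht.2.le
  rw [step, if_neg (by linarith [ht.1]), abs_sub_comm]
  exact (sub_le_sub_left h1 _).trans (le_abs_self _)

theorem ofReal_le_devPhi_of_neg (x : State um up) (z : ℝ) {y : ℝ} (hy : y < 0) :
    ENNReal.ofReal (-y * (x.2 (y + z) - chem um)) ≤ devPhi z x := by
  have e : ENNReal.ofReal (-y * (x.2 (y + z) - chem um)) =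
      ∫⁻ _ in Ioo (y + z) z, ENNReal.ofReal (x.2 (y + z) - chem um) := by
    rw [setLIntegral_const, Real.volume_Ioo, show z - (y + z) = -y by ring,
      ENNReal.ofReal_mul (by linarith), mul_comm]
  rw [e, devPhi_eq]
  refine (setLIntegral_mono' measurableSet_Ioo fun t ht => ENNReal.ofReal_le_ofReal ?_).trans
    (setLIntegral_le_lintegral _ _)
  have h1 : x.2 (y + z) ≤ x.2 t := x.2.monotone ht.1.le
  rw [step, if_pos (by linarith [ht.2])]
  exact (sub_le_sub_right h1 _).trans (le_abs_self _)

namespace OppositePhases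

variable (h : OppositePhases um up)
include h

/-- Sublevel sets of the energy are compact modulo translations: once the phase vanishes at the
origin, the `L¹` bound and monotonicity make its tails uniformly small. -/
theorem exists_isCompact_translate (c : ℝ) : ∃ K : Set (State um up), IsCompact K ∧
    ∀ x : State um up, energy um up x ≤ c → ∃ z, translate z x ∈ K := by
  obtain ⟨C, hC, hdev⟩ := h.dev_le_excess
  set N := ENNReal.ofReal C * (ENNReal.ofReal (c - minEnergy um up) + 1) with hN
  have hNt : N ≠ ⊤ := ENNReal.mul_ne_top ENNReal.ofReal_ne_top
    (ENNReal.add_ne_top.2 ⟨ENNReal.ofReal_ne_top, ENNReal.one_ne_top⟩)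
  refine ⟨_, (isCompact_univ (X := LinfUnit)).prod
    (PhaseSpace.isCompact_tails (a := chem um) (b := chem up) N.toReal), fun x hx => ?_⟩
  obtain ⟨z, hz⟩ := h.exists_zero x
  have hex : excess x ≤ ENNReal.ofReal (c - minEnergy um up) := by
    rw [h.energy_eq] at hx
    have hne : excess x ≠ ⊤ := by
      intro hne
      rw [hne, EReal.coe_ennreal_top, EReal.top_add_coe] at hx
      exact EReal.coe_ne_top _ (top_le_iff.1 hx)
    rw [← EReal.coe_ennreal_toReal hne, ← EReal.coe_add, EReal.coe_le_coe_iff] at hx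
    rw [← ENNReal.ofReal_toReal hne]
    exact ENNReal.ofReal_le_ofReal (by linarith)
  have hd : devPhi z x ≤ N :=
    le_add_self.trans ((hdev x z hz).trans (by rw [hN]; gcongr))
  have hv : ∀ y, (translate (-z) x).2 y = x.2 (y + z) := fun y => by
    change x.2 (y - -z) = _
    rw [sub_neg_eq_add]
  refine ⟨-z, mem_univ _, fun y hy => ?_, fun y hy => ?_⟩
  · rw [hv]
    exact (ENNReal.ofReal_le_iff_le_toReal hNt).1 ((ofReal_le_devPhi_of_pos x z hy).trans hd)
  · rw [hv]
    exact (ENNReal.ofReal_le_iff_le_toReal hNt).1 ((ofReal_le_devPhi_of_neg x z hy).trans hd)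

theorem exists_isCompact_eventually {ι : Type*} {l : Filter ι} {L : ι → ℝ} {x : ι → State um up}
    (hL : Tendsto L l atTop) (hx : limsup (fun i => energyBox um up (L i) (x i)) l < ⊤) :
    ∃ (K : Set (State um up)) (z : ι → ℝ), IsCompact K ∧ ∀ᶠ i in l, translate (z i) (x i) ∈ K := by
  obtain ⟨c, hc⟩ := EReal.lt_iff_exists_real_btwn.1 hx
  obtain ⟨K, hK, hz⟩ := h.exists_isCompact_translate c
  choose! z hz using hz
  refine ⟨K, fun i => z (x i), hK, ?_⟩
  filter_upwards [eventually_lt_of_limsup_lt hc.1, hL.eventually_gt_atTop 0] with i h1 h2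
  exact hz _ ((h.energy_le_energyBox h2 _).trans h1.le)

theorem isCompact_closure_range {L : ℕ → ℝ} {x : ℕ → State um up} (hL : Tendsto L atTop atTop)
    (hx : limsup (fun n => energyBox um up (L n) (x n)) atTop < ⊤) :
    ∃ z : ℕ → ℝ, IsCompact (closure (Set.range fun n => translate (z n) (x n))) := by
  obtain ⟨K, z, hK, hz⟩ := h.exists_isCompact_eventually hL hx
  obtain ⟨N, hN⟩ := eventually_atTop.1 hz
  refine ⟨z, IsCompact.closure_of_subset
    (hK.union ((finite_lt_nat N).image fun n => translate (z n) (x n)).isCompact) ?_⟩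
  rintro _ ⟨n, rfl⟩
  rcases lt_or_ge n N with hn | hn
  · exact Or.inr ⟨n, hn, rfl⟩
  · exact Or.inl (hN n hn)

theorem isCompact_closure_image {x : ℝ → State um up}
    (hx : limsup (fun ℓ => energyBox um up ℓ (x ℓ)) atTop < ⊤) :
    ∃ (z : ℝ → ℝ) (ℓ₀ : ℝ),
      IsCompact (closure ((fun ℓ => translate (z ℓ) (x ℓ)) '' Set.Ici ℓ₀)) := by
  obtain ⟨K, z, hK, hz⟩ := h.exists_isCompact_eventually tendsto_id hx
  obtain ⟨ℓ₀, hℓ₀⟩ := eventually_atTop.1 hz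
  refine ⟨z, ℓ₀, IsCompact.closure_of_subset hK ?_⟩
  rintro _ ⟨ℓ, hℓ, rfl⟩
  exact hℓ₀ ℓ hℓ

end OppositePhases

/-! ### Recovery states -/

theorem density_congr {x x' : State um up} {s : Set ℝ} (hs : IsOpen s)
    (h1 : ∀ᵐ y, y ∈ s → x'.1 y = x.1 y) (h2 : ∀ y ∈ s, x'.2 y = x.2 y) :
    ∀ᵐ y, y ∈ s → density x' y = density x y := by
  filter_upwards [h1] with y hy hys
  have : x'.2.val =ᶠ[𝓝 y] x.2.val := by
    filter_upwards [hs.mem_nhds hys] with t ht using h2 t ht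
  rw [density, density, hy hys, h2 y hys, this.deriv_eq]

namespace OppositePhases

variable (h : OppositePhases um up)
include h

/-- A state can be frozen outside `(-ℓ,ℓ)` without changing it in `(-(ℓ-2Φ),ℓ-2Φ)`, where
`Φ = φ_+`: the phase is cut off by two lines of slope `1`, and `u` is put in local equilibrium
with the phase in the boundary layer. There the phase stays as close to its limits as it was at
the edge of the layer. -/
theorem exists_recovery_state (x : State um up) {ℓ : ℝ} (hℓ : 2 * chem up < ℓ) :
    ∃ x' ∈ boxSet um up ℓ,
      (∀ᵐ y, y ∈ Ioo (-(ℓ - 2 * chem up)) (ℓ - 2 * chem up) → x'.1 y = x.1 y) ∧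
      (∀ y ∈ Ioo (-(ℓ - 2 * chem up)) (ℓ - 2 * chem up), x'.2 y = x.2 y) ∧
      (∀ᵐ y, y ∉ Ioo (-(ℓ - 2 * chem up)) (ℓ - 2 * chem up) →
        x'.1 y = Real.sigmoid (x'.2 y)) ∧
      ∀ y, y ∉ Ioo (-(ℓ - 2 * chem up)) (ℓ - 2 * chem up) →
        |x'.2 y - step (chem um) (chem up) y| ≤
          (chem up - x.2 (ℓ - 2 * chem up)) + (x.2 (-(ℓ - 2 * chem up)) + chem up) := by
  have hp := h.chem_up_pos
  have hc := h.chem_um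
  have hI := h.mem_Icc x
  set Φ := chem up with hΦ
  set r := ℓ - 2 * Φ with hr
  set f : ℝ → ℝ := fun y =>
    max (min (x.2 y) (max (-Φ) (y + (ℓ - Φ)))) (min Φ (y + (Φ - ℓ))) with hf
  have hs : UnitSlope f :=
    (x.2.unitSlope.min ((unitSlope_const _).max (unitSlope_add_const _))).max
      ((unitSlope_const _).min (unitSlope_add_const _))
  have hleft : ∀ y ≤ -ℓ, f y = -Φ := fun y hy => by
    simp only [hf]
    rw [max_eq_left (by linarith : y + (ℓ - Φ) ≤ -Φ), min_eq_right (hI y).1, max_eq_left]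
    exact (min_le_right _ _).trans (by linarith)
  have hright : ∀ y ≥ ℓ, f y = Φ := fun y hy => by
    simp only [hf]
    rw [min_eq_left (by linarith : Φ ≤ y + (Φ - ℓ)), max_eq_right]
    exact (min_le_left _ _).trans (hI y).2
  have hmid : ∀ y ∈ Icc (-r) r, f y = x.2 y := fun y hy => by
    simp only [hf]
    rw [min_eq_left, max_eq_left]
    · exact (min_le_right _ _).trans (by linarith [hy.2, (hI y).1])
    · exact le_trans (by linarith [hy.1, (hI y).2]) (le_max_right _ _)
  have hfI : ∀ y, f y ∈ Icc (-Φ) Φ := fun y =>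
    ⟨by
      have := hs.monotone (min_le_left y (-ℓ))
      rwa [hleft _ (min_le_right _ _)] at this, by
      have := hs.monotone (le_max_left y ℓ)
      rwa [hright _ (le_max_right _ _)] at this⟩
  set g : ℝ → ℝ := fun y =>
    if y ∈ Ioo (-r) r then max 0 (min 1 (x.1 y)) else Real.sigmoid (f y) with hg
  have hgm : AEMeasurable g := (Measurable.ite measurableSet_Ioo
    (measurable_const.max (measurable_const.min (Lp.stronglyMeasurable x.1.val).measurable))
    (differentiable_sigmoid.continuous.comp hs.continuous).measurable).aemeasurable
  have hgI : ∀ y, g y ∈ Icc (0 : ℝ) 1 := fun y => by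
    simp only [hg]
    split_ifs
    · exact ⟨le_max_left _ _, max_le zero_le_one (min_le_left _ _)⟩
    · exact ⟨(Real.sigmoid_pos _).le, (Real.sigmoid_lt_one _).le⟩
  have hcoe := LinfUnit.coeFn_ofFun g hgm hgI
  have hr0 : 0 < r := by linarith
  have hrl : r < ℓ := by linarith
  refine ⟨(LinfUnit.ofFun g hgm hgI, PhaseSpace.ofUnitSlope f hs ?_ ?_), ⟨?_, ?_, hright, ?_⟩,
    ?_, fun y hy => hmid y (Ioo_subset_Icc_self hy), ?_, fun y hy => ?_⟩
  · refine tendsto_const_nhds.congr' ?_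
    filter_upwards [eventually_le_atBot (-ℓ)] with y hy
    rw [hleft y hy, hc]
  · refine tendsto_const_nhds.congr' ?_
    filter_upwards [eventually_ge_atTop ℓ] with y hy using (hright y hy).symm
  · intro y hy
    exact (hleft y hy).trans hc.symm
  · filter_upwards [hcoe] with y hy hy'
    have : y ∉ Ioo (-r) r := fun h3 => by linarith [h3.1]
    rw [hy]
    simp only [hg]
    rw [if_neg this, hleft y hy', ← hc, h.sigmoid_um]
  · filter_upwards [hcoe] with y hy hy'
    have : y ∉ Ioo (-r) r := fun h3 => by linarith [h3.2]
    rw [hy]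
    simp only [hg]
    rw [if_neg this, hright y hy', h.sigmoid_up]
  · filter_upwards [hcoe, x.1.mem_unit] with y hy h1 hy'
    rw [hy]
    simp only [hg]
    rw [if_pos hy', min_eq_right h1.2, max_eq_right h1.1]
  · filter_upwards [hcoe] with y hy hy'
    rw [hy]
    simp only [hg]
    rw [if_neg hy']
    rfl
  · change |f y - _| ≤ _
    have h1 := (hI r).2
    have h2 := (hI (-r)).1
    have h3 := hfI y
    rcases lt_or_ge y 0 with hy0 | hy0
    · have h4 : y ≤ -r := by
        by_contra h4
        exact hy ⟨by linarith, by linarith⟩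
      have h5 := hs.monotone h4
      rw [hmid _ ⟨le_rfl, by linarith⟩] at h5
      rw [step, if_pos hy0, abs_of_nonneg (by linarith [h3.1])]
      linarith
    · have h4 : r ≤ y := by
        by_contra h4
        exact hy ⟨by linarith, by linarith⟩
      have h5 := hs.monotone h4
      rw [hmid _ ⟨by linarith, le_rfl⟩] at h5
      rw [step, if_neg (not_lt.2 hy0), abs_of_nonpos (by linarith [h3.2])]
      linarith

/-- The energy of a state that coincides with `x` in a smaller interval and is in local
equilibrium, close to the step, outside. -/
theorem integral_density_recovery_le {x x' : State um up} {ℓ r e : ℝ}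
    (hr : 0 < r) (hrl : r ≤ ℓ) (hx' : x' ∈ boxSet um up ℓ)
    (h1 : ∀ᵐ y, y ∈ Ioo (-r) r → x'.1 y = x.1 y) (h2 : ∀ y ∈ Ioo (-r) r, x'.2 y = x.2 y)
    (h3 : ∀ᵐ y, y ∉ Ioo (-r) r → x'.1 y = Real.sigmoid (x'.2 y))
    (h4 : ∀ y, y ∉ Ioo (-r) r → |x'.2 y - step (chem um) (chem up) y| ≤ e) :
    ∫ y, density x' y ≤
      (∫ y in Ioo (-r) r, density x y) + 2 * (ℓ - r) * ((up * um)⁻¹ * e) := by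
  have hℓ : 0 < ℓ := hr.trans_le hrl
  have hA := h.mul_pos
  have hsub : Ioo (-r) r ⊆ Ioo (-ℓ) ℓ := Ioo_subset_Ioo (by linarith) hrl
  have i0 := (h.integrable_density (h.mem_domainD_of_mem_boxSet hℓ hx')).integrableOn
    (s := Ioo (-ℓ) ℓ)
  have hv : volume.real (Ioo (-ℓ) ℓ \ Ioo (-r) r) = 2 * (ℓ - r) := by
    rw [measureReal_sdiff hsub measurableSet_Ioo (by simp),
      Real.volume_real_Ioo_of_le (by linarith),
      Real.volume_real_Ioo_of_le (by linarith)]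
    ring
  have hfin : volume (Ioo (-ℓ) ℓ \ Ioo (-r) r) ≠ ∞ :=
    ne_top_of_le_ne_top (by simp : volume (Ioo (-ℓ) ℓ) ≠ ∞) (measure_mono sdiff_subset)
  have hm : MeasurableSet (Ioo (-ℓ) ℓ \ Ioo (-r) r) := measurableSet_Ioo.diff measurableSet_Ioo
  have e1 : ∫ y in Ioo (-r) r, density x' y = ∫ y in Ioo (-r) r, density x y :=
    setIntegral_congr_ae measurableSet_Ioo (density_congr isOpen_Ioo h1 h2)
  have e2 : ∫ y in Ioo (-ℓ) ℓ \ Ioo (-r) r, density x' y ≤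
      ∫ _ in Ioo (-ℓ) ℓ \ Ioo (-r) r, (up * um)⁻¹ * e := by
    refine setIntegral_mono_on_ae (i0.mono_set sdiff_subset) (integrableOn_const hfin) hm ?_
    filter_upwards [h3] with y hy hys
    have k1 := h4 y hys.2
    have k2 := h.log_mobility_le (h.mem_Icc x' y) (step_eq_or (chem um) (chem up) y)
    have k3 := entropy_nonpos (x'.2.unitSlope.deriv_mem y)
    have k4 := mul_le_mul_of_nonneg_left k1 (inv_nonneg.2 hA.le)
    rw [density, h.gFun_sub, hy hys.2, kl_self (Real.sigmoid_pos _) (Real.sigmoid_lt_one _)]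
    linarith
  rw [setIntegral_const, hv, smul_eq_mul] at e2
  rw [← h.setIntegral_density hx', ← sdiff_union_of_subset hsub,
    setIntegral_union disjoint_sdiff_left measurableSet_Ioo (i0.mono_set sdiff_subset)
      (i0.mono_set hsub), e1]
  linarith

/-! ### Γ-convergence -/

theorem exists_recovery_family (x : State um up) : ∃ y : ℝ → State um up,
    Tendsto y atTop (𝓝 x) ∧
      limsup (fun ℓ => energyBox um up ℓ (y ℓ)) atTop ≤ energy um up x := by
  by_cases hx : x ∈ domainD um up
  swap
  · refine ⟨fun _ => x, tendsto_const_nhds, ?_⟩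
    rw [energy, if_neg hx]
    exact le_top
  have hp := h.chem_up_pos
  have hex : ∀ ℓ : ℝ, ∃ x' : State um up, 2 * chem up < ℓ → x' ∈ boxSet um up ℓ ∧ _ := fun ℓ => by
    by_cases hℓ : 2 * chem up < ℓ
    · obtain ⟨x', hx'⟩ := h.exists_recovery_state x hℓ
      exact ⟨x', fun _ => hx'⟩
    · exact ⟨x, fun h' => absurd h' hℓ⟩
  choose y hy using hex
  have hrad : Tendsto (fun ℓ => ℓ - 2 * chem up) atTop atTop :=
    tendsto_atTop_add_const_right _ _ tendsto_id
  have hrad' : Tendsto (fun ℓ => -(ℓ - 2 * chem up)) atTop atBot :=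
    tendsto_neg_atTop_atBot.comp hrad
  have hmem : ∀ t : ℝ, ∀ᶠ ℓ in atTop, t ∈ Ioo (-(ℓ - 2 * chem up)) (ℓ - 2 * chem up) := fun t =>
    (hrad'.eventually_lt_atBot t).and (hrad.eventually_gt_atTop t)
  refine ⟨y, (Prod.tendsto_iff _ _).2 ⟨?_, ?_⟩, ?_⟩
  · refine LinfUnit.tendsto_of_ae_eq (g := fun ℓ t =>
      if t ∈ Ioo (-(ℓ - 2 * chem up)) (ℓ - 2 * chem up) then x.1 t else (y ℓ).1 t)
      (g₀ := fun t => x.1 t) ?_ (Eventually.of_forall fun _ => rfl)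
      (Eventually.of_forall fun t => ?_)
    · filter_upwards [eventually_gt_atTop (2 * chem up)] with ℓ hℓ
      filter_upwards [(hy ℓ hℓ).2.1] with t ht
      split_ifs with h1
      · exact ht h1
      · rfl
    · refine tendsto_const_nhds.congr' ?_
      filter_upwards [hmem t] with ℓ hℓ
      rw [if_pos hℓ]
  · refine PhaseSpace.tendsto_of_pointwise fun t => tendsto_const_nhds.congr' ?_
    filter_upwards [hmem t, eventually_gt_atTop (2 * chem up)] with ℓ h1 hℓ
    exact ((hy ℓ hℓ).2.2.1 t h1).symm
  · set E : ℝ → ℝ := fun ℓ =>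
      (∫ t in Ioo (-(ℓ - 2 * chem up)) (ℓ - 2 * chem up), density x t) +
        2 * (ℓ - (ℓ - 2 * chem up)) * ((up * um)⁻¹ *
          ((chem up - x.2 (ℓ - 2 * chem up)) + (x.2 (-(ℓ - 2 * chem up)) + chem up))) with hE
    have hElim : Tendsto E atTop (𝓝 (∫ t, density x t)) := by
      have k1 := (aecover_Ioo (μ := (volume : Measure ℝ)) hrad'
        hrad).integral_tendsto_of_countably_generated (h.integrable_density hx)
      have k2 := (x.2.tendsto_atTop.comp hrad).const_sub (chem up)
      have k3 := (x.2.tendsto_atBot.comp hrad').add_const (chem up)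
      have k4 := ((k2.add k3).const_mul (up * um)⁻¹).const_mul (2 * (2 * chem up))
      have hc := h.chem_um
      have hz : 2 * (2 * chem up) * ((up * um)⁻¹ * (chem up - chem up + (chem um + chem up))) =
          0 := by rw [hc]; ring
      rw [hz] at k4
      have k5 := k1.add k4
      rw [add_zero] at k5
      refine k5.congr fun ℓ => ?_
      simp only [hE, Function.comp_apply]
      ring
    have hle : ∀ᶠ ℓ in atTop, energyBox um up ℓ (y ℓ) ≤ ((E ℓ : ℝ) : EReal) := by
      filter_upwards [eventually_gt_atTop (2 * chem up)] with ℓ hℓ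
      obtain ⟨h0, h1, h2, h3, h4⟩ := hy ℓ hℓ
      rw [energyBox, if_pos h0, h.setIntegral_density h0, EReal.coe_le_coe_iff]
      exact h.integral_density_recovery_le (by linarith) (by linarith) h0 h1 h2 h3 h4
    rw [energy, if_pos hx]
    refine (limsup_le_limsup hle).trans_eq ?_
    exact ((continuous_coe_real_ereal.tendsto _).comp hElim).limsup_eq

theorem gammaTendsto_energyBox : GammaTendsto (energyBox um up) (energy um up) := by
  refine ⟨fun x L y hL hy => ?_, h.exists_recovery_family⟩
  have h1 := (lowerSemicontinuousAt_iff_le_liminf.1 (h.lowerSemicontinuous_energy x))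
  refine h1.trans ((liminf_le_liminf_of_le hy).trans ?_)
  rw [← liminf_comp]
  refine liminf_le_liminf ?_
  filter_upwards [hL.eventually_gt_atTop 0] with n hn using h.energy_le_energyBox hn _

end OppositePhases

end BurgersGamma

theorem theoremt (um up : ℝ) (h_um : 0 < um) (h_lt : um < up) (h_up : up < 1)
    (h_sum : um + up = 1) :
    -- (i) the energy density is integrable on `D`, so that `G` is given there by a true integral
    (∀ x ∈ domainD um up, Integrable (density x)) ∧
    -- upper and lower bounds
    (∃ C : ℝ, 1 < C ∧ ∀ x ∈ domainD um up,
      energy um up x ≤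
        (C : EReal) * (((devU 0 x) ^ 2 + devPhi 0 x : ℝ≥0∞) : EReal) + (C : EReal) ∧
      ∃ z : ℝ,
        ((1 / C : ℝ) : EReal) * (((devU z x) ^ 2 + devPhi z x : ℝ≥0∞) : EReal) - (C : EReal)
          ≤ energy um up x) ∧
    -- lower semicontinuity
    LowerSemicontinuous (energy um up) ∧
    -- the solutions on the whole line are the translates of the standing wave
    (∀ v : ℝ → ℝ, IsStandingWave um up v ↔ ∃ z : ℝ, v = fun y => ubar up (y - z)) ∧
    -- minimizers of `G`
    {x : State um up | ∀ x', energy um up x ≤ energy um up x'} =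
      {x | ∃ v, IsStandingWave um up v ∧ IsPairOf x v} ∧
    (∃ xbar : State um up, IsPairOf xbar (ubar up) ∧
      {x : State um up | ∀ x', energy um up x ≤ energy um up x'} =
        Set.range (fun z : ℝ => translate z xbar) ∧
      -- (ii) convergence of the finite volume solutions, which are the unique minimizers of `G_ℓ`
      -- as soon as `G_ℓ` is not identically infinite
      (∃ (v : ℝ → ℝ → ℝ) (xl : ℝ → State um up),
        (∀ ℓ : ℝ, 0 < ℓ → IsBoxSolution um up ℓ (v ℓ) ∧
          ∀ w, IsBoxSolution um up ℓ w → Set.EqOn w (v ℓ) (Set.Icc (-ℓ) ℓ)) ∧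
        (∀ ℓ : ℝ, chem up ≤ ℓ → IsPairOf (xl ℓ) (extendBox um up ℓ (v ℓ)) ∧
          {x : State um up | ∀ x', energyBox um up ℓ x ≤ energyBox um up ℓ x'} = {xl ℓ}) ∧
        Tendsto xl atTop (𝓝 xbar))) ∧
    -- compactness modulo translations, along sequences `ℓ_n → ∞` and for families indexed by `ℓ`
    (∀ (L : ℕ → ℝ) (x : ℕ → State um up), Tendsto L atTop atTop →
      limsup (fun n => energyBox um up (L n) (x n)) atTop < ⊤ →
      ∃ z : ℕ → ℝ, IsCompact (closure (Set.range fun n => translate (z n) (x n)))) ∧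
    (∀ x : ℝ → State um up,
      limsup (fun ℓ => energyBox um up ℓ (x ℓ)) atTop < ⊤ →
      ∃ (z : ℝ → ℝ) (ℓ₀ : ℝ),
        IsCompact (closure ((fun ℓ => translate (z ℓ) (x ℓ)) '' Set.Ici ℓ₀))) ∧
    -- `Γ`-convergence
    GammaTendsto (energyBox um up) (energy um up) := by
  have h : OppositePhases um up := ⟨h_um, h_lt, h_sum⟩
  obtain ⟨xbar, hxb⟩ := h.exists_standingWave_state
  have : Nonempty (State um up) := ⟨xbar⟩
  choose! xl hxl using fun ℓ (hℓ : chem up ≤ ℓ) => h.exists_boxSolution_state hℓ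
  exact ⟨fun x hx => h.integrable_density hx, h.energy_bounds, h.lowerSemicontinuous_energy,
    h.isStandingWave_iff, h.minimizers_eq,
    ⟨xbar, hxb, h.minimizers_eq_range hxb, fun ℓ => profile (boxRate up ℓ), xl,
      fun ℓ hℓ => ⟨h.isBoxSolution_profile hℓ, fun w hw => h.eqOn_of_isBoxSolution hℓ hw⟩,
      fun ℓ hℓ => ⟨hxl ℓ hℓ, h.minimizers_energyBox hℓ (hxl ℓ hℓ)⟩,
      h.tendsto_boxSolution hxl hxb⟩,
    fun L x hL hx => h.isCompact_closure_range hL hx,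
    fun x hx => h.isCompact_closure_image hx, h.gammaTendsto_energyBox⟩
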